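/- Let $n\ge 2$, let $\Omega\subset\mathbb{R}^n$ be a domain (open and connected) with Lebesgue measure $|\Omega|=1$, and let $1\le p\le \frac{n}{n-1}$. For a measurable $f$ on $\Omega$ let $f^*(t)=\inf\{\lambda\ge 0: |\{|f|>\lambda\}|\le t\}$ be its decreasing rearrangement, $f^{**}(t)=\frac1t\int_0^t f^*(s)\,ds$, $f_\Omega=\frac{1}{|\Omega|}\int_\Omega f$, and $\|f\|_{L^{p,1}(\Omega)}=\int_0^1 s^{1/p-1}f^*(s)\,ds$. For a rearrangement invariant (r.i.) Banach function space $X(\Omega)$ in the sense of Bennett and Sharpley, let $\hat X=\hat X(0,1)$ be its Luxemburg representation on $(0,1)$, and let $W^1_X(\Omega)=\{f\in X(\Omega): |\nabla f|\in X(\Omega)\}$, with $\nabla f$ the weak gradient. Consider the following conditions. (i) There is a constant $C$ such that for all $f\in W^{1,1}(\Omega)$ $$\Big(\int_\Omega |f-f_\Omega|^p\,dx\Big)^{1/p}\le C\int_\Omega|\nabla f|\,dx .$$ (ii) There is a constant $C$ such that for each $f\in W^{1,1}(\Omega)$ there is $r_f\in\mathbb{R}$ with $$s^{\frac1p-1}\big[(f-r_f)^{**}(s)-(f-r_f)^{*}(s)\big]\le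 \frac{C}{s}\int_0^s|\nabla f|^*(u)\,du,\qquad 0<s<1,$$ and $$\int_0^t s^{\frac1p-1}\big[(f-r_f)^{**}(s)-(f-r_f)^{*}(s)\big]\,ds\le C\int_0^t|\nabla f|^*(s)\,ds,\qquad 0<t<1 .$$ (iii) For every r.i. space $X(\Omega)$ (with no condition on its Boyd indices) there is a constant $C$ such that for all $f\in W^1_X(\Omega)$ $$\inf_{c\in\mathbb{R}}\Big\|s^{\frac1p-1}\big[(f-c)^{**}(s)-(f-c)^{*}(s)\big]\Big\|_{\hat X}\le C\,\|\nabla f\|_{X(\Omega)} .$$ (iii') Condition (iii) holds with one constant $C$ for all r.i. spaces $X(\Omega)$. (iv) There is a constant $C$ such that for all $f\in W^{1,1}(\Omega)$ $$\|f-f_\Omega\|_{L^{p,1}(\Omega)}\le C\,\|\nabla f\|_{L^1(\Omega)} .$$ If $1<p\le\frac{n}{n-1}$, then (i), (ii), (iii), (iii') and (iv) are equivalent. For all $1\le p\le\frac{n}{n-1}$, including $p=1$, (i) and (iv) are equivalent, (ii) implies (iii'), and (iii) implies (iv). -/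

import Mathlib

open MeasureTheory Set
open scoped ENNReal NNReal ContDiff

noncomputable section

namespace SobolevPoincare

/-! ### Rearrangements -/

section Rearrangement

variable {α : Type*} [MeasurableSpace α]

/-- The decreasing rearrangement `f^*(t) = inf {l ≥ 0 : μ {f > l} ≤ t}` of a nonnegative function.
For a real or vector valued function it is applied to `|f|`, written `fun x => ‖f x‖ₑ`. -/
def decrRearr (μ : Measure α) (f : α → ℝ≥0∞) (t : ℝ) : ℝ≥0∞ :=
  sInf {l : ℝ≥0∞ | μ {x | l < f x} ≤ ENNReal.ofReal t}

/-- `f^{**}(t) = (1/t) ∫_0^t f^*(s) ds`. -/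
def avgRearr (μ : Measure α) (f : α → ℝ≥0∞) (t : ℝ) : ℝ≥0∞ :=
  (∫⁻ s in Ioo 0 t, decrRearr μ f s) / ENNReal.ofReal t

/-- `s ↦ s^{1/p-1} [f^{**}(s) - f^*(s)]`. For `f` integrable and `s > 0` both terms are finite and
`f^* ≤ f^{**}`, so that the subtraction is the true one. -/
def oscRearr (p : ℝ) (μ : Measure α) (f : α → ℝ≥0∞) (s : ℝ) : ℝ≥0∞ :=
  ENNReal.ofReal (s ^ (1 / p - 1)) * (avgRearr μ f s - decrRearr μ f s)

/-- The Lorentz norm of `L^{p,1}` over a space of total mass one: `∫_0^1 s^{1/p} f^*(s) ds/s`. -/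
def lorentzNorm (p : ℝ) (μ : Measure α) (f : α → ℝ≥0∞) : ℝ≥0∞ :=
  ∫⁻ s in Ioo (0 : ℝ) 1, ENNReal.ofReal (s ^ (1 / p - 1)) * decrRearr μ f s

/-! ### Rearrangement invariant spaces -/

/-- `ρ` is a rearrangement invariant Banach function norm (in the sense of Bennett and Sharpley)
on the nonnegative measurable functions of `(α, μ)`. The r.i. space `X` it defines consists of the
measurable `f` with `‖f‖_X = ρ |f| < ⊤`. Only the values of `ρ` at measurable functions matter. -/
structure IsRINorm (μ : Measure α) (ρ : (α → ℝ≥0∞) → ℝ≥0∞) : Prop where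
  eq_zero_iff : ∀ f, AEMeasurable f μ → (ρ f = 0 ↔ f =ᵐ[μ] 0)
  smul : ∀ (a : ℝ≥0) (f), AEMeasurable f μ → ρ (fun x => a * f x) = a * ρ f
  add_le : ∀ f g, AEMeasurable f μ → AEMeasurable g μ → ρ (fun x => f x + g x) ≤ ρ f + ρ g
  mono : ∀ f g, AEMeasurable f μ → AEMeasurable g μ → f ≤ᵐ[μ] g → ρ f ≤ ρ g
  fatou : ∀ f : ℕ → α → ℝ≥0∞, (∀ k, AEMeasurable (f k) μ) →
    (∀ᵐ x ∂μ, Monotone fun k => f k x) → ρ (fun x => ⨆ k, f k x) = ⨆ k, ρ (f k)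
  indicator_lt_top : ∀ A, MeasurableSet A → μ A < ⊤ → ρ (A.indicator fun _ => 1) < ⊤
  lintegral_le : ∀ A, MeasurableSet A → μ A < ⊤ →
    ∃ C : ℝ≥0, ∀ f, AEMeasurable f μ → ∫⁻ x in A, f x ∂μ ≤ C * ρ f
  rearr_inv : ∀ f g, AEMeasurable f μ → AEMeasurable g μ →
    (∀ l : ℝ≥0∞, μ {x | l < f x} = μ {x | l < g x}) → ρ f = ρ g

/-- The associate norm `ρ'(g) = sup {∫ f g dμ : ρ f ≤ 1}`. -/
def assocNorm (μ : Measure α) (ρ : (α → ℝ≥0∞) → ℝ≥0∞) (g : α → ℝ≥0∞) : ℝ≥0∞ :=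
  ⨆ (f : α → ℝ≥0∞) (_ : AEMeasurable f μ) (_ : ρ f ≤ 1), ∫⁻ x, f x * g x ∂μ

/-- The norm of `X̂(0,1)`, the Luxemburg representation on `(0,1)` of the r.i. space given by `ρ`
over a space of total mass one: `ρ̂(h) = sup {∫_0^1 h^*(s) g^*(s) ds : ρ'(g) ≤ 1}`. It is the
r.i. norm on `(0,1)` with `ρ f = ρ̂(f^*)` for all `f`. -/
def hatNorm (μ : Measure α) (ρ : (α → ℝ≥0∞) → ℝ≥0∞) (h : ℝ → ℝ≥0∞) : ℝ≥0∞ :=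
  ⨆ (g : α → ℝ≥0∞) (_ : AEMeasurable g μ) (_ : assocNorm μ ρ g ≤ 1),
    ∫⁻ s in Ioo (0 : ℝ) 1, decrRearr (volume.restrict (Ioo (0 : ℝ) 1)) h s * decrRearr μ g s

end Rearrangement

/-! ### Sobolev spaces -/

section Sobolev

variable {n : ℕ}

/-- `G` is the weak gradient of `f` in the open set `Ω`. -/
def HasWeakGradient (Ω : Set (EuclideanSpace ℝ (Fin n))) (f : EuclideanSpace ℝ (Fin n) → ℝ)
    (G : EuclideanSpace ℝ (Fin n) → EuclideanSpace ℝ (Fin n)) : Prop :=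
  LocallyIntegrableOn f Ω ∧ LocallyIntegrableOn G Ω ∧
    ∀ φ : EuclideanSpace ℝ (Fin n) → ℝ, ContDiff ℝ ∞ φ → HasCompactSupport φ → tsupport φ ⊆ Ω →
      ∀ v : EuclideanSpace ℝ (Fin n),
        ∫ x in Ω, f x * fderiv ℝ φ x v = - ∫ x in Ω, φ x * inner ℝ (G x) v

/-- `f ∈ W^{1,1}(Ω)` with weak gradient `G`. -/
def MemW11 (Ω : Set (EuclideanSpace ℝ (Fin n))) (f : EuclideanSpace ℝ (Fin n) → ℝ)
    (G : EuclideanSpace ℝ (Fin n) → EuclideanSpace ℝ (Fin n)) : Prop :=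
  HasWeakGradient Ω f G ∧ IntegrableOn f Ω ∧ IntegrableOn G Ω

/-- `f ∈ W^1_X(Ω)` with weak gradient `G`, where the r.i. space `X(Ω)` is given by `ρ`. -/
def MemW1X (Ω : Set (EuclideanSpace ℝ (Fin n)))
    (ρ : (EuclideanSpace ℝ (Fin n) → ℝ≥0∞) → ℝ≥0∞) (f : EuclideanSpace ℝ (Fin n) → ℝ)
    (G : EuclideanSpace ℝ (Fin n) → EuclideanSpace ℝ (Fin n)) : Prop :=
  HasWeakGradient Ω f G ∧ ρ (fun x => ‖f x‖ₑ) < ⊤ ∧ ρ (fun x => ‖G x‖ₑ) < ⊤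

/-! ### The four conditions -/

/-- `(∫_Ω |f - f_Ω|^p)^{1/p} ≤ C ∫_Ω |∇f|` on `W^{1,1}(Ω)`. -/
def PoincareLp (Ω : Set (EuclideanSpace ℝ (Fin n))) (p : ℝ) : Prop :=
  ∃ C : ℝ≥0, ∀ f G, MemW11 Ω f G →
    eLpNorm (fun x => f x - ⨍ y in Ω, f y) (ENNReal.ofReal p) (volume.restrict Ω)
      ≤ C * ∫⁻ x in Ω, ‖G x‖ₑ

/-- The pointwise and the integrated rearrangement inequality on `W^{1,1}(Ω)`, for one real `r`
depending on `f` and a constant independent of `f`. -/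
def RearrIneq (Ω : Set (EuclideanSpace ℝ (Fin n))) (p : ℝ) : Prop :=
  ∃ C : ℝ≥0, ∀ f G, MemW11 Ω f G → ∃ r : ℝ,
    (∀ s ∈ Ioo (0 : ℝ) 1, oscRearr p (volume.restrict Ω) (fun x => ‖f x - r‖ₑ) s
      ≤ C * avgRearr (volume.restrict Ω) (fun x => ‖G x‖ₑ) s) ∧
    (∀ t ∈ Ioo (0 : ℝ) 1,
      ∫⁻ s in Ioo 0 t, oscRearr p (volume.restrict Ω) (fun x => ‖f x - r‖ₑ) s
        ≤ C * ∫⁻ s in Ioo 0 t, decrRearr (volume.restrict Ω) (fun x => ‖G x‖ₑ) s)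

/-- `inf_c ‖s^{1/p-1} [(f-c)^{**}(s) - (f-c)^*(s)]‖_X̂ ≤ C ‖∇f‖_X` on `W^1_X(Ω)`, for the one
r.i. space `X(Ω)` given by `ρ` and the one constant `C`. -/
def RISobolev (Ω : Set (EuclideanSpace ℝ (Fin n))) (p : ℝ)
    (ρ : (EuclideanSpace ℝ (Fin n) → ℝ≥0∞) → ℝ≥0∞) (C : ℝ≥0) : Prop :=
  ∀ f G, MemW1X Ω ρ f G →
    ⨅ c : ℝ, hatNorm (volume.restrict Ω) ρ
      (oscRearr p (volume.restrict Ω) (fun x => ‖f x - c‖ₑ)) ≤ C * ρ (fun x => ‖G x‖ₑ)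

/-- The previous inequality for every r.i. space, with a constant that may depend on the space. -/
def RISobolevAll (Ω : Set (EuclideanSpace ℝ (Fin n))) (p : ℝ) : Prop :=
  ∀ ρ, IsRINorm (volume.restrict Ω) ρ → ∃ C : ℝ≥0, RISobolev Ω p ρ C

/-- The previous inequality for every r.i. space, with one constant for all of them. -/
def RISobolevUniform (Ω : Set (EuclideanSpace ℝ (Fin n))) (p : ℝ) : Prop :=
  ∃ C : ℝ≥0, ∀ ρ, IsRINorm (volume.restrict Ω) ρ → RISobolev Ω p ρ C

/-- `‖f - f_Ω‖_{L^{p,1}(Ω)} ≤ C ‖∇f‖_{L^1(Ω)}` on `W^{1,1}(Ω)`. -/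
def PoincareLorentz (Ω : Set (EuclideanSpace ℝ (Fin n))) (p : ℝ) : Prop :=
  ∃ C : ℝ≥0, ∀ f G, MemW11 Ω f G →
    lorentzNorm p (volume.restrict Ω) (fun x => ‖f x - ⨍ y in Ω, f y‖ₑ)
      ≤ C * ∫⁻ x in Ω, ‖G x‖ₑ

end Sobolev

end SobolevPoincare

end

open MeasureTheory Set
open scoped ENNReal NNReal ContDiff

noncomputable section

namespace SobolevPoincare

/-! ### Decreasing rearrangements: distribution functions, equimeasurability, Lorentz norms. -/

section Rearrangement

variable {α : Type*} [MeasurableSpace α] {μ : Measure α} {f g : α → ℝ≥0∞}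

/-! The equivalence of (i) and (iv) is Maz'ya's truncation principle. A Poincaré inequality in `L^p`
applied to the slices of `f` between the levels `2^k` and `2^(k+1)` gives a weak-type bound for each
slice. The gradients of the slices live on disjoint sets, so the bounds add up to an `L^{p,1}` bound
(`lorentzNorm_le_of_poincareLp`). The converse is the inclusion of `L^{p,1}` in `L^p`.

The truncation argument also localizes. Let `m` be a median of `f` and `g = |f - m|`. Then `(g -
g^*(t))_+` has `L^{p,1}` norm at most a constant times the integral of `|∇f|` over `{g > g^*(t)}`, a
set of measure at most `t`, hence at most a constant times `∫_0^t |∇f|^*`. The pointwise half of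
(ii) follows since the weight decreases, and the integrated half follows from Hardy's inequality,
which needs `p > 1`.

From (ii), cutting a set `E` at the point `|E|` shows that the oscillation has integral at most `2C
∫_0^{|E|} |∇f|^*` over `E`. By the layer cake formula this passes to integrals against any `g^*`.
Since Lebesgue measure has no atoms, `∫ |∇f|^* g^*` is at most the norm of `|∇f|` whenever `g` has
associate norm at most one (`lintegral_decrRearr_mul_decrRearr_le`). Neither Boyd indices nor the
choice of the space enters, which gives (iii').

The delicate step is from (iii) to (iv). Only `X = L^1` is used, but the oscillation sees `|f - c|`
alone: it vanishes when `|f - c|` is constant, that is, when `f` takes two values `c ± m`. So (iii)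
says only that every `f` is, up to its gradient, close to two values (`exists_two_values`).
Connectedness removes the second value. Suppose the Poincaré inequality in `L^1` fails. Chains of
balls give it on parts of `Ω` of almost full measure, so there are `f₁`, `f₂` of norm one with tiny
gradients which are concentrated on tiny sets, essentially disjoint ones. Both `f₁ + f₂` and `f₁ -
f₂` are close to two values, one of which may be taken to be `0`; a comparison of signs forces `f₁`
or `f₂` to be small, a contradiction.

With the `L^1` inequality at hand, a function with small `L^1` norm and small gradient has a
positive or a negative part that is small in `L^{p,1}`. If (iv) failed, there would be two such
functions with large positive parts whose minimum is negligible in `L^{p,1}`. Then both parts of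
their difference are large, a contradiction. -/

theorem lt_decrRearr_iff {t : ℝ} {l : ℝ≥0∞} :
    l < decrRearr μ f t ↔ ENNReal.ofReal t < μ {x | l < f x} := by
  constructor
  · intro h
    by_contra hc
    exact absurd (sInf_le (show l ∈ {l : ℝ≥0∞ | μ {x | l < f x} ≤ ENNReal.ofReal t} from
      not_lt.1 hc)) (not_le.2 h)
  · intro h
    have hl : l < ⊤ := by
      by_contra hl
      have : l = ⊤ := by simpa using hl
      simp [this] at h
    obtain ⟨u, -, hu, hlim⟩ := exists_seq_strictAnti_tendsto' hl
    -- Right-continuity of the distribution function; it makes the infimum defining `f^*` attained.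
    have hU : {x | l < f x} = ⋃ k, {x | u k < f x} := by
      ext x
      simp only [mem_ofPred_eq, mem_iUnion]
      constructor
      · intro hx
        exact ((hlim.eventually (gt_mem_nhds hx))).exists
      · rintro ⟨k, hk⟩
        exact (hu k).1.trans hk
    rw [hU, Directed.measure_iUnion, lt_iSup_iff] at h
    · obtain ⟨k, hk⟩ := h
      refine (hu k).1.trans_le (le_sInf fun b hb => ?_)
      by_contra hlt
      exact absurd (hb.trans_lt hk) (not_lt.2 (measure_mono fun x hx => (not_le.1 hlt).trans hx))
    · intro i j
      rcases le_total (u i) (u j) with hij | hij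
      · exact ⟨i, subset_rfl, fun x hx => lt_of_le_of_lt hij hx⟩
      · exact ⟨j, fun x hx => lt_of_le_of_lt hij hx, subset_rfl⟩

theorem decrRearr_le_iff {t : ℝ} {l : ℝ≥0∞} :
    decrRearr μ f t ≤ l ↔ μ {x | l < f x} ≤ ENNReal.ofReal t := by
  rw [← not_lt, lt_decrRearr_iff, not_lt]

theorem decrRearr_antitone (μ : Measure α) (f : α → ℝ≥0∞) : Antitone (decrRearr μ f) :=
  fun _ _ h => sInf_le_sInf fun _ hl => le_trans hl (ENNReal.ofReal_le_ofReal h)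

theorem measurable_decrRearr (μ : Measure α) (f : α → ℝ≥0∞) : Measurable (decrRearr μ f) :=
  (decrRearr_antitone μ f).measurable

theorem decrRearr_mono_ae (h : f ≤ᵐ[μ] g) (t : ℝ) : decrRearr μ f t ≤ decrRearr μ g t :=
  sInf_le_sInf fun _ hl =>
    (measure_mono_ae (h.mono fun _ hx hlx => lt_of_lt_of_le hlx hx)).trans hl

theorem decrRearr_congr_ae (h : f =ᵐ[μ] g) : decrRearr μ f = decrRearr μ g :=
  funext fun t => le_antisymm (decrRearr_mono_ae h.le t) (decrRearr_mono_ae h.symm.le t)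

theorem decrRearr_tsub_const (m : ℝ≥0∞) (t : ℝ) :
    decrRearr μ (fun x => f x - m) t = decrRearr μ f t - m := by
  refine eq_of_forall_lt_iff fun l => ?_
  simp only [lt_decrRearr_iff, lt_tsub_iff_right]

theorem decrRearr_const_mul {a : ℝ≥0} (ha : a ≠ 0) (t : ℝ) :
    decrRearr μ (fun x => a * f x) t = a * decrRearr μ f t := by
  have h0 : (a : ℝ≥0∞) ≠ 0 := by simpa using ha
  refine eq_of_forall_lt_iff fun l => ?_
  have key : ∀ y : ℝ≥0∞, l < a * y ↔ l / a < y := fun y => by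
    rw [mul_comm, ENNReal.div_lt_iff (Or.inl h0) (Or.inl ENNReal.coe_ne_top)]
  simp only [lt_decrRearr_iff, key]

theorem decrRearr_indicator_le (A : Set α) {t : ℝ} (h : μ A ≤ ENNReal.ofReal t) :
    decrRearr μ (A.indicator f) t = 0 := by
  rw [← nonpos_iff_eq_zero, decrRearr_le_iff]
  refine (measure_mono fun x hx => ?_).trans h
  by_contra hxA
  simp [hxA] at hx

section Prob

variable [IsProbabilityMeasure μ]

theorem Ioo_inter_lt_decrRearr (l : ℝ≥0∞) :
    {s | l < decrRearr μ f s} ∩ Ioo (0 : ℝ) 1 = Ioo 0 (μ {x | l < f x}).toReal := by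
  ext s
  have h1 : μ {x | l < f x} ≠ ⊤ := measure_ne_top _ _
  have h2 : (μ {x | l < f x}).toReal ≤ 1 := by
    simpa using ENNReal.toReal_mono ENNReal.one_ne_top (prob_le_one (μ := μ) (s := {x | l < f x}))
  simp only [mem_inter_iff, mem_ofPred_eq, mem_Ioo, lt_decrRearr_iff]
  constructor
  · rintro ⟨h, h0, -⟩
    exact ⟨h0, (ENNReal.ofReal_lt_iff_lt_toReal h0.le h1).1 h⟩
  · rintro ⟨h0, h⟩
    exact ⟨(ENNReal.ofReal_lt_iff_lt_toReal h0.le h1).2 h, h0, h.trans_le h2⟩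

theorem volume_lt_decrRearr (l : ℝ≥0∞) :
    volume.restrict (Ioo (0 : ℝ) 1) {s | l < decrRearr μ f s} = μ {x | l < f x} := by
  rw [Measure.restrict_apply' measurableSet_Ioo, Ioo_inter_lt_decrRearr, Real.volume_Ioo, sub_zero,
    ENNReal.ofReal_toReal (measure_ne_top _ _)]

instance isProbabilityMeasure_Ioo :
    IsProbabilityMeasure (volume.restrict (Ioo (0 : ℝ) 1)) := ⟨by simp⟩

theorem map_eq_of_distrib {β : Type*} [MeasurableSpace β] {ν : Measure β} [IsProbabilityMeasure ν]
    {k : β → ℝ≥0∞} (hf : AEMeasurable f μ) (hk : AEMeasurable k ν)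
    (h : ∀ l : ℝ≥0∞, μ {x | l < f x} = ν {x | l < k x}) : μ.map f = ν.map k := by
  have : IsProbabilityMeasure (μ.map f) := Measure.isProbabilityMeasure_map hf
  have : IsProbabilityMeasure (ν.map k) := Measure.isProbabilityMeasure_map hk
  refine Measure.ext_of_Iic _ _ fun l => ?_
  have hc : (Iic l)ᶜ = Ioi l := compl_Iic
  have e1 : μ.map f (Ioi l) = ν.map k (Ioi l) := by
    rw [Measure.map_apply_of_aemeasurable hf measurableSet_Ioi,
      Measure.map_apply_of_aemeasurable hk measurableSet_Ioi]
    exact h l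
  rw [← compl_Ioi, prob_compl_eq_one_sub measurableSet_Ioi,
    prob_compl_eq_one_sub measurableSet_Ioi, e1]

theorem lintegral_comp_eq_of_distrib {β : Type*} [MeasurableSpace β] {ν : Measure β}
    [IsProbabilityMeasure ν] {k : β → ℝ≥0∞} (hf : AEMeasurable f μ) (hk : AEMeasurable k ν)
    (h : ∀ l : ℝ≥0∞, μ {x | l < f x} = ν {x | l < k x}) {Φ : ℝ≥0∞ → ℝ≥0∞} (hΦ : Measurable Φ) :
    ∫⁻ x, Φ (f x) ∂μ = ∫⁻ y, Φ (k y) ∂ν := by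
  rw [← lintegral_map' hΦ.aemeasurable hf, ← lintegral_map' hΦ.aemeasurable hk,
    map_eq_of_distrib hf hk h]

theorem lintegral_comp_decrRearr (hf : AEMeasurable f μ) {Φ : ℝ≥0∞ → ℝ≥0∞} (hΦ : Measurable Φ) :
    ∫⁻ s in Ioo (0 : ℝ) 1, Φ (decrRearr μ f s) = ∫⁻ x, Φ (f x) ∂μ :=
  lintegral_comp_eq_of_distrib (measurable_decrRearr μ f).aemeasurable hf volume_lt_decrRearr hΦ

theorem lintegral_decrRearr (hf : AEMeasurable f μ) :
    ∫⁻ s in Ioo (0 : ℝ) 1, decrRearr μ f s = ∫⁻ x, f x ∂μ :=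
  lintegral_comp_decrRearr hf measurable_id

/-- The rearrangement of `f` times the indicator of `A` is at most `f^*` and vanishes from `μ A` on.
-/
theorem setLIntegral_le_decrRearr (hf : AEMeasurable f μ) {A : Set α} (hA : NullMeasurableSet A μ)
    {t : ℝ} (ht : μ A ≤ ENNReal.ofReal t) :
    ∫⁻ x in A, f x ∂μ ≤ ∫⁻ s in Ioo 0 t, decrRearr μ f s := by
  rw [← lintegral_indicator₀ hA, ← lintegral_decrRearr (hf.indicator₀ hA),
    ← lintegral_indicator measurableSet_Ioo, ← lintegral_indicator measurableSet_Ioo]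
  refine lintegral_mono fun s => ?_
  by_cases hs : s ∈ Ioo (0 : ℝ) 1
  · rw [indicator_of_mem hs]
    by_cases hst : s < t
    · rw [indicator_of_mem (show s ∈ Ioo 0 t from ⟨hs.1, hst⟩)]
      exact decrRearr_mono_ae (.of_forall fun x => indicator_le_self _ _ _) s
    · rw [decrRearr_indicator_le A (ht.trans (ENNReal.ofReal_le_ofReal (not_lt.1 hst)))]
      exact zero_le
  · simp [hs]

end Prob

theorem decrRearr_const_one [IsProbabilityMeasure μ] {s : ℝ} (hs : s ∈ Ioo (0 : ℝ) 1) :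
    decrRearr μ (fun _ => (1 : ℝ≥0∞)) s = 1 := by
  refine eq_of_forall_lt_iff fun l => ?_
  rw [lt_decrRearr_iff]
  by_cases hl : l < 1
  · simpa [hl] using hs.2
  · simp [hl]

/-! ### Lorentz norms -/

variable {p : ℝ}

theorem lintegral_rpow_inv_sub_one (hp : 1 ≤ p) {b : ℝ} (hb : 0 ≤ b) :
    ∫⁻ s in Ioo 0 b, ENNReal.ofReal (s ^ (1 / p - 1)) = ENNReal.ofReal (p * b ^ (1 / p)) := by
  have hp0 : 0 < p := by linarith
  have h1 : (-1 : ℝ) < 1 / p - 1 := by have : 0 < 1 / p := by positivity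
                                       linarith
  have hi : IntervalIntegrable (fun s : ℝ => s ^ (1 / p - 1)) volume 0 b :=
    intervalIntegral.intervalIntegrable_rpow' h1
  rw [intervalIntegrable_iff_integrableOn_Ioo_of_le hb] at hi
  rw [← ofReal_integral_eq_lintegral_ofReal hi, ← integral_Ioc_eq_integral_Ioo,
    ← intervalIntegral.integral_of_le hb, integral_rpow (Or.inl h1)]
  · congr 1
    rw [sub_add_cancel, Real.zero_rpow (by positivity)]
    field_simp
    simp
  · filter_upwards [ae_restrict_mem measurableSet_Ioo] with s hs
    exact Real.rpow_nonneg hs.1.le _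

theorem lintegral_indicator_ofReal_lt (a : ℝ≥0∞) :
    ∫⁻ l in Ioi (0 : ℝ), {l : ℝ | ENNReal.ofReal l < a}.indicator 1 l = a := by
  have hm : MeasurableSet {l : ℝ | ENNReal.ofReal l < a} :=
    measurableSet_lt ENNReal.measurable_ofReal measurable_const
  rw [lintegral_indicator_one hm, Measure.restrict_apply hm]
  by_cases ha : a = ⊤
  · subst ha
    simp
  · have : {l : ℝ | ENNReal.ofReal l < a} ∩ Ioi 0 = Ioo 0 a.toReal := by
      ext l
      simp only [mem_inter_iff, mem_ofPred_eq, mem_Ioi, mem_Ioo]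
      constructor
      · rintro ⟨h, h0⟩
        exact ⟨h0, (ENNReal.ofReal_lt_iff_lt_toReal h0.le ha).1 h⟩
      · rintro ⟨h0, h⟩
        exact ⟨(ENNReal.ofReal_lt_iff_lt_toReal h0.le ha).2 h, h0⟩
    rw [this, Real.volume_Ioo, sub_zero, ENNReal.ofReal_toReal ha]

theorem measurable_weight (p : ℝ) : Measurable fun s : ℝ => ENNReal.ofReal (s ^ (1 / p - 1)) :=
  (measurable_id.pow_const _).ennreal_ofReal

/-- Layer cake and Fubini: in `(0,1)` the set `{f^* > l}` is the interval from `0` to `μ {f > l}`,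
and the weight integrates to `p b^{1/p}` over `(0,b)`. Truncation arguments work on this side. -/
theorem lorentzNorm_eq_distrib [IsProbabilityMeasure μ] (hp : 1 ≤ p) (f : α → ℝ≥0∞) :
    lorentzNorm p μ f =
      ENNReal.ofReal p * ∫⁻ l in Ioi (0 : ℝ), μ {x | ENNReal.ofReal l < f x} ^ (1 / p) := by
  have hp0 : 0 < p := by linarith
  have e1 : lorentzNorm p μ f = ∫⁻ s in Ioo (0 : ℝ) 1, ∫⁻ l in Ioi (0 : ℝ),
      ENNReal.ofReal (s ^ (1 / p - 1)) *
        {q : ℝ × ℝ | ENNReal.ofReal q.2 < decrRearr μ f q.1}.indicator 1 (s, l) := by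
    refine lintegral_congr fun s => ?_
    rw [lintegral_const_mul']
    · congr 1
      exact (lintegral_indicator_ofReal_lt _).symm
    · exact ENNReal.ofReal_ne_top
  have hS : MeasurableSet {q : ℝ × ℝ | ENNReal.ofReal q.2 < decrRearr μ f q.1} :=
    measurableSet_lt (ENNReal.measurable_ofReal.comp measurable_snd)
      ((measurable_decrRearr μ f).comp measurable_fst)
  rw [e1, lintegral_lintegral_swap, ← lintegral_const_mul' _ _ ENNReal.ofReal_ne_top]
  · refine lintegral_congr fun l => ?_
    have hm : MeasurableSet {s | ENNReal.ofReal l < decrRearr μ f s} :=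
      measurableSet_lt measurable_const (measurable_decrRearr μ f)
    have e2 : ∀ s : ℝ, ENNReal.ofReal (s ^ (1 / p - 1)) *
        {q : ℝ × ℝ | ENNReal.ofReal q.2 < decrRearr μ f q.1}.indicator 1 (s, l) =
        {s | ENNReal.ofReal l < decrRearr μ f s}.indicator
          (fun s => ENNReal.ofReal (s ^ (1 / p - 1))) s := by
      intro s
      simp only [indicator, mem_ofPred_eq, Pi.one_apply, mul_ite, mul_one, mul_zero]
    simp_rw [e2]
    rw [lintegral_indicator hm, Measure.restrict_restrict hm, Ioo_inter_lt_decrRearr,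
      lintegral_rpow_inv_sub_one hp ENNReal.toReal_nonneg, ENNReal.ofReal_mul hp0.le,
      ← ENNReal.ofReal_rpow_of_nonneg ENNReal.toReal_nonneg (by positivity),
      ENNReal.ofReal_toReal (measure_ne_top _ _)]
  · exact (((measurable_weight p).comp measurable_fst).mul
      (measurable_one.indicator hS)).aemeasurable

theorem lorentzNorm_mono_ae (h : f ≤ᵐ[μ] g) : lorentzNorm p μ f ≤ lorentzNorm p μ g :=
  lintegral_mono fun s => mul_le_mul_right (decrRearr_mono_ae h s) _

theorem lorentzNorm_mono (h : ∀ x, f x ≤ g x) : lorentzNorm p μ f ≤ lorentzNorm p μ g :=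
  lorentzNorm_mono_ae (.of_forall h)

theorem lorentzNorm_const_mul {a : ℝ≥0} (ha : a ≠ 0) (f : α → ℝ≥0∞) :
    lorentzNorm p μ (fun x => a * f x) = a * lorentzNorm p μ f := by
  rw [lorentzNorm, lorentzNorm, ← lintegral_const_mul' _ _ ENNReal.coe_ne_top]
  refine lintegral_congr fun s => ?_
  rw [decrRearr_const_mul ha, mul_left_comm]

/-- Subadditivity of `x ↦ x^{1/p}` on the distribution functions. The hypothesis says `h ≤ max f g`;
for such a maximum no constant is lost. -/
theorem lorentzNorm_le_add_of_distrib [IsProbabilityMeasure μ] (hp : 1 ≤ p) {f g h : α → ℝ≥0∞}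
    (hd : ∀ l : ℝ≥0∞, {x | l < h x} ⊆ {x | l < f x} ∪ {x | l < g x}) :
    lorentzNorm p μ h ≤ lorentzNorm p μ f + lorentzNorm p μ g := by
  have hp0 : 0 < p := by linarith
  have hmeas : ∀ k : α → ℝ≥0∞, Measurable fun l : ℝ => μ {x | ENNReal.ofReal l < k x} ^ (1 / p) :=
    fun k => (Antitone.measurable (f := fun l : ℝ => μ {x | ENNReal.ofReal l < k x})
      fun a b hab => measure_mono fun x hx =>
        lt_of_le_of_lt (ENNReal.ofReal_le_ofReal hab) hx).pow_const _
  simp only [lorentzNorm_eq_distrib hp]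
  rw [← mul_add, ← lintegral_add_left (hmeas f)]
  refine mul_le_mul_right (lintegral_mono fun l => ?_) _
  calc μ {x | ENNReal.ofReal l < h x} ^ (1 / p)
      ≤ (μ {x | ENNReal.ofReal l < f x} + μ {x | ENNReal.ofReal l < g x}) ^ (1 / p) := by
        gcongr
        exact (measure_mono (hd _)).trans (measure_union_le _ _)
    _ ≤ _ := ENNReal.rpow_add_le_add_rpow _ _ (by positivity)
        (by rw [div_le_one hp0]; exact hp)

/-- The factor 2 comes from `f + g ≤ max (2f) (2g)`; this crude triangle inequality suffices
throughout. -/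
theorem lorentzNorm_add_le [IsProbabilityMeasure μ] (hp : 1 ≤ p) (f g : α → ℝ≥0∞) :
    lorentzNorm p μ (fun x => f x + g x) ≤ 2 * (lorentzNorm p μ f + lorentzNorm p μ g) := by
  have h2 : ((2 : ℝ≥0) : ℝ≥0∞) = 2 := rfl
  have := lorentzNorm_le_add_of_distrib (μ := μ) hp (f := fun x => (2 : ℝ≥0) * f x)
    (g := fun x => (2 : ℝ≥0) * g x) (h := fun x => f x + g x) (fun l x hx => by
      simp only [mem_union, mem_ofPred_eq, h2, two_mul] at hx ⊢
      rcases le_total (f x) (g x) with h | h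
      · exact Or.inr (hx.trans_le (by gcongr))
      · exact Or.inl (hx.trans_le (by gcongr)))
  rwa [lorentzNorm_const_mul two_ne_zero, lorentzNorm_const_mul two_ne_zero, ← mul_add, h2] at this

theorem one_le_weight (hp : 1 ≤ p) {s : ℝ} (hs : s ∈ Ioo (0 : ℝ) 1) :
    1 ≤ ENNReal.ofReal (s ^ (1 / p - 1)) := by
  rw [ENNReal.one_le_ofReal]
  refine Real.one_le_rpow_of_pos_of_le_one_of_nonpos hs.1 hs.2.le ?_
  have : 1 / p ≤ 1 := by rw [div_le_one (by linarith)]; exact hp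
  linarith

theorem weight_anti (hp : 1 ≤ p) {s t : ℝ} (hs : 0 < s) (hst : s ≤ t) :
    ENNReal.ofReal (t ^ (1 / p - 1)) ≤ ENNReal.ofReal (s ^ (1 / p - 1)) := by
  refine ENNReal.ofReal_le_ofReal (Real.rpow_le_rpow_of_nonpos hs hst ?_)
  have : 1 / p ≤ 1 := by rw [div_le_one (by linarith)]; exact hp
  linarith

theorem lintegral_le_lorentzNorm [IsProbabilityMeasure μ] (hp : 1 ≤ p) (hf : AEMeasurable f μ) :
    ∫⁻ x, f x ∂μ ≤ lorentzNorm p μ f := by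
  rw [← lintegral_decrRearr hf]
  exact setLIntegral_mono' measurableSet_Ioo fun s hs => le_mul_of_one_le_left' (one_le_weight hp hs)

theorem lorentzNorm_const_le [IsProbabilityMeasure μ] (hp : 1 ≤ p) (c : ℝ≥0∞) :
    lorentzNorm p μ (fun _ => c) ≤ ENNReal.ofReal p * c := by
  calc lorentzNorm p μ (fun _ => c)
      ≤ ∫⁻ s in Ioo (0 : ℝ) 1, ENNReal.ofReal (s ^ (1 / p - 1)) * c :=
        lintegral_mono fun s => mul_le_mul_right (decrRearr_le_iff.2 (by simp)) _
    _ = _ := by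
        rw [lintegral_mul_const _ (measurable_weight p), lintegral_rpow_inv_sub_one hp zero_le_one]
        simp

/-- `L^{p,1}` is contained in `L^p`. -/
theorem lintegral_rpow_le_lorentzNorm [IsProbabilityMeasure μ] (hp : 1 ≤ p)
    (hf : AEMeasurable f μ) : ∫⁻ x, f x ^ p ∂μ ≤ lorentzNorm p μ f ^ p := by
  have hp0 : 0 < p := by linarith
  set N := lorentzNorm p μ f with hN
  rw [← lintegral_comp_decrRearr hf (Φ := fun y => y ^ p) (by fun_prop)]
  have key : ∀ s ∈ Ioo (0 : ℝ) 1,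
      decrRearr μ f s ^ p ≤ N ^ (p - 1) * (ENNReal.ofReal (s ^ (1 / p - 1)) * decrRearr μ f s) := by
    intro s hs
    -- The weak-type bound: weight and `f^*` both decrease, so on `(0,s)` their product is at least
    -- its value at `s`. It is then spent on `p - 1` of the `p` factors `f^*`.
    have h1 : ENNReal.ofReal (s ^ (1 / p)) * decrRearr μ f s ≤ N := by
      calc ENNReal.ofReal (s ^ (1 / p)) * decrRearr μ f s
          = ∫⁻ _ in Ioo 0 s, ENNReal.ofReal (s ^ (1 / p - 1)) * decrRearr μ f s := by
            rw [setLIntegral_const, Real.volume_Ioo, sub_zero, mul_right_comm,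
              ← ENNReal.ofReal_mul (by positivity [hs.1]), ← Real.rpow_add_one hs.1.ne',
              sub_add_cancel]
        _ ≤ ∫⁻ u in Ioo 0 s, ENNReal.ofReal (u ^ (1 / p - 1)) * decrRearr μ f u :=
            setLIntegral_mono' measurableSet_Ioo fun u hu => mul_le_mul'
              (weight_anti hp hu.1 hu.2.le) (decrRearr_antitone μ f hu.2.le)
        _ ≤ N := lintegral_mono_set (Ioo_subset_Ioo_right hs.2.le)
    have h2 : decrRearr μ f s ≤ N * ENNReal.ofReal (s ^ (-(1 / p))) := by
      have hs0 : 0 < s ^ (1 / p) := Real.rpow_pos_of_pos hs.1 _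
      rw [Real.rpow_neg hs.1.le, ENNReal.ofReal_inv_of_pos hs0, ← div_eq_mul_inv,
        ENNReal.le_div_iff_mul_le (Or.inl (by simpa using hs0)) (Or.inl ENNReal.ofReal_ne_top), mul_comm]
      exact h1
    calc decrRearr μ f s ^ p = decrRearr μ f s ^ (p - 1) * decrRearr μ f s := by
          conv_lhs => rw [show p = (p - 1) + 1 by ring]
          rw [ENNReal.rpow_add_of_nonneg _ _ (by linarith) zero_le_one, ENNReal.rpow_one]
      _ ≤ (N * ENNReal.ofReal (s ^ (-(1 / p)))) ^ (p - 1) * decrRearr μ f s := by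
          gcongr
      _ = _ := by
          rw [ENNReal.mul_rpow_of_nonneg _ _ (by linarith), mul_assoc,
            ENNReal.ofReal_rpow_of_nonneg (Real.rpow_nonneg hs.1.le _) (by linarith),
            ← Real.rpow_mul hs.1.le]
          congr 4
          field_simp
          ring
  calc ∫⁻ s in Ioo (0 : ℝ) 1, decrRearr μ f s ^ p
      ≤ ∫⁻ s in Ioo (0 : ℝ) 1,
          N ^ (p - 1) * (ENNReal.ofReal (s ^ (1 / p - 1)) * decrRearr μ f s) :=
        setLIntegral_mono' measurableSet_Ioo key
    _ = N ^ (p - 1) * N := by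
        rw [lintegral_const_mul (f := fun s => ENNReal.ofReal (s ^ (1 / p - 1)) * decrRearr μ f s) _
          ((measurable_weight p).mul (measurable_decrRearr μ f)), hN, lorentzNorm]
    _ = N ^ p := by
        conv_rhs => rw [show p = (p - 1) + 1 by ring]
        rw [ENNReal.rpow_add_of_nonneg _ _ (by linarith) zero_le_one, ENNReal.rpow_one]

end Rearrangement

/-! ### Measure preserving maps, the Hardy–Littlewood pairing and the associate norm. -/

section Resonance

/-- The distribution function of an atomless measure is uniformly distributed. -/
theorem measure_cdf_le_eq {ν : Measure ℝ} [IsFiniteMeasure ν] (hν : ∀ c, ν {c} = 0) {a : ℝ≥0∞}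
    (ha : a ≤ ν univ) : ν {c | ν (Iio c) ≤ a} = a := by
  have hmono : Monotone fun c : ℝ => ν (Iio c) := fun b c h => measure_mono (Iio_subset_Iio h)
  have hS : MeasurableSet {c | ν (Iio c) ≤ a} := measurableSet_le hmono.measurable measurable_const
  refine le_antisymm ?_ ?_
  -- Inner regularity: a compact subset has a greatest element `c`, so it lies in `Iio c` together
  -- with the null set `{c}`. The other inequality treats the complement, with least elements.
  · rw [hS.measure_eq_iSup_isCompact]
    refine iSup_le fun K => iSup_le fun hK => iSup_le fun hKc => ?_
    rcases K.eq_empty_or_nonempty with rfl | hne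
    · simp
    obtain ⟨c, hc, hmax⟩ := hKc.exists_isGreatest hne
    calc ν K ≤ ν (insert c (Iio c)) :=
          measure_mono fun y hy => by
            rcases (hmax hy).eq_or_lt with h | h
            · exact Or.inl h
            · exact Or.inr h
      _ ≤ ν {c} + ν (Iio c) := by
          rw [insert_eq]
          exact measure_union_le _ _
      _ ≤ a := by
          rw [hν, zero_add]
          exact hK hc
  · have hT : ν {c | ν (Iio c) ≤ a}ᶜ ≤ ν univ - a := by
      rw [hS.compl.measure_eq_iSup_isCompact]
      refine iSup_le fun K => iSup_le fun hK => iSup_le fun hKc => ?_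
      rcases K.eq_empty_or_nonempty with rfl | hne
      · simp
      obtain ⟨c, hc, hmin⟩ := hKc.exists_isLeast hne
      calc ν K ≤ ν (Iio c)ᶜ := measure_mono fun y hy => not_lt.2 (hmin hy)
        _ = ν univ - ν (Iio c) := measure_compl measurableSet_Iio (measure_ne_top _ _)
        _ ≤ ν univ - a := tsub_le_tsub_left (not_le.1 (show ¬ ν (Iio c) ≤ a from hK hc)).le _
    rw [← compl_compl {c | ν (Iio c) ≤ a}, measure_compl hS.compl (measure_ne_top _ _)]
    refine ENNReal.le_sub_of_add_le_right (measure_ne_top _ _) ?_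
    calc a + ν {c | ν (Iio c) ≤ a}ᶜ ≤ a + (ν univ - a) := by gcongr
      _ = ν univ := add_tsub_cancel_of_le ha

variable {α : Type*} [MeasurableSpace α] {μ : Measure α} [IsProbabilityMeasure μ]

/-- Counterpart of `μ {L < g} ≤ t`, obtained from levels increasing to `L`. Together they say that a
part of the level set `{g = L}` can fill the gap up to mass exactly `t`. -/
theorem le_measure_decrRearr_le {g : α → ℝ≥0∞} (hg : Measurable g) {t : ℝ} (ht : t ≤ 1) :
    ENNReal.ofReal t ≤ μ {x | decrRearr μ g t ≤ g x} := by
  set L := decrRearr μ g t with hL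
  rcases eq_or_ne L 0 with h0 | h0
  · simpa [h0] using ht
  have hlt : μ {x | g x < L} ≤ 1 - ENNReal.ofReal t := by
    obtain ⟨u, hu, hlt, hlim⟩ := exists_seq_strictMono_tendsto' (pos_iff_ne_zero.2 h0)
    have hU : {x | g x < L} = ⋃ k, {x | g x ≤ u k} := by
      ext x
      simp only [mem_ofPred_eq, mem_iUnion]
      constructor
      · intro hx
        obtain ⟨k, hk⟩ := (hlim.eventually (lt_mem_nhds hx)).exists
        exact ⟨k, le_of_lt hk⟩
      · rintro ⟨k, hk⟩
        exact hk.trans_lt (hlt k).2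
    rw [hU, Directed.measure_iUnion]
    · refine iSup_le fun k => ?_
      have : {x | g x ≤ u k} = {x | u k < g x}ᶜ := by ext; simp
      rw [this, prob_compl_eq_one_sub (measurableSet_lt measurable_const hg)]
      exact tsub_le_tsub_left (lt_decrRearr_iff.1 (hlt k).2).le _
    · exact (monotone_nat_of_le_succ fun k x hx =>
        le_trans hx (hu (Nat.lt_succ_self k)).le).directed_le
  have : {x | L ≤ g x} = {x | g x < L}ᶜ := by ext; simp
  rw [this, prob_compl_eq_one_sub (measurableSet_lt hg measurable_const)]
  refine ENNReal.le_sub_of_add_le_right (measure_ne_top _ _) ?_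
  calc ENNReal.ofReal t + μ {x | g x < L} ≤ ENNReal.ofReal t + (1 - ENNReal.ofReal t) := by gcongr
    _ = 1 := add_tsub_cancel_of_le (by simpa using ht)

/-- On a probability space carrying a function with null level sets, every `g` dominates
`g^* ∘ σ` for a measure preserving `σ` onto `(0,1)`. -/
theorem exists_measurePreserving_decrRearr_le {τ : α → ℝ} (hτ : Measurable τ)
    (hτ0 : ∀ c, μ {x | τ x = c} = 0) {g : α → ℝ≥0∞} (hg : AEMeasurable g μ) :
    ∃ σ : α → ℝ, MeasurePreserving σ μ (volume.restrict (Ioo (0 : ℝ) 1)) ∧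
      ∀ᵐ x ∂μ, decrRearr μ g (σ x) ≤ g x := by
  wlog hgm : Measurable g generalizing g
  · obtain ⟨σ, h1, h2⟩ := this hg.measurable_mk.aemeasurable hg.measurable_mk
    refine ⟨σ, h1, ?_⟩
    filter_upwards [h2, hg.ae_eq_mk] with x hx hxe
    rwa [hxe, decrRearr_congr_ae hg.ae_eq_mk]
  -- The rank of `x`: the mass of the points ahead of it when points are ordered by decreasing `g`
  -- and ties are broken by `τ`. The map sought is `S`, read as a real number.
  let S : α → ℝ≥0∞ := fun x => μ {y | g x < g y ∨ (g y = g x ∧ τ y < τ x)}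
  have hSm : Measurable S := by
    have : MeasurableSet {q : α × α | g q.1 < g q.2 ∨ (g q.2 = g q.1 ∧ τ q.2 < τ q.1)} :=
      (measurableSet_lt (hgm.comp measurable_fst) (hgm.comp measurable_snd)).union
        ((measurableSet_eq_fun (hgm.comp measurable_snd) (hgm.comp measurable_fst)).inter
          (measurableSet_lt (hτ.comp measurable_snd) (hτ.comp measurable_fst)))
    exact measurable_measure_prodMk_left this
  have hS1 : ∀ x, S x ≤ 1 := fun x => prob_le_one
  have hunif : ∀ t : ℝ, 0 ≤ t → t ≤ 1 → μ {x | S x ≤ ENNReal.ofReal t} = ENNReal.ofReal t := by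
    intro t ht0 ht1
    set L := decrRearr μ g t with hL
    set A := μ {x | L < g x} with hA
    have hAt : A ≤ ENNReal.ofReal t := decrRearr_le_iff.1 le_rfl
    have hBm : MeasurableSet {x | g x = L} := measurableSet_eq_fun hgm measurable_const
    have hAm : MeasurableSet {x | L < g x} := measurableSet_lt measurable_const hgm
    set ν : Measure ℝ := (μ.restrict {x | g x = L}).map τ with hν
    have hνI : ∀ s : Set ℝ, MeasurableSet s → ν s = μ ({x | g x = L} ∩ τ ⁻¹' s) := fun s hs => by
      rw [hν, Measure.map_apply hτ hs, Measure.restrict_apply (hτ hs), inter_comm]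
    have hν0 : ∀ c, ν {c} = 0 := fun c => by
      rw [hνI _ (measurableSet_singleton c)]
      exact measure_mono_null inter_subset_right (hτ0 c)
    have hνu : A + ν univ = μ {x | L ≤ g x} := by
      rw [hνI _ MeasurableSet.univ, preimage_univ, inter_univ, hA, ← measure_union _ hBm]
      · congr 1
        ext x
        simp [le_iff_lt_or_eq, eq_comm]
      · exact disjoint_left.2 fun x hx hx' => hx.ne' hx'
    have ha : ENNReal.ofReal t - A ≤ ν univ := by
      rw [tsub_le_iff_left, hνu]
      exact le_measure_decrRearr_le hgm ht1
    have hSB : ∀ x, g x = L → S x = A + ν (Iio (τ x)) := by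
      intro x hx
      rw [hνI _ measurableSet_Iio, hA, ← measure_union _ (hBm.inter (hτ measurableSet_Iio))]
      · refine congrArg μ ?_
        ext y
        simp [hx]
      · exact disjoint_left.2 fun x hx hx' => hx.ne' hx'.1
    -- The points of rank at most `t` are those above the level `L`, together with the first points
    -- of the tie `{g = L}` in the order of `τ`, up to the missing mass `t - A`.
    have hset : {x | S x ≤ ENNReal.ofReal t} =
        {x | L < g x} ∪ ({x | g x = L} ∩ τ ⁻¹' {c | ν (Iio c) ≤ ENNReal.ofReal t - A}) := by
      ext x
      simp only [mem_ofPred_eq, mem_union, mem_inter_iff, mem_preimage]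
      rcases lt_trichotomy (g x) L with h | h | h
      · have h1 : ENNReal.ofReal t < S x :=
          (lt_decrRearr_iff.1 h).trans_le (measure_mono fun y hy => Or.inl hy)
        simp [h.not_gt, h.ne, h1]
      · rw [hSB x h, ENNReal.le_sub_iff_add_le_left (measure_ne_top _ _) hAt]
        simp only [h, lt_self_iff_false, true_and, false_or, A]
      · have h1 : S x ≤ ENNReal.ofReal t := by
          refine le_trans (measure_mono fun y hy => ?_) hAt
          rcases hy with hy | hy
          · exact h.trans hy
          · exact h.trans_eq hy.1.symm
        simp [h, h1]
    have hcm : MeasurableSet {c | ν (Iio c) ≤ ENNReal.ofReal t - A} :=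
      measurableSet_le (Monotone.measurable fun b c h => measure_mono (Iio_subset_Iio h))
        measurable_const
    rw [hset, measure_union _ (hBm.inter (hτ hcm)), ← hνI _ hcm, measure_cdf_le_eq hν0 ha,
      add_tsub_cancel_of_le hAt]
    exact disjoint_left.2 fun x hx hx' => hx.ne' hx'.1
  have hSσ : ∀ x, ENNReal.ofReal (S x).toReal = S x := fun x =>
    ENNReal.ofReal_toReal (measure_ne_top _ _)
  refine ⟨fun x => (S x).toReal, ⟨hSm.ennreal_toReal, ?_⟩, .of_forall fun x => ?_⟩
  · have : IsProbabilityMeasure (μ.map fun x => (S x).toReal) :=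
      Measure.isProbabilityMeasure_map hSm.ennreal_toReal.aemeasurable
    refine Measure.ext_of_Iic _ _ fun t => ?_
    rw [Measure.map_apply hSm.ennreal_toReal measurableSet_Iic,
      Measure.restrict_apply measurableSet_Iic]
    rcases lt_or_ge t 0 with ht | ht
    · have e1 : (fun x => (S x).toReal) ⁻¹' Iic t = ∅ := by
        ext x
        simpa using ht.trans_le ENNReal.toReal_nonneg
      have e2 : Iic t ∩ Ioo 0 1 = ∅ := by
        ext x
        simp only [mem_inter_iff, mem_Iic, mem_Ioo, mem_empty_iff_false, iff_false]
        intro h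
        linarith [h.1, h.2.1]
      rw [e1, e2]
      simp
    · have e1 : (fun x => (S x).toReal) ⁻¹' Iic t = {x | S x ≤ ENNReal.ofReal t} := by
        ext x
        simp only [mem_preimage, mem_Iic, mem_ofPred_eq]
        rw [ENNReal.le_ofReal_iff_toReal_le (measure_ne_top _ _) ht]
      rw [e1]
      rcases le_or_gt t 1 with h1 | h1
      · rw [hunif t ht h1]
        rcases h1.eq_or_lt with rfl | h1
        · rw [inter_eq_self_of_subset_right fun x hx => hx.2.le]
          simp
        · have e2 : Iic t ∩ Ioo 0 1 = Ioc 0 t := by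
            ext x
            simp only [mem_inter_iff, mem_Iic, mem_Ioo, mem_Ioc]
            constructor
            · intro h
              exact ⟨h.2.1, h.1⟩
            · intro h
              exact ⟨h.2, h.1, by linarith [h.2]⟩
          rw [e2]
          simp
      · rw [inter_eq_self_of_subset_right fun x hx => hx.2.le.trans h1.le]
        have : {x | S x ≤ ENNReal.ofReal t} = univ := by
          ext x
          simpa using (hS1 x).trans (by simpa using h1.le)
        rw [this]
        simp
  · rw [decrRearr_le_iff, hSσ]
    exact measure_mono fun y hy => Or.inl hy

/-- Layer cake formula for the integral of a product. -/
theorem lintegral_mul_eq_lintegral_setLIntegral {β : Type*} [MeasurableSpace β] {ν : Measure β}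
    [SFinite ν] {k w : β → ℝ≥0∞} (hk : Measurable k) (hw : AEMeasurable w ν) :
    ∫⁻ x, k x * w x ∂ν =
      ∫⁻ l in Ioi (0 : ℝ), ∫⁻ x in {x | ENNReal.ofReal l < k x}, w x ∂ν := by
  have hS : MeasurableSet {q : β × ℝ | ENNReal.ofReal q.2 < k q.1} :=
    measurableSet_lt (ENNReal.measurable_ofReal.comp measurable_snd) (hk.comp measurable_fst)
  have e1 : ∀ x, k x * w x = ∫⁻ l in Ioi (0 : ℝ),
      {q : β × ℝ | ENNReal.ofReal q.2 < k q.1}.indicator 1 (x, l) * w x := by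
    intro x
    rw [lintegral_mul_const (f := fun l : ℝ =>
      {q : β × ℝ | ENNReal.ofReal q.2 < k q.1}.indicator 1 (x, l)) _
      ((measurable_one.indicator hS).comp measurable_prodMk_left)]
    congr 1
    exact (lintegral_indicator_ofReal_lt _).symm
  simp_rw [e1]
  rw [lintegral_lintegral_swap]
  · refine lintegral_congr fun l => ?_
    have hm : MeasurableSet {x | ENNReal.ofReal l < k x} := measurableSet_lt measurable_const hk
    rw [← lintegral_indicator hm]
    refine lintegral_congr fun x => ?_
    simp [indicator]
  · exact (measurable_one.indicator hS).aemeasurable.mul hw.comp_fst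

/-- With `σ` such that `g^* ∘ σ ≤ g`, the function `f^* ∘ σ` is equimeasurable with `f`, hence has
the same norm. Divided by `ρ f` it competes in the supremum defining the associate norm of `g`, and
its pairing with `g` dominates that of `f^*` with `g^*`. -/
theorem lintegral_decrRearr_mul_decrRearr_le {ρ : (α → ℝ≥0∞) → ℝ≥0∞} (hρ : IsRINorm μ ρ)
    {τ : α → ℝ} (hτ : Measurable τ) (hτ0 : ∀ c, μ {x | τ x = c} = 0) {f g : α → ℝ≥0∞}
    (hf : AEMeasurable f μ) (hg : AEMeasurable g μ) (hfρ : ρ f ≠ ⊤) (hgρ : assocNorm μ ρ g ≤ 1) :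
    ∫⁻ s in Ioo (0 : ℝ) 1, decrRearr μ f s * decrRearr μ g s ≤ ρ f := by
  obtain ⟨σ, hσ, hσg⟩ := exists_measurePreserving_decrRearr_le hτ hτ0 hg
  have hk := measurable_decrRearr μ f
  rcases eq_or_ne (ρ f) 0 with h0 | h0
  · rw [h0, nonpos_iff_eq_zero]
    have hf0 := (hρ.eq_zero_iff f hf).1 h0
    have : ∀ s, decrRearr μ f s = 0 := fun s => by
      rw [decrRearr_congr_ae hf0, ← nonpos_iff_eq_zero, decrRearr_le_iff]
      simp
    simp [this]
  · have hkσ : AEMeasurable (fun x => decrRearr μ f (σ x)) μ := (hk.comp hσ.measurable).aemeasurable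
    have hρσ : ρ (fun x => decrRearr μ f (σ x)) = ρ f := by
      refine hρ.rearr_inv _ _ hkσ hf fun l => ?_
      rw [← volume_lt_decrRearr (μ := μ) (f := f), ← hσ.map_eq, Measure.map_apply hσ.measurable
        (measurableSet_lt measurable_const hk)]
      rfl
    set a : ℝ≥0 := (ρ f).toNNReal⁻¹ with ha
    have haρ : (a : ℝ≥0∞) = (ρ f)⁻¹ := by
      rw [ha, ENNReal.coe_inv (by simp [ENNReal.toNNReal_eq_zero_iff, h0, hfρ]),
        ENNReal.coe_toNNReal hfρ]
    have h1 : ρ (fun x => a * decrRearr μ f (σ x)) ≤ 1 := by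
      rw [hρ.smul a _ hkσ, hρσ, haρ, ENNReal.inv_mul_cancel h0 hfρ]
    have h2 : ∫⁻ x, (a * decrRearr μ f (σ x)) * g x ∂μ ≤ 1 := by
      refine le_trans ?_ hgρ
      have hm : AEMeasurable (fun x => a * decrRearr μ f (σ x)) μ := hkσ.const_mul _
      exact le_iSup_of_le (fun x => a * decrRearr μ f (σ x))
        (le_iSup_of_le hm (le_iSup_of_le h1 le_rfl))
    have h3 : ∫⁻ x, decrRearr μ f (σ x) * g x ∂μ ≤ ρ f := by
      simp_rw [mul_assoc] at h2
      rw [lintegral_const_mul' _ _ ENNReal.coe_ne_top, haρ, mul_comm, ← div_eq_mul_inv] at h2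
      rwa [ENNReal.div_le_iff h0 hfρ, one_mul] at h2
    refine le_trans (le_of_eq ?_) ((lintegral_mono_ae (hσg.mono fun x hx =>
      mul_le_mul_right hx (decrRearr μ f (σ x)))).trans h3)
    rw [← hσ.lintegral_comp (f := fun s => decrRearr μ f s * decrRearr μ g s)
      (hk.mul (measurable_decrRearr μ g))]

/-- If the integral of `w` over any set of measure `t` is at most `K ∫_0^t f^*`, then
`∫ w^* g^* ≤ K ∫ f^* g^*`. -/
theorem lintegral_decrRearr_mul_le_of_setLIntegral_le {w : ℝ → ℝ≥0∞} {K : ℝ≥0}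
    (hw : AEMeasurable w (volume.restrict (Ioo (0 : ℝ) 1))) {f : α → ℝ≥0∞}
    (h : ∀ E : Set ℝ, MeasurableSet E → ∫⁻ s in E ∩ Ioo 0 1, w s ≤
      K * ∫⁻ s in Ioo 0 (volume (E ∩ Ioo 0 1)).toReal, decrRearr μ f s) (g : α → ℝ≥0∞) :
    ∫⁻ s in Ioo (0 : ℝ) 1, decrRearr (volume.restrict (Ioo (0 : ℝ) 1)) w s * decrRearr μ g s ≤
      K * ∫⁻ s in Ioo (0 : ℝ) 1, decrRearr μ f s * decrRearr μ g s := by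
  obtain ⟨σ, hσ, hσw⟩ := exists_measurePreserving_decrRearr_le
    (μ := volume.restrict (Ioo (0 : ℝ) 1)) measurable_id (fun c => by simp) hw
  have hk := measurable_decrRearr μ g
  have hkσ : Measurable fun s => decrRearr μ g (σ s) := hk.comp hσ.measurable
  calc ∫⁻ s in Ioo (0 : ℝ) 1, decrRearr (volume.restrict (Ioo (0 : ℝ) 1)) w s * decrRearr μ g s
      = ∫⁻ s in Ioo (0 : ℝ) 1,
          decrRearr (volume.restrict (Ioo (0 : ℝ) 1)) w (σ s) * decrRearr μ g (σ s) := by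
        rw [← hσ.lintegral_comp (f := fun s =>
          decrRearr (volume.restrict (Ioo (0 : ℝ) 1)) w s * decrRearr μ g s)
          ((measurable_decrRearr _ w).mul hk)]
    _ ≤ ∫⁻ s in Ioo (0 : ℝ) 1, decrRearr μ g (σ s) * w s := by
        refine lintegral_mono_ae (hσw.mono fun s hs => ?_)
        rw [mul_comm]
        exact mul_le_mul_right hs _
    _ = ∫⁻ l in Ioi (0 : ℝ), ∫⁻ s in {s | ENNReal.ofReal l < decrRearr μ g (σ s)} ∩ Ioo 0 1, w s := by
        rw [lintegral_mul_eq_lintegral_setLIntegral hkσ hw]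
        refine lintegral_congr fun l => ?_
        rw [Measure.restrict_restrict (measurableSet_lt measurable_const hkσ)]
    -- A superlevel set of `g^* ∘ σ` has measure `μ {g > l}`. The hypothesis trades it for the
    -- interval of that length, which is the superlevel set of `g^*`.
    _ ≤ ∫⁻ l in Ioi (0 : ℝ), K * ∫⁻ s in {s | ENNReal.ofReal l < decrRearr μ g s} ∩ Ioo 0 1,
          decrRearr μ f s := by
        refine lintegral_mono fun l => ?_
        have hm := measurableSet_lt (measurable_const (a := ENNReal.ofReal l)) hk
        have e : volume ({s | ENNReal.ofReal l < decrRearr μ g (σ s)} ∩ Ioo 0 1) =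
            μ {x | ENNReal.ofReal l < g x} := by
          rw [← volume_lt_decrRearr (μ := μ) (f := g), ← hσ.map_eq,
            Measure.map_apply hσ.measurable hm,
            Measure.restrict_apply (hσ.measurable hm)]
          rfl
        rw [Ioo_inter_lt_decrRearr, ← e]
        exact h _ (measurableSet_lt measurable_const hkσ)
    _ = _ := by
        rw [lintegral_const_mul' _ _ ENNReal.coe_ne_top]
        congr 1
        simp_rw [mul_comm (decrRearr μ f _)]
        rw [lintegral_mul_eq_lintegral_setLIntegral hk (measurable_decrRearr μ f).aemeasurable]
        refine lintegral_congr fun l => ?_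
        rw [Measure.restrict_restrict (measurableSet_lt measurable_const hk)]

end Resonance

/-! ### The averaged rearrangement and the integral of the oscillation over arbitrary sets. -/

section Oscillation

variable {α : Type*} [MeasurableSpace α] {μ : Measure α}

theorem measurable_avgRearr (μ : Measure α) (f : α → ℝ≥0∞) : Measurable (avgRearr μ f) :=
  (Monotone.measurable (f := fun t : ℝ => ∫⁻ s in Ioo 0 t, decrRearr μ f s) fun _ _ h =>
    lintegral_mono_set (Ioo_subset_Ioo_right h)).div ENNReal.measurable_ofReal

theorem measurable_oscRearr (p : ℝ) (μ : Measure α) (f : α → ℝ≥0∞) :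
    Measurable (oscRearr p μ f) :=
  (measurable_weight p).mul ((measurable_avgRearr μ f).sub (measurable_decrRearr μ f))

theorem ofReal_mul_avgRearr (μ : Measure α) (f : α → ℝ≥0∞) {t : ℝ} (ht : 0 < t) :
    ENNReal.ofReal t * avgRearr μ f t = ∫⁻ s in Ioo 0 t, decrRearr μ f s :=
  ENNReal.mul_div_cancel (by simpa using ht) ENNReal.ofReal_ne_top

theorem decrRearr_le_avgRearr (μ : Measure α) (f : α → ℝ≥0∞) {t : ℝ} (ht : 0 < t) :
    decrRearr μ f t ≤ avgRearr μ f t := by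
  rw [avgRearr, ENNReal.le_div_iff_mul_le (Or.inl (by simpa using ht))
    (Or.inl ENNReal.ofReal_ne_top)]
  calc decrRearr μ f t * ENNReal.ofReal t = ∫⁻ _ in Ioo 0 t, decrRearr μ f t := by
        rw [setLIntegral_const, Real.volume_Ioo, sub_zero]
    _ ≤ _ := setLIntegral_mono' measurableSet_Ioo fun s hs => decrRearr_antitone μ f hs.2.le

theorem decrRearr_ne_top [IsProbabilityMeasure μ] {f : α → ℝ≥0∞} (hf : AEMeasurable f μ)
    (hi : ∫⁻ x, f x ∂μ ≠ ⊤) {t : ℝ} (ht : 0 < t) : decrRearr μ f t ≠ ⊤ := by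
  have hr : 0 < min t 1 := lt_min ht one_pos
  refine ne_top_of_le_ne_top ?_
    ((decrRearr_antitone μ f (min_le_left t 1)).trans (decrRearr_le_avgRearr μ f hr))
  refine ENNReal.div_ne_top (ne_top_of_le_ne_top hi ?_) (by simpa using ht)
  rw [← lintegral_decrRearr hf]
  exact lintegral_mono_set (Ioo_subset_Ioo_right (min_le_right _ _))

theorem avgRearr_anti (μ : Measure α) (f : α → ℝ≥0∞) {t u : ℝ} (ht : 0 < t) (htu : t ≤ u) :
    avgRearr μ f u ≤ avgRearr μ f t := by
  have hu : 0 < u := ht.trans_le htu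
  rw [avgRearr, ENNReal.div_le_iff (by simpa using hu) ENNReal.ofReal_ne_top]
  calc ∫⁻ s in Ioo 0 u, decrRearr μ f s
      ≤ ∫⁻ s in Ioo 0 t ∪ Ico t u, decrRearr μ f s := lintegral_mono_set fun s hs => by
        rcases lt_or_ge s t with h | h
        · exact Or.inl ⟨hs.1, h⟩
        · exact Or.inr ⟨h, hs.2⟩
    _ ≤ (∫⁻ s in Ioo 0 t, decrRearr μ f s) + ∫⁻ s in Ico t u, decrRearr μ f s :=
        lintegral_union_le _ _ _
    _ ≤ ENNReal.ofReal t * avgRearr μ f t + ∫⁻ _ in Ico t u, avgRearr μ f t := by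
        rw [ofReal_mul_avgRearr μ f ht]
        refine add_le_add le_rfl (setLIntegral_mono' measurableSet_Ico fun s hs => ?_)
        exact (decrRearr_antitone μ f hs.1).trans (decrRearr_le_avgRearr μ f ht)
    _ = avgRearr μ f t * ENNReal.ofReal u := by
        rw [setLIntegral_const, Real.volume_Ico, mul_comm, ← mul_add, ← ENNReal.ofReal_add ht.le
          (by linarith)]
        congr 2
        ring

/-- The two rearrangement inequalities bound the integral of the oscillation over an arbitrary
set. -/
theorem setLIntegral_le_of_avgRearr_of_lintegral {w : ℝ → ℝ≥0∞} {f : α → ℝ≥0∞} {C : ℝ≥0}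
    (h1 : ∀ s ∈ Ioo (0 : ℝ) 1, w s ≤ C * avgRearr μ f s)
    (h2 : ∀ t ∈ Ioo (0 : ℝ) 1, ∫⁻ s in Ioo 0 t, w s ≤ C * ∫⁻ s in Ioo 0 t, decrRearr μ f s)
    {E : Set ℝ} (hE : MeasurableSet E) :
    ∫⁻ s in E ∩ Ioo 0 1, w s ≤
      (2 * C : ℝ≥0) * ∫⁻ s in Ioo 0 (volume (E ∩ Ioo 0 1)).toReal, decrRearr μ f s := by
  have hfin : volume (E ∩ Ioo (0 : ℝ) 1) ≤ 1 :=
    (measure_mono inter_subset_right).trans (by simp)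
  have hne : volume (E ∩ Ioo (0 : ℝ) 1) ≠ ⊤ := ne_top_of_le_ne_top ENNReal.one_ne_top hfin
  set t := (volume (E ∩ Ioo (0 : ℝ) 1)).toReal with ht
  have hvol : volume (E ∩ Ioo (0 : ℝ) 1) = ENNReal.ofReal t := (ENNReal.ofReal_toReal hne).symm
  -- Cut at `r`: below it the integrated inequality applies, above it the pointwise one together
  -- with the monotonicity of `f^{**}`. Each contributes `C ∫_0^r f^*`, whence the factor 2.
  have main : ∀ r ∈ Ioo (0 : ℝ) 1, r ≤ t →
      volume (E ∩ Ioo 0 1 ∩ Ici r) ≤ ENNReal.ofReal r →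
      ∫⁻ s in E ∩ Ioo 0 1, w s ≤ (2 * C : ℝ≥0) * ∫⁻ s in Ioo 0 t, decrRearr μ f s := by
    intro r hr hrt hv
    calc ∫⁻ s in E ∩ Ioo 0 1, w s ≤ ∫⁻ s in Ioo 0 r ∪ (E ∩ Ioo 0 1 ∩ Ici r), w s :=
          lintegral_mono_set fun s hs => by
            rcases lt_or_ge s r with h | h
            · exact Or.inl ⟨hs.2.1, h⟩
            · exact Or.inr ⟨hs, h⟩
      _ ≤ (∫⁻ s in Ioo 0 r, w s) + ∫⁻ s in E ∩ Ioo 0 1 ∩ Ici r, w s := lintegral_union_le _ _ _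
      _ ≤ C * (∫⁻ s in Ioo 0 r, decrRearr μ f s) +
            ∫⁻ _ in E ∩ Ioo 0 1 ∩ Ici r, C * avgRearr μ f r := by
          refine add_le_add (h2 r hr) (setLIntegral_mono'
            ((hE.inter measurableSet_Ioo).inter measurableSet_Ici) fun s hs => ?_)
          exact (h1 s hs.1.2).trans (mul_le_mul_right (avgRearr_anti μ f hr.1 hs.2) _)
      _ ≤ C * (∫⁻ s in Ioo 0 r, decrRearr μ f s) + C * avgRearr μ f r * ENNReal.ofReal r := by
          rw [setLIntegral_const]
          gcongr
      _ = (2 * C : ℝ≥0) * ∫⁻ s in Ioo 0 r, decrRearr μ f s := by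
          rw [mul_assoc, mul_comm (avgRearr μ f r), ofReal_mul_avgRearr μ f hr.1]
          push_cast
          ring
      _ ≤ _ := by
          gcongr
  have ht1 : t ≤ 1 := by simpa using ENNReal.toReal_mono ENNReal.one_ne_top hfin
  rcases (ENNReal.toReal_nonneg : 0 ≤ t).eq_or_lt with h0 | h0
  · have : volume (E ∩ Ioo (0 : ℝ) 1) = 0 := by rw [hvol, ht, ← h0]; simp
    rw [Measure.restrict_eq_zero.2 this]
    simp
  rcases ht1.eq_or_lt with h1 | h1
  -- The endpoint `t = 1` is outside the range of the hypotheses; cutting at `1/2` leaves a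
  -- remainder of measure at most `1/2`.
  · refine main (1 / 2) (by norm_num) (by rw [h1]; norm_num) ?_
    calc volume (E ∩ Ioo 0 1 ∩ Ici (1 / 2)) ≤ volume (Ico (1 / 2 : ℝ) 1) :=
          measure_mono fun s hs => ⟨hs.2, hs.1.2.2⟩
      _ = _ := by rw [Real.volume_Ico]; norm_num
  · exact main t ⟨h0, h1⟩ le_rfl ((measure_mono inter_subset_left).trans hvol.le)

end Oscillation

/-! ### The r.i. space `L^1`. -/

section RI

variable {α : Type*} [MeasurableSpace α] {μ : Measure α} [IsProbabilityMeasure μ]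

theorem isRINorm_lintegral : IsRINorm μ fun f => ∫⁻ x, f x ∂μ where
  eq_zero_iff f hf := lintegral_eq_zero_iff' hf
  smul a f hf := lintegral_const_mul'' _ hf
  add_le f g hf _ := (lintegral_add_left' hf g).le
  mono f g _ _ h := lintegral_mono_ae h
  fatou f hf h := lintegral_iSup' hf h
  indicator_lt_top A hA _ := by
    rw [lintegral_indicator hA]
    simp
  lintegral_le A _ _ := ⟨1, fun f _ => by simpa using setLIntegral_le_lintegral A f⟩
  rearr_inv f g hf hg h := lintegral_comp_eq_of_distrib hf hg h measurable_id

/-- The constant `1` has associate norm at most one and is its own rearrangement on `(0,1)`. -/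
theorem lintegral_le_hatNorm_lintegral {h : ℝ → ℝ≥0∞} (hh : Measurable h) :
    ∫⁻ s in Ioo (0 : ℝ) 1, h s ≤ hatNorm μ (fun f => ∫⁻ x, f x ∂μ) h := by
  have hm : AEMeasurable (fun _ : α => (1 : ℝ≥0∞)) μ := aemeasurable_const
  have h1 : assocNorm μ (fun f => ∫⁻ x, f x ∂μ) (fun _ => 1) ≤ 1 :=
    iSup_le fun f => iSup_le fun _ => iSup_le fun hf => by simpa using hf
  refine le_trans (le_of_eq ?_) (le_iSup_of_le (fun _ => 1)
    (le_iSup_of_le hm (le_iSup_of_le h1 le_rfl)))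
  rw [← lintegral_decrRearr (μ := volume.restrict (Ioo (0 : ℝ) 1)) hh.aemeasurable]
  exact setLIntegral_congr_fun measurableSet_Ioo fun s hs => by
    simp only [decrRearr_const_one hs, mul_one]

end RI

/-! ### From (ii) to (iii'). -/

section Sobolev

variable {n : ℕ} {Ω : Set (EuclideanSpace ℝ (Fin n))} {p : ℝ}

theorem isProbabilityMeasure_restrict (hΩ1 : volume Ω = 1) :
    IsProbabilityMeasure (volume.restrict Ω) := ⟨by simpa using hΩ1⟩

theorem HasWeakGradient.aestronglyMeasurable {f : EuclideanSpace ℝ (Fin n) → ℝ}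
    {G : EuclideanSpace ℝ (Fin n) → EuclideanSpace ℝ (Fin n)} (h : HasWeakGradient Ω f G) :
    AEStronglyMeasurable f (volume.restrict Ω) ∧ AEStronglyMeasurable G (volume.restrict Ω) :=
  ⟨h.1.aestronglyMeasurable, h.2.1.aestronglyMeasurable⟩

theorem MemW1X.memW11 (hΩ1 : volume Ω = 1)
    {ρ : (EuclideanSpace ℝ (Fin n) → ℝ≥0∞) → ℝ≥0∞} (hρ : IsRINorm (volume.restrict Ω) ρ)
    {f : EuclideanSpace ℝ (Fin n) → ℝ} {G : EuclideanSpace ℝ (Fin n) → EuclideanSpace ℝ (Fin n)}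
    (h : MemW1X Ω ρ f G) : MemW11 Ω f G := by
  obtain ⟨hw, hf, hG⟩ := h
  have hm := hw.aestronglyMeasurable
  obtain ⟨C, hC⟩ := hρ.lintegral_le univ MeasurableSet.univ (by simp [hΩ1])
  rw [Measure.restrict_univ] at hC
  refine ⟨hw, ⟨hm.1, ?_⟩, ⟨hm.2, ?_⟩⟩
  · exact (hC _ hm.1.enorm).trans_lt (ENNReal.mul_lt_top ENNReal.coe_lt_top hf)
  · exact (hC _ hm.2.enorm).trans_lt (ENNReal.mul_lt_top ENNReal.coe_lt_top hG)

theorem RearrIneq.riSobolevUniform (hn : 0 < n) (hΩ1 : volume Ω = 1)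
    (h : RearrIneq Ω p) : RISobolevUniform Ω p := by
  have := isProbabilityMeasure_restrict hΩ1
  obtain ⟨C, hC⟩ := h
  refine ⟨2 * C, fun ρ hρ f G hfG => ?_⟩
  obtain ⟨r, h1, h2⟩ := hC f G (hfG.memW11 hΩ1 hρ)
  have hG : AEMeasurable (fun x => ‖G x‖ₑ) (volume.restrict Ω) :=
    (hfG.1.aestronglyMeasurable).2.enorm
  have : Nonempty (Fin n) := ⟨⟨0, hn⟩⟩
  refine iInf_le_of_le r (iSup_le fun g => iSup_le fun hg => iSup_le fun hgρ => ?_)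
  refine (lintegral_decrRearr_mul_le_of_setLIntegral_le (measurable_oscRearr _ _ _).aemeasurable
    (fun E hE => setLIntegral_le_of_avgRearr_of_lintegral h1 h2 hE) g).trans ?_
  gcongr
  -- The norm serves as the function with null level sets: spheres are Lebesgue null in positive
  -- dimension.
  refine lintegral_decrRearr_mul_decrRearr_le hρ measurable_norm (fun c => ?_) hG hg hfG.2.2.ne hgρ
  refine Measure.restrict_le_self.absolutelyContinuous ?_
  have : {x : EuclideanSpace ℝ (Fin n) | ‖x‖ = c} = Metric.sphere 0 c := by ext; simp
  rw [this]
  exact Measure.addHaar_sphere _ _ _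

end Sobolev

/-! ### Mollification and convergence in `L^1`. -/

section Mollify

open Filter Topology
open scoped Convolution

variable {n : ℕ} {V : Type*} [NormedAddCommGroup V] [NormedSpace ℝ V]

/-- A bump function supported in the ball of radius `2 / (k + 1)`. -/
def mollifier (n k : ℕ) : ContDiffBump (0 : EuclideanSpace ℝ (Fin n)) where
  rIn := 1 / ((k : ℝ) + 1)
  rOut := 2 / ((k : ℝ) + 1)
  rIn_pos := by positivity
  rIn_lt_rOut := by gcongr; norm_num

/-- The kernel of the `k`-th mollification. -/
def mollKernel (n k : ℕ) : EuclideanSpace ℝ (Fin n) → ℝ := (mollifier n k).normed volume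

/-- The `k`-th mollification of `u`. -/
def mollify (k : ℕ) (u : EuclideanSpace ℝ (Fin n) → V) : EuclideanSpace ℝ (Fin n) → V :=
  mollKernel n k ⋆[ContinuousLinearMap.lsmul ℝ ℝ, volume] u

theorem mollifier_rOut_tendsto : Tendsto (fun k => (mollifier n k).rOut) atTop (𝓝 0) :=
  tendsto_const_div_atTop_nhds_zero_nat 2 |>.comp (tendsto_add_atTop_nat 1) |>.congr fun k => by
    simp [mollifier]

theorem contDiff_mollKernel (k : ℕ) : ContDiff ℝ ∞ (mollKernel n k) :=
  (mollifier n k).contDiff_normed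

theorem hasCompactSupport_mollKernel (k : ℕ) : HasCompactSupport (mollKernel n k) :=
  (mollifier n k).hasCompactSupport_normed

theorem mollify_apply (k : ℕ) (u : EuclideanSpace ℝ (Fin n) → V) (x : EuclideanSpace ℝ (Fin n)) :
    mollify k u x = ∫ y, mollKernel n k (x - y) • u y := by
  rw [mollify, convolution_eq_swap]
  rfl

/-- Lebesgue differentiation requires the two radii of the bump functions to have bounded ratio;
here it is always 2. -/
theorem ae_tendsto_mollify [CompleteSpace V] {u : EuclideanSpace ℝ (Fin n) → V}
    (hu : Integrable u) : ∀ᵐ x, Tendsto (fun k => mollify k u x) atTop (𝓝 (u x)) :=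
  ContDiffBump.ae_convolution_tendsto_right_of_locallyIntegrable (K := 2) mollifier_rOut_tendsto
    (.of_forall fun k => by simp [mollifier, div_eq_mul_inv]) hu.locallyIntegrable

theorem contDiff_mollify [CompleteSpace V] (k : ℕ) {u : EuclideanSpace ℝ (Fin n) → V}
    (hu : Integrable u) : ContDiff ℝ ∞ (mollify k u) :=
  (hasCompactSupport_mollKernel k).contDiff_convolution_left _ (contDiff_mollKernel k)
    hu.locallyIntegrable

theorem lintegral_mollKernel_sub (k : ℕ) (y : EuclideanSpace ℝ (Fin n)) :
    ∫⁻ x, ‖mollKernel n k (x - y)‖ₑ = 1 := by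
  rw [lintegral_sub_right_eq_self (fun x => ‖mollKernel n k x‖ₑ) y]
  have : ∀ x, ‖mollKernel n k x‖ₑ = ENNReal.ofReal (mollKernel n k x) := fun x =>
    Real.enorm_of_nonneg ((mollifier n k).nonneg_normed x)
  simp_rw [this]
  rw [← ofReal_integral_eq_lintegral_ofReal]
  · simp [mollKernel, (mollifier n k).integral_normed]
  · exact (mollifier n k).integrable_normed
  · exact .of_forall fun x => (mollifier n k).nonneg_normed x

theorem lintegral_enorm_mollify_le (k : ℕ) {u : EuclideanSpace ℝ (Fin n) → V}
    (hu : AEStronglyMeasurable u) : ∫⁻ x, ‖mollify k u x‖ₑ ≤ ∫⁻ x, ‖u x‖ₑ := by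
  calc ∫⁻ x, ‖mollify k u x‖ₑ ≤ ∫⁻ x, ∫⁻ y, ‖mollKernel n k (x - y)‖ₑ * ‖u y‖ₑ := by
        refine lintegral_mono fun x => ?_
        rw [mollify_apply]
        refine (enorm_integral_le_lintegral_enorm _).trans (le_of_eq ?_)
        simp_rw [enorm_smul]
    _ = ∫⁻ y, ∫⁻ x, ‖mollKernel n k (x - y)‖ₑ * ‖u y‖ₑ := by
        refine lintegral_lintegral_swap ?_
        refine AEMeasurable.mul ?_ hu.enorm.comp_snd
        exact ((contDiff_mollKernel k).continuous.measurable.comp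
          (measurable_fst.sub measurable_snd)).enorm.aemeasurable
    _ = ∫⁻ y, ‖u y‖ₑ := by
        refine lintegral_congr fun y => ?_
        have hm : Measurable fun x => ‖mollKernel n k (x - y)‖ₑ :=
          ((contDiff_mollKernel k).continuous.measurable.comp
            (measurable_id.sub measurable_const)).enorm
        rw [lintegral_mul_const _ hm, lintegral_mollKernel_sub, one_mul]

theorem integrable_mollify [CompleteSpace V] (k : ℕ) {u : EuclideanSpace ℝ (Fin n) → V}
    (hu : Integrable u) : Integrable (mollify k u) :=
  ⟨(contDiff_mollify k hu).continuous.aestronglyMeasurable,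
    (lintegral_enorm_mollify_le k hu.1).trans_lt hu.2⟩

/-- Almost everywhere convergence without gain of mass is convergence in `L^1`. -/
theorem tendsto_lintegral_enorm_sub_of_le {α : Type*} [MeasurableSpace α] {μ : Measure α}
    {V : Type*} [NormedAddCommGroup V] {u : ℕ → α → V} {v : α → V} (hu : ∀ k, AEStronglyMeasurable (u k) μ)
    (hv : Integrable v μ) (hle : ∀ k, ∫⁻ x, ‖u k x‖ₑ ∂μ ≤ ∫⁻ x, ‖v x‖ₑ ∂μ)
    (hlim : ∀ᵐ x ∂μ, Tendsto (fun k => u k x) atTop (𝓝 (v x))) :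
    Tendsto (fun k => ∫⁻ x, ‖u k x - v x‖ₑ ∂μ) atTop (𝓝 0) := by
  set I := ∫⁻ x, ‖v x‖ₑ ∂μ with hI
  have hI' : I ≠ ⊤ := hv.2.ne
  have hd : ∀ k, AEMeasurable (fun x => ‖u k x - v x‖ₑ) μ := fun k => ((hu k).sub hv.1).enorm
  have hdle : ∀ k x, ‖u k x - v x‖ₑ ≤ ‖u k x‖ₑ + ‖v x‖ₑ := fun k x => enorm_sub_le
  have hdI : ∀ k, ∫⁻ x, ‖u k x - v x‖ₑ ∂μ ≤ 2 * I := fun k => by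
    refine (lintegral_mono (hdle k)).trans ?_
    rw [lintegral_add_left' (hu k).enorm, two_mul]
    exact add_le_add (hle k) le_rfl
  have h2I : 2 * I ≠ ⊤ := ENNReal.mul_ne_top ENNReal.ofNat_ne_top hI'
  -- Fatou's lemma for the nonnegative functions `|u_k| + |v| - |u_k - v|`, which tend to `2|v|`.
  have hF : 2 * I ≤ liminf (fun k => 2 * I - ∫⁻ x, ‖u k x - v x‖ₑ ∂μ) atTop := by
    calc 2 * I = ∫⁻ x, liminf (fun k => ‖u k x‖ₑ + ‖v x‖ₑ - ‖u k x - v x‖ₑ) atTop ∂μ := by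
          rw [hI, ← lintegral_const_mul'' _ hv.1.enorm]
          refine lintegral_congr_ae (hlim.mono fun x hx => ?_)
          refine (Tendsto.liminf_eq ?_).symm
          have h1 : Tendsto (fun k => ‖u k x‖ₑ) atTop (𝓝 ‖v x‖ₑ) := hx.enorm
          have h2 : Tendsto (fun k => ‖u k x - v x‖ₑ) atTop (𝓝 0) := by
            simpa using (hx.sub_const (v x)).enorm
          have h3 := ENNReal.Tendsto.sub (h1.add (tendsto_const_nhds (x := ‖v x‖ₑ))) h2
            (Or.inr ENNReal.zero_ne_top)
          rwa [tsub_zero, ← two_mul] at h3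
      _ ≤ liminf (fun k => ∫⁻ x, ‖u k x‖ₑ + ‖v x‖ₑ - ‖u k x - v x‖ₑ ∂μ) atTop :=
          lintegral_liminf_le' fun k => ((hu k).enorm.add hv.1.enorm).sub (hd k)
      _ ≤ _ := by
          refine liminf_le_liminf (.of_forall fun k => ?_)
          have := lintegral_sub' (hd k) (ne_top_of_le_ne_top h2I (hdI k))
            (.of_forall (hdle k)) (μ := μ)
          rw [this, lintegral_add_left' (hu k).enorm, two_mul]
          exact tsub_le_tsub_right (add_le_add (hle k) le_rfl) _
  rw [ENNReal.tendsto_nhds_zero]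
  intro ε hε
  rcases eq_or_ne (2 * I) 0 with h0 | h0
  · exact .of_forall fun k => (hdI k).trans (by simp [h0])
  have hlt : 2 * I - ε < liminf (fun k => 2 * I - ∫⁻ x, ‖u k x - v x‖ₑ ∂μ) atTop :=
    (ENNReal.sub_lt_self h2I h0 hε.ne').trans_le hF
  filter_upwards [eventually_lt_of_lt_liminf hlt] with k hk
  by_contra hc
  exact absurd hk (not_lt.2 (tsub_le_tsub_left (not_le.1 hc).le _))

theorem tendsto_lintegral_mollify_sub [CompleteSpace V] {u : EuclideanSpace ℝ (Fin n) → V}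
    (hu : Integrable u) : Tendsto (fun k => ∫⁻ x, ‖mollify k u x - u x‖ₑ) atTop (𝓝 0) :=
  tendsto_lintegral_enorm_sub_of_le (fun k => (integrable_mollify k hu).1) hu
    (fun k => lintegral_enorm_mollify_le k hu.1) (ae_tendsto_mollify hu)

end Mollify

/-! ### Mollification commutes with the weak gradient. -/

section WeakGradient

open Filter Topology
open scoped Convolution

variable {n : ℕ} {Ω : Set (EuclideanSpace ℝ (Fin n))} {f : EuclideanSpace ℝ (Fin n) → ℝ}
  {G : EuclideanSpace ℝ (Fin n) → EuclideanSpace ℝ (Fin n)}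

theorem integral_mul_eq_of_tsupport_subset {φ h h' : EuclideanSpace ℝ (Fin n) → ℝ}
    (hφ : ∀ x ∉ Ω, φ x = 0) (hh : ∀ x ∈ Ω, h x = h' x) :
    ∫ x in Ω, φ x * h x = ∫ x, φ x * h' x := by
  rw [setIntegral_eq_integral_of_forall_compl_eq_zero fun x hx => by rw [hφ x hx, zero_mul]]
  refine integral_congr_ae (.of_forall fun x => ?_)
  by_cases hx : x ∈ Ω
  · simp only [hh x hx]
  · simp only [hφ x hx, zero_mul]

theorem MemW11.integrable_indicator (hΩ : IsOpen Ω) (h : MemW11 Ω f G) :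
    Integrable (Ω.indicator f) ∧ Integrable (Ω.indicator G) :=
  ⟨(integrable_indicator_iff hΩ.measurableSet).2 h.2.1,
    (integrable_indicator_iff hΩ.measurableSet).2 h.2.2⟩

/-- Once the ball lies in `Ω`, the kernel `y ↦ η(x - y)` is an admissible test function, and its
derivative in `y` is minus the derivative in `x`. -/
theorem MemW11.fderiv_mollify (hΩ : IsOpen Ω) (h : MemW11 Ω f G) {k : ℕ}
    {x : EuclideanSpace ℝ (Fin n)} (hx : Metric.closedBall x (mollifier n k).rOut ⊆ Ω)
    (v : EuclideanSpace ℝ (Fin n)) :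
    fderiv ℝ (mollify k (Ω.indicator f)) x v = inner ℝ (mollify k (Ω.indicator G) x) v := by
  obtain ⟨hf, hG⟩ := h.integrable_indicator hΩ
  have hη : ContDiff ℝ ∞ (mollKernel n k) := contDiff_mollKernel k
  have hη1 : ContDiff ℝ 1 (mollKernel n k) := hη.of_le (by norm_cast)
  let φ : EuclideanSpace ℝ (Fin n) → ℝ := fun y => mollKernel n k (x - y)
  have hφ : ContDiff ℝ ∞ φ := hη.comp (contDiff_const.sub contDiff_id)
  have hφs : tsupport φ ⊆ Metric.closedBall x (mollifier n k).rOut := by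
    refine closure_minimal (fun y hy => ?_) Metric.isClosed_closedBall
    have : x - y ∈ Function.support ((mollifier n k).normed volume) := hy
    rw [(mollifier n k).support_normed_eq, mem_ball_zero_iff] at this
    rw [Metric.mem_closedBall, dist_comm, dist_eq_norm]
    exact this.le
  have hφc : HasCompactSupport φ :=
    (isCompact_closedBall _ _).of_isClosed_subset (isClosed_tsupport φ) hφs
  have hφ0 : ∀ y ∉ Ω, φ y = 0 := fun y hy =>
    image_eq_zero_of_notMem_tsupport fun hy' => hy (hx (hφs hy'))
  have hφ'0 : ∀ y ∉ Ω, fderiv ℝ φ y v = 0 := fun y hy => by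
    rw [image_eq_zero_of_notMem_tsupport (f := fderiv ℝ φ) fun hy' =>
      hy (hx (hφs (tsupport_fderiv_subset ℝ hy')))]
    rfl
  have hdφ : ∀ y, fderiv ℝ φ y v = - fderiv ℝ (mollKernel n k) (x - y) v := fun y => by
    have h1 : HasFDerivAt φ ((fderiv ℝ (mollKernel n k) (x - y)).comp
        (-ContinuousLinearMap.id ℝ (EuclideanSpace ℝ (Fin n)))) y :=
      ((hη1.differentiable one_ne_zero (x - y)).hasFDerivAt).comp y
        ((hasFDerivAt_id y).const_sub x)
    rw [h1.fderiv]
    simp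
  have key := h.1.2.2 φ hφ hφc (hφs.trans hx) v
  have e1 : ∫ y in Ω, f y * fderiv ℝ φ y v = - ∫ y, Ω.indicator f y *
      fderiv ℝ (mollKernel n k) (x - y) v := by
    simp_rw [mul_comm (f _)]
    rw [integral_mul_eq_of_tsupport_subset (h' := Ω.indicator f) hφ'0
      fun y hy => (indicator_of_mem hy f).symm, ← integral_neg]
    refine integral_congr_ae (.of_forall fun y => ?_)
    simp only [hdφ y]
    ring
  have e2 : ∫ y in Ω, φ y * inner ℝ (G y) v = inner ℝ (mollify k (Ω.indicator G) x) v := by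
    rw [integral_mul_eq_of_tsupport_subset (h' := fun y => inner ℝ (Ω.indicator G y) v) hφ0
      fun y hy => by rw [indicator_of_mem hy], mollify_apply, real_inner_comm, ← integral_inner]
    · refine integral_congr_ae (.of_forall fun y => ?_)
      simp only [inner_smul_right, real_inner_comm v, φ]
    · obtain ⟨c, hc⟩ := hφc.exists_bound_of_continuous hφ.continuous
      exact hG.bdd_smul c hφ.continuous.aestronglyMeasurable (.of_forall hc)
  rw [e1, e2, neg_inj] at key
  rw [← key]
  have hd := (hasCompactSupport_mollKernel k).hasFDerivAt_convolution_right
    (ContinuousLinearMap.lsmul ℝ ℝ).flip hf.locallyIntegrable hη1 x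
  rw [convolution_flip] at hd
  rw [mollify, hd.fderiv, convolution_precompR_apply _ hf.locallyIntegrable
    ((hasCompactSupport_mollKernel k).fderiv ℝ) (hη1.continuous_fderiv one_ne_zero)]
  refine integral_congr_ae (.of_forall fun y => ?_)
  simp [mul_comm]

end WeakGradient

/-! ### Calculus in `W^{1,1}`: linearity, chain rule, positive parts. -/

section ChainRule

open Filter Topology

variable {n : ℕ} {Ω : Set (EuclideanSpace ℝ (Fin n))} {f g : EuclideanSpace ℝ (Fin n) → ℝ}
  {G H : EuclideanSpace ℝ (Fin n) → EuclideanSpace ℝ (Fin n)}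

theorem MemW11.of_integrable (hf : IntegrableOn f Ω) (hG : IntegrableOn G Ω)
    (h : ∀ φ : EuclideanSpace ℝ (Fin n) → ℝ, ContDiff ℝ ∞ φ → HasCompactSupport φ →
      tsupport φ ⊆ Ω → ∀ v : EuclideanSpace ℝ (Fin n),
        ∫ x in Ω, f x * fderiv ℝ φ x v = - ∫ x in Ω, φ x * inner ℝ (G x) v) : MemW11 Ω f G :=
  ⟨⟨hf.locallyIntegrableOn, hG.locallyIntegrableOn, h⟩, hf, hG⟩

theorem integrableOn_mul_fderiv (hf : IntegrableOn f Ω) {φ : EuclideanSpace ℝ (Fin n) → ℝ}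
    (hφ : ContDiff ℝ ∞ φ) (hφc : HasCompactSupport φ) (v : EuclideanSpace ℝ (Fin n)) :
    IntegrableOn (fun x => f x * fderiv ℝ φ x v) Ω := by
  have hc : Continuous fun x => fderiv ℝ φ x v :=
    (hφ.continuous_fderiv (by simp)).clm_apply continuous_const
  obtain ⟨c, hb⟩ := (hφc.fderiv_apply ℝ v).exists_bound_of_continuous hc
  exact hf.mul_bdd hc.aestronglyMeasurable (.of_forall hb)

theorem integrableOn_mul_inner (hG : IntegrableOn G Ω) {φ : EuclideanSpace ℝ (Fin n) → ℝ}
    (hφ : ContDiff ℝ ∞ φ) (hφc : HasCompactSupport φ) (v : EuclideanSpace ℝ (Fin n)) :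
    IntegrableOn (fun x => φ x * inner ℝ (G x) v) Ω := by
  obtain ⟨c, hb⟩ := hφc.exists_bound_of_continuous hφ.continuous
  exact (hG.inner_const v).bdd_mul hφ.continuous.aestronglyMeasurable (.of_forall hb)

theorem MemW11.add (hf : MemW11 Ω f G) (hg : MemW11 Ω g H) :
    MemW11 Ω (fun x => f x + g x) (fun x => G x + H x) := by
  refine .of_integrable (hf.2.1.add hg.2.1) (hf.2.2.add hg.2.2) fun φ hφ hφc hφs v => ?_
  simp_rw [add_mul, inner_add_left, mul_add]
  rw [integral_add (integrableOn_mul_fderiv hf.2.1 hφ hφc v)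
    (integrableOn_mul_fderiv hg.2.1 hφ hφc v), integral_add (integrableOn_mul_inner hf.2.2 hφ hφc v)
    (integrableOn_mul_inner hg.2.2 hφ hφc v), hf.1.2.2 φ hφ hφc hφs v, hg.1.2.2 φ hφ hφc hφs v]
  ring

theorem MemW11.const_mul (a : ℝ) (hf : MemW11 Ω f G) :
    MemW11 Ω (fun x => a * f x) (fun x => a • G x) := by
  refine .of_integrable (hf.2.1.const_mul a) (hf.2.2.smul a) fun φ hφ hφc hφs v => ?_
  simp_rw [inner_smul_left, mul_assoc, mul_left_comm (φ _)]
  rw [integral_const_mul, integral_const_mul, hf.1.2.2 φ hφ hφc hφs v]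
  simp

theorem MemW11.neg (hf : MemW11 Ω f G) : MemW11 Ω (fun x => -f x) (fun x => -G x) := by
  simpa using hf.const_mul (-1)

theorem MemW11.sub (hf : MemW11 Ω f G) (hg : MemW11 Ω g H) :
    MemW11 Ω (fun x => f x - g x) (fun x => G x - H x) := by
  simpa [sub_eq_add_neg] using hf.add hg.neg

theorem memW11_const (hΩ1 : volume Ω = 1) (c : ℝ) :
    MemW11 Ω (fun _ => c) (fun _ => (0 : EuclideanSpace ℝ (Fin n))) := by
  refine .of_integrable (by simp [integrableOn_const_iff, hΩ1]) (integrableOn_zero)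
    fun φ hφ hφc hφs v => ?_
  have h0 : ∀ x ∉ Ω, c * fderiv ℝ φ x v = 0 := fun x hx => by
    rw [image_eq_zero_of_notMem_tsupport (f := fderiv ℝ φ) fun hx' =>
      hx (hφs (tsupport_fderiv_subset ℝ hx'))]
    simp
  rw [setIntegral_eq_integral_of_forall_compl_eq_zero h0, integral_const_mul]
  have hc : Continuous fun x => fderiv ℝ φ x v :=
    (hφ.continuous_fderiv (by simp)).clm_apply continuous_const
  have := integral_mul_fderiv_eq_neg_fderiv_mul_of_integrable (μ := volume)
    (f := fun _ : EuclideanSpace ℝ (Fin n) => (1 : ℝ)) (g := φ) (v := v) (by simp)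
    (by simpa using hc.integrable_of_hasCompactSupport (hφc.fderiv_apply ℝ v))
    (by simpa using hφ.continuous.integrable_of_hasCompactSupport hφc)
    (fun _ _ => differentiableAt_const _)
    (fun x _ => hφ.differentiable (by simp) x)
  simp only [one_mul, fderiv_fun_const, Pi.zero_apply, zero_apply, zero_mul,
    integral_zero, neg_zero] at this
  rw [this]
  simp

theorem MemW11.sub_const (hΩ1 : volume Ω = 1) (hf : MemW11 Ω f G) (c : ℝ) :
    MemW11 Ω (fun x => f x - c) G := by
  simpa using hf.sub (memW11_const hΩ1 c)

/-- Chain rule for the weak gradient. -/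
theorem MemW11.comp (hΩ : IsOpen Ω) (hΩ1 : volume Ω = 1) (h : MemW11 Ω f G) {F F' : ℝ → ℝ}
    (hF : ∀ t, HasDerivAt F (F' t) t) (hF' : Continuous F') (hb : ∀ t, |F' t| ≤ 1) :
    MemW11 Ω (fun x => F (f x)) (fun x => F' (f x) • G x) := by
  have := isProbabilityMeasure_restrict hΩ1
  have hFc : Continuous F := continuous_iff_continuousAt.2 fun t => (hF t).continuousAt
  have hLip : ∀ s t, |F s - F t| ≤ |s - t| := fun s t => by
    have := Convex.norm_image_sub_le_of_norm_hasDerivWithin_le (C := 1)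
      (fun x _ => (hF x).hasDerivWithinAt) (fun x _ => hb x) convex_univ (mem_univ t) (mem_univ s)
    simpa using this
  have hint : IntegrableOn (fun x => F (f x)) Ω := by
    refine (h.2.1.norm.add (integrable_const |F 0|)).mono'
      (hFc.comp_aestronglyMeasurable h.2.1.1) (.of_forall fun x => ?_)
    have h1 := hLip (f x) 0
    have h2 := abs_sub_abs_le_abs_sub (F (f x)) (F 0)
    simp only [sub_zero] at h1
    simp only [Real.norm_eq_abs, Pi.add_apply]
    linarith
  have hintG : IntegrableOn (fun x => F' (f x) • G x) Ω :=
    h.2.2.bdd_smul 1 (hF'.comp_aestronglyMeasurable h.2.1.1) (.of_forall fun x => hb (f x))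
  refine .of_integrable hint hintG fun φ hφ hφc hφs v => ?_
  obtain ⟨hfi, hGi⟩ := h.integrable_indicator hΩ
  set u : ℕ → EuclideanSpace ℝ (Fin n) → ℝ := fun k => mollify k (Ω.indicator f) with hu
  set U : ℕ → EuclideanSpace ℝ (Fin n) → EuclideanSpace ℝ (Fin n) :=
    fun k => mollify k (Ω.indicator G) with hU
  have hus : ∀ k, ContDiff ℝ ∞ (u k) := fun k => contDiff_mollify k hfi
  have hUs : ∀ k, ContDiff ℝ ∞ (U k) := fun k => contDiff_mollify k hGi
  have hdc : Continuous fun x => fderiv ℝ φ x v :=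
    (hφ.continuous_fderiv (by simp)).clm_apply continuous_const
  have hdcs : HasCompactSupport fun x => fderiv ℝ φ x v := hφc.fderiv_apply ℝ v
  obtain ⟨M, hM⟩ := hφc.exists_bound_of_continuous hφ.continuous
  obtain ⟨M', hM'⟩ := hdcs.exists_bound_of_continuous hdc
  have hφ0 : ∀ x ∉ Ω, φ x = 0 := fun x hx =>
    image_eq_zero_of_notMem_tsupport fun hx' => hx (hφs hx')
  have hφ'0 : ∀ x ∉ Ω, fderiv ℝ φ x v = 0 := fun x hx => by
    rw [image_eq_zero_of_notMem_tsupport (f := fderiv ℝ φ) fun hx' =>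
      hx (hφs (tsupport_fderiv_subset ℝ hx'))]
    rfl
  simp_rw [mul_comm (F _)]
  rw [integral_mul_eq_of_tsupport_subset (h' := fun x => F (Ω.indicator f x)) hφ'0
      fun x hx => by rw [indicator_of_mem hx],
    integral_mul_eq_of_tsupport_subset
      (h' := fun x => F' (Ω.indicator f x) * inner ℝ (Ω.indicator G x) v) hφ0
      fun x hx => by rw [indicator_of_mem hx, indicator_of_mem hx, real_inner_smul_left]]
  -- the identity for the mollifications
  have hk : ∀ᶠ k in atTop, ∫ x, fderiv ℝ φ x v * F (u k x) =
      - ∫ x, φ x * (F' (u k x) * inner ℝ (U k x) v) := by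
    -- The gradient of the mollification is needed only on the compact support of `φ`, where the
    -- balls lie in `Ω` for large `k`.
    obtain ⟨δ, hδ, hsub⟩ := hφc.isCompact.exists_cthickening_subset_open hΩ hφs
    filter_upwards [mollifier_rOut_tendsto (n := n) |>.eventually (gt_mem_nhds hδ)] with k hk
    have hd : ∀ x, HasFDerivAt (fun x => F (u k x)) (F' (u k x) • fderiv ℝ (u k) x) x := fun x =>
      (hF (u k x)).comp_hasFDerivAt x ((hus k).differentiable (by simp) x).hasFDerivAt
    have hcF : Continuous fun x => F (u k x) := hFc.comp (hus k).continuous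
    have hcd : Continuous fun x => fderiv ℝ (fun x => F (u k x)) x v := by
      have : (fun x => fderiv ℝ (fun x => F (u k x)) x v) =
          fun x => F' (u k x) * fderiv ℝ (u k) x v := by
        ext x
        rw [(hd x).fderiv]
        rfl
      rw [this]
      exact (hF'.comp (hus k).continuous).mul
        (((hus k).continuous_fderiv (by simp)).clm_apply continuous_const)
    have := integral_mul_fderiv_eq_neg_fderiv_mul_of_integrable (μ := volume)
      (f := fun x => F (u k x)) (g := φ) (v := v)
      ((hcd.mul hφ.continuous).integrable_of_hasCompactSupport hφc.mul_left)
      ((hcF.mul hdc).integrable_of_hasCompactSupport hdcs.mul_left)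
      ((hcF.mul hφ.continuous).integrable_of_hasCompactSupport hφc.mul_left)
      (fun x _ => (hd x).differentiableAt)
      (fun x _ => hφ.differentiable (by simp) x)
    simp_rw [mul_comm (F _)] at this
    rw [this, neg_inj]
    refine integral_congr_ae (.of_forall fun x => ?_)
    by_cases hx : x ∈ tsupport φ
    · have hball : Metric.closedBall x (mollifier n k).rOut ⊆ Ω := fun y hy =>
        hsub (Metric.mem_cthickening_of_dist_le y x δ _ hx (le_trans hy hk.le))
      simp only [(hd x).fderiv, smul_apply, smul_eq_mul]
      rw [hu, h.fderiv_mollify hΩ hball v]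
      ring
    · simp [image_eq_zero_of_notMem_tsupport hx]
  have hlu : ∀ᵐ x, Tendsto (fun k => u k x) atTop (𝓝 (Ω.indicator f x)) := ae_tendsto_mollify hfi
  have hL1 : Tendsto (fun k => ∫ x, fderiv ℝ φ x v * F (u k x)) atTop
      (𝓝 (∫ x, fderiv ℝ φ x v * F (Ω.indicator f x))) := by
    refine tendsto_integral_of_L1 _ (hdc.aestronglyMeasurable.mul
      (hFc.comp_aestronglyMeasurable hfi.1)) (.of_forall fun k =>
        (hdc.mul (hFc.comp (hus k).continuous)).integrable_of_hasCompactSupport hdcs.mul_right) ?_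
    have hz : Tendsto (fun k => ENNReal.ofReal M' * ∫⁻ x, ‖u k x - Ω.indicator f x‖ₑ) atTop
        (𝓝 0) := by
      simpa using ENNReal.Tendsto.const_mul (tendsto_lintegral_mollify_sub hfi)
        (Or.inr ENNReal.ofReal_ne_top)
    refine tendsto_of_tendsto_of_tendsto_of_le_of_le tendsto_const_nhds hz (fun _ => zero_le)
      fun k => ?_
    dsimp only
    rw [← lintegral_const_mul' _ _ ENNReal.ofReal_ne_top]
    refine lintegral_mono fun x => ?_
    rw [Pi.mul_apply, ← mul_sub, enorm_mul]
    refine mul_le_mul' ?_ (enorm_le_iff_norm_le.2 (hLip _ _))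
    rw [← ofReal_norm]
    exact ENNReal.ofReal_le_ofReal (hM' x)
  -- The difference of the products splits into `F'(u_k)(U_k - G)`, handled by `|F'| ≤ 1` and
  -- convergence in `L^1`, and `(F'(u_k) - F'(f)) G`, handled by dominated convergence because `F'`
  -- is merely continuous.
  have hL2 : Tendsto (fun k => ∫ x, φ x * (F' (u k x) * inner ℝ (U k x) v)) atTop
      (𝓝 (∫ x, φ x * (F' (Ω.indicator f x) * inner ℝ (Ω.indicator G x) v))) := by
    refine tendsto_integral_of_L1 _ (hφ.continuous.aestronglyMeasurable.mul
      ((hF'.comp_aestronglyMeasurable hfi.1).mul (hGi.1.inner aestronglyMeasurable_const)))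
      (.of_forall fun k => (hφ.continuous.mul ((hF'.comp (hus k).continuous).mul
        ((hUs k).continuous.inner continuous_const))).integrable_of_hasCompactSupport
          hφc.mul_right) ?_
    have hz1 : Tendsto (fun k => ENNReal.ofReal M * ‖v‖ₑ * ∫⁻ x, ‖U k x - Ω.indicator G x‖ₑ) atTop
        (𝓝 0) := by
      simpa using ENNReal.Tendsto.const_mul (tendsto_lintegral_mollify_sub hGi)
        (Or.inr (ENNReal.mul_ne_top ENNReal.ofReal_ne_top enorm_ne_top))
    have hz2 : Tendsto (fun k => ENNReal.ofReal M * ‖v‖ₑ *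
        ∫⁻ x, ‖F' (u k x) - F' (Ω.indicator f x)‖ₑ * ‖Ω.indicator G x‖ₑ) atTop (𝓝 0) := by
      have : Tendsto (fun k => ∫⁻ x, ‖F' (u k x) - F' (Ω.indicator f x)‖ₑ * ‖Ω.indicator G x‖ₑ)
          atTop (𝓝 (∫⁻ _ : EuclideanSpace ℝ (Fin n), 0)) := by
        refine tendsto_lintegral_of_dominated_convergence' (fun x => 2 * ‖Ω.indicator G x‖ₑ)
          (fun k => (((hF'.comp (hus k).continuous).aestronglyMeasurable.sub
            (hF'.comp_aestronglyMeasurable hfi.1)).enorm.mul hGi.1.enorm)) (fun k => ?_) ?_ ?_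
        · refine .of_forall fun x => mul_le_mul_left ?_ _
          refine enorm_sub_le.trans ?_
          rw [← one_add_one_eq_two]
          exact add_le_add (by simpa [enorm_le_iff_norm_le] using
            (enorm_le_iff_norm_le (y := (1 : ℝ))).2 (by simpa using hb (u k x)))
            (by simpa using (enorm_le_iff_norm_le (y := (1 : ℝ))).2 (by simpa using hb _))
        · rw [lintegral_const_mul'' _ hGi.1.enorm]
          exact ENNReal.mul_ne_top ENNReal.ofNat_ne_top hGi.2.ne
        · filter_upwards [hlu] with x hx
          have h1 : Tendsto (fun k => ‖F' (u k x) - F' (Ω.indicator f x)‖ₑ) atTop (𝓝 0) := by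
            simpa using (((hF'.tendsto _).comp hx).sub_const (F' (Ω.indicator f x))).enorm
          simpa using ENNReal.Tendsto.mul_const h1 (Or.inr enorm_ne_top)
      rw [lintegral_zero] at this
      simpa using ENNReal.Tendsto.const_mul this
        (Or.inr (ENNReal.mul_ne_top ENNReal.ofReal_ne_top enorm_ne_top))
    have hz := hz1.add hz2
    rw [add_zero] at hz
    refine tendsto_of_tendsto_of_tendsto_of_le_of_le tendsto_const_nhds hz (fun _ => zero_le)
      fun k => ?_
    dsimp only
    have hUm : AEMeasurable fun x => ‖U k x - Ω.indicator G x‖ₑ :=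
      ((hUs k).continuous.aestronglyMeasurable.sub hGi.1).enorm
    rw [← mul_add, ← lintegral_add_left' hUm,
      ← lintegral_const_mul' _ _ (ENNReal.mul_ne_top ENNReal.ofReal_ne_top enorm_ne_top)]
    refine lintegral_mono fun x => ?_
    have e : φ x * (F' (u k x) * inner ℝ (U k x) v) -
        φ x * (F' (Ω.indicator f x) * inner ℝ (Ω.indicator G x) v) =
        φ x * (F' (u k x) * inner ℝ (U k x - Ω.indicator G x) v +
          (F' (u k x) - F' (Ω.indicator f x)) * inner ℝ (Ω.indicator G x) v) := by
      rw [inner_sub_left]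
      ring
    simp only [Pi.mul_apply]
    rw [e, enorm_mul, mul_assoc]
    refine mul_le_mul' ?_ ?_
    · rw [← ofReal_norm]
      exact ENNReal.ofReal_le_ofReal (hM x)
    refine (enorm_add_le _ _).trans ?_
    rw [mul_add, enorm_mul, enorm_mul]
    have hin : ∀ w : EuclideanSpace ℝ (Fin n), ‖inner ℝ w v‖ₑ ≤ ‖v‖ₑ * ‖w‖ₑ := fun w => by
      rw [← enorm_norm v, ← enorm_norm w, ← enorm_mul, enorm_le_iff_norm_le, Real.norm_eq_abs,
        Real.norm_eq_abs, abs_of_nonneg (by positivity : 0 ≤ ‖v‖ * ‖w‖), mul_comm]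
      exact abs_real_inner_le_norm w v
    refine add_le_add ?_ ?_
    · calc ‖F' (u k x)‖ₑ * ‖inner ℝ (U k x - Ω.indicator G x) v‖ₑ
          ≤ 1 * (‖v‖ₑ * ‖U k x - Ω.indicator G x‖ₑ) :=
            mul_le_mul' (by simpa using
              (enorm_le_iff_norm_le (y := (1 : ℝ))).2 (by simpa using hb (u k x))) (hin _)
        _ = _ := one_mul _
    · rw [mul_left_comm]
      exact mul_le_mul_right (hin _) _
  exact tendsto_nhds_unique (hL1.congr' hk) hL2.neg

/-- A continuous approximation of the indicator function of `(0, ∞)`. -/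
def ramp (j : ℕ) (t : ℝ) : ℝ := max 0 (min 1 (((j : ℝ) + 1) * t))

theorem continuous_ramp (j : ℕ) : Continuous (ramp j) := by
  unfold ramp
  fun_prop

theorem ramp_mem (j : ℕ) (t : ℝ) : 0 ≤ ramp j t ∧ ramp j t ≤ 1 :=
  ⟨le_max_left _ _, max_le zero_le_one (min_le_left _ _)⟩

theorem abs_ramp_le (j : ℕ) (t : ℝ) : |ramp j t| ≤ 1 := by
  rw [abs_of_nonneg (ramp_mem j t).1]
  exact (ramp_mem j t).2

theorem ramp_of_nonpos (j : ℕ) {t : ℝ} (ht : t ≤ 0) : ramp j t = 0 :=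
  max_eq_left ((min_le_right _ _).trans (mul_nonpos_of_nonneg_of_nonpos (by positivity) ht))

theorem ramp_tendsto_of_pos {t : ℝ} (ht : 0 < t) :
    Tendsto (fun j => ramp j t) atTop (𝓝 1) := by
  obtain ⟨N, hN⟩ := exists_nat_gt (1 / t)
  refine tendsto_const_nhds.congr' ?_
  filter_upwards [eventually_ge_atTop N] with j hj
  have h1 : (N : ℝ) ≤ j := by exact_mod_cast hj
  have h2 : 1 ≤ ((j : ℝ) + 1) * t := by
    rw [div_lt_iff₀ ht] at hN
    nlinarith
  simp [ramp, min_eq_left h2]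

theorem integral_ramp_tendsto (t : ℝ) :
    Tendsto (fun j => ∫ s in (0 : ℝ)..t, ramp j s) atTop (𝓝 (max t 0)) := by
  rcases le_or_gt t 0 with ht | ht
  · refine tendsto_const_nhds.congr fun j => ?_
    rw [max_eq_right ht, intervalIntegral.integral_symm,
      intervalIntegral.integral_congr (g := fun _ => 0), intervalIntegral.integral_zero, neg_zero]
    intro s hs
    rw [uIcc_of_le ht] at hs
    exact ramp_of_nonpos j hs.2
  · have : max t 0 = ∫ _ in (0 : ℝ)..t, (1 : ℝ) := by simp [ht.le]
    rw [this]
    refine intervalIntegral.tendsto_integral_filter_of_dominated_convergence (fun _ => 1)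
      (.of_forall fun j => (continuous_ramp j).aestronglyMeasurable)
      (.of_forall fun j => .of_forall fun s _ => abs_ramp_le j s) (by simp)
      (.of_forall fun s hs => ?_)
    rw [uIoc_of_le ht.le] at hs
    exact ramp_tendsto_of_pos hs.1

theorem abs_integral_ramp_le (j : ℕ) (t : ℝ) : |∫ s in (0 : ℝ)..t, ramp j s| ≤ |t| := by
  have := intervalIntegral.norm_integral_le_of_norm_le_const (a := 0) (b := t) (C := 1)
    (f := ramp j) fun s _ => abs_ramp_le j s
  simpa using this

/-- The primitives of `ramp j` are `C^1` and tend to the positive part. As `ramp j 0 = 0`, the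
derivatives tend to the indicator of `(0,∞)` at every point, so nothing about the gradient on `{f =
0}` is required. -/
theorem MemW11.posPart (hΩ : IsOpen Ω) (hΩ1 : volume Ω = 1) (h : MemW11 Ω f G) :
    MemW11 Ω (fun x => max (f x) 0) ({x | 0 < f x}.indicator G) := by
  have hnull : NullMeasurableSet {x | 0 < f x} (volume.restrict Ω) :=
    nullMeasurableSet_lt aemeasurable_const h.2.1.1.aemeasurable
  have hj : ∀ j, MemW11 Ω (fun x => ∫ s in (0 : ℝ)..f x, ramp j s) (fun x => ramp j (f x) • G x) :=
    fun j => h.comp hΩ hΩ1 (fun t => (continuous_ramp j).integral_hasStrictDerivAt 0 t |>.hasDerivAt)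
      (continuous_ramp j) (abs_ramp_le j)
  refine .of_integrable h.2.1.pos_part (h.2.2.indicator₀ hnull) fun φ hφ hφc hφs v => ?_
  have h1 : Tendsto (fun j => ∫ x in Ω, (∫ s in (0 : ℝ)..f x, ramp j s) * fderiv ℝ φ x v) atTop
      (𝓝 (∫ x in Ω, max (f x) 0 * fderiv ℝ φ x v)) := by
    refine tendsto_integral_of_dominated_convergence (fun x => ‖f x * fderiv ℝ φ x v‖)
      (fun j => (integrableOn_mul_fderiv (hj j).2.1 hφ hφc v).1)
      (integrableOn_mul_fderiv h.2.1 hφ hφc v).norm (fun j => .of_forall fun x => ?_)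
      (.of_forall fun x => (integral_ramp_tendsto (f x)).mul_const _)
    rw [norm_mul, norm_mul]
    exact mul_le_mul_of_nonneg_right (abs_integral_ramp_le j (f x)) (norm_nonneg _)
  have h2 : Tendsto (fun j => ∫ x in Ω, φ x * inner ℝ (ramp j (f x) • G x) v) atTop
      (𝓝 (∫ x in Ω, φ x * inner ℝ ({x | 0 < f x}.indicator G x) v)) := by
    refine tendsto_integral_of_dominated_convergence (fun x => ‖φ x * inner ℝ (G x) v‖)
      (fun j => (integrableOn_mul_inner (hj j).2.2 hφ hφc v).1)
      (integrableOn_mul_inner h.2.2 hφ hφc v).norm (fun j => .of_forall fun x => ?_)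
      (.of_forall fun x => ?_)
    · rw [real_inner_smul_left, mul_left_comm, norm_mul]
      exact mul_le_of_le_one_left (norm_nonneg _) (abs_ramp_le j (f x))
    · simp_rw [real_inner_smul_left]
      refine Tendsto.const_mul _ ?_
      rcases le_or_gt (f x) 0 with hx | hx
      · simp [ramp_of_nonpos _ hx, indicator, hx.not_gt]
      · simpa [indicator, hx] using (ramp_tendsto_of_pos hx).mul_const (inner ℝ (G x) v)
  refine tendsto_nhds_unique h1 ((h2.neg).congr fun j => ?_)
  exact ((hj j).1.2.2 φ hφ hφc hφs v).symm

theorem MemW11.posPart_sub_const (hΩ : IsOpen Ω) (hΩ1 : volume Ω = 1) (h : MemW11 Ω f G) (a : ℝ) :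
    MemW11 Ω (fun x => max (f x - a) 0) ({x | a < f x}.indicator G) := by
  simpa only [sub_pos] using (h.sub_const hΩ1 a).posPart hΩ hΩ1

end ChainRule

/-! ### Medians and functions vanishing on half of the space. -/

section Truncation

variable {α : Type*} [MeasurableSpace α] {μ : Measure α} {p : ℝ}

theorem enorm_mul_measure_rpow_le_eLpNorm (hp : 1 ≤ p) {w : α → ℝ} {c : ℝ} {B : Set α}
    (hB : NullMeasurableSet B μ) (h : ∀ x ∈ B, ‖c‖ₑ ≤ ‖w x‖ₑ) :
    ‖c‖ₑ * μ B ^ (1 / p) ≤ eLpNorm w (ENNReal.ofReal p) μ := by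
  have hp0 : 0 < p := by linarith
  have e := eLpNorm_indicator_const₀ (μ := μ) (c := c) hB (p := ENNReal.ofReal p)
    (by simpa using hp0) ENNReal.ofReal_ne_top
  rw [ENNReal.toReal_ofReal hp0.le] at e
  rw [← e]
  refine eLpNorm_mono_enorm fun x => ?_
  by_cases hx : x ∈ B
  · simpa [hx] using h x hx
  · simp [hx]

variable [IsProbabilityMeasure μ]

/-- On `{w = 0}`, of measure at least `1/2`, the function `w - c` is the constant `-c`; so `|c|` is
at most twice the norm of `w - c`, and `3 = 1 + 2`. -/
theorem eLpNorm_le_three_mul_eLpNorm_sub_const (hp : 1 ≤ p) {w : α → ℝ}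
    (hw : AEStronglyMeasurable w μ) (h : μ {x | w x ≠ 0} ≤ 1 / 2) (c : ℝ) :
    eLpNorm w (ENNReal.ofReal p) μ ≤ 3 * eLpNorm (fun x => w x - c) (ENNReal.ofReal p) μ := by
  have hp0 : 0 < p := by linarith
  have hp1 : 1 ≤ ENNReal.ofReal p := by simpa using hp
  set N := eLpNorm (fun x => w x - c) (ENNReal.ofReal p) μ with hN
  have hZm : NullMeasurableSet {x | w x ≠ 0} μ :=
    (nullMeasurableSet_eq_fun hw.aemeasurable aemeasurable_const).compl
  have hZ : (1 / 2 : ℝ≥0∞) ≤ μ {x | w x ≠ 0}ᶜ := by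
    rw [prob_compl_eq_one_sub₀ hZm]
    refine ENNReal.le_sub_of_add_le_right (measure_ne_top _ _) ?_
    calc (1 / 2 : ℝ≥0∞) + μ {x | w x ≠ 0} ≤ 1 / 2 + 1 / 2 := by gcongr
      _ = 1 := ENNReal.add_halves 1
  have hc : ‖c‖ₑ ≤ 2 * N := by
    have h1 : ‖c‖ₑ * μ {x | w x ≠ 0}ᶜ ^ (1 / p) ≤ N := by
      refine enorm_mul_measure_rpow_le_eLpNorm hp hZm.compl fun x hx => ?_
      have : w x = 0 := by simpa using hx
      simp [this]
    have h2 : (1 / 2 : ℝ≥0∞) ≤ μ {x | w x ≠ 0}ᶜ ^ (1 / p) := by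
      calc (1 / 2 : ℝ≥0∞) = (1 / 2 : ℝ≥0∞) ^ (1 : ℝ) := by simp
        _ ≤ (1 / 2 : ℝ≥0∞) ^ (1 / p) :=
            ENNReal.rpow_le_rpow_of_exponent_ge (by simp) (by rw [div_le_one hp0]; exact hp)
        _ ≤ _ := by gcongr
    calc ‖c‖ₑ = 2 * (‖c‖ₑ * (1 / 2)) := by
          rw [mul_left_comm, one_div, ENNReal.mul_inv_cancel two_ne_zero ENNReal.ofNat_ne_top,
            mul_one]
      _ ≤ 2 * (‖c‖ₑ * μ {x | w x ≠ 0}ᶜ ^ (1 / p)) := by gcongr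
      _ ≤ 2 * N := by gcongr
  calc eLpNorm w (ENNReal.ofReal p) μ
      = eLpNorm ((fun x => w x - c) + fun _ => c) (ENNReal.ofReal p) μ := by
        congr 1
        ext x
        simp
    _ ≤ N + eLpNorm (fun _ : α => c) (ENNReal.ofReal p) μ :=
        eLpNorm_add_le (hw.sub aestronglyMeasurable_const) aestronglyMeasurable_const hp1
    _ ≤ N + 2 * N := by
        gcongr
        rw [eLpNorm_const' c (by simpa using hp0) ENNReal.ofReal_ne_top]
        simpa using hc
    _ = 3 * N := by ring

/-- The exponential makes `f` positive without changing its order, so that the rearrangement at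
`1/2` supplies the median. -/
theorem exists_median {f : α → ℝ} (hf : AEMeasurable f μ) :
    ∃ m : ℝ, μ {x | m < f x} ≤ 1 / 2 ∧ μ {x | f x < m} ≤ 1 / 2 := by
  wlog hfm : Measurable f generalizing f
  · obtain ⟨m, h1, h2⟩ := this hf.measurable_mk.aemeasurable hf.measurable_mk
    refine ⟨m, h1.trans' (measure_mono_ae ?_), h2.trans' (measure_mono_ae ?_)⟩
    · filter_upwards [hf.ae_eq_mk] with x hx (h : m < f x)
      exact h.trans_eq hx
    · filter_upwards [hf.ae_eq_mk] with x hx (h : f x < m)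
      exact hx.symm.trans_lt h
  set g : α → ℝ≥0∞ := fun x => ENNReal.ofReal (Real.exp (f x)) with hg
  have hgm : Measurable g := (Real.measurable_exp.comp hfm).ennreal_ofReal
  have hhalf : ENNReal.ofReal (1 / 2) = 1 / 2 := by
    rw [ENNReal.ofReal_div_of_pos two_pos]
    simp
  set L := decrRearr μ g (1 / 2) with hL
  have h1 : μ {x | L < g x} ≤ 1 / 2 := hhalf ▸ decrRearr_le_iff.1 (le_refl L)
  have h2 : (1 / 2 : ℝ≥0∞) ≤ μ {x | L ≤ g x} :=
    hhalf ▸ le_measure_decrRearr_le hgm (by norm_num : (1 / 2 : ℝ) ≤ 1)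
  have h3 : μ {x | g x < L} ≤ 1 / 2 := by
    have : {x | g x < L} = {x | L ≤ g x}ᶜ := by ext; simp
    rw [this, prob_compl_eq_one_sub (measurableSet_le measurable_const hgm), tsub_le_iff_right]
    calc (1 : ℝ≥0∞) = 1 / 2 + 1 / 2 := (ENNReal.add_halves 1).symm
      _ ≤ _ := by gcongr
  have hLtop : L ≠ ⊤ := by
    intro h
    rw [h] at h2
    simp [g] at h2
  have hL0 : L ≠ 0 := by
    intro h
    rw [h] at h1
    simp only [g, ENNReal.ofReal_pos, Real.exp_pos, ofPred_true, measure_univ] at h1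
    exact absurd h1 (not_le.2 (by rw [one_div]; exact ENNReal.one_half_lt_one))
  have hLpos : 0 < L.toReal := ENNReal.toReal_pos hL0 hLtop
  refine ⟨Real.log L.toReal, h1.trans' (measure_mono fun x hx => ?_),
    h3.trans' (measure_mono fun x hx => ?_)⟩
  · exact (ENNReal.lt_ofReal_iff_toReal_lt hLtop).2 ((Real.log_lt_iff_lt_exp hLpos).1 hx)
  · exact (ENNReal.ofReal_lt_iff_lt_toReal (Real.exp_pos _).le hLtop).2
      ((Real.lt_log_iff_exp_lt hLpos).1 hx)

end Truncation

/-! ### Maz'ya truncation: (i) is equivalent to (iv), and implies (ii) for `p > 1`. -/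

section Mazya

variable {n : ℕ} {Ω : Set (EuclideanSpace ℝ (Fin n))} {p : ℝ}
  {f : EuclideanSpace ℝ (Fin n) → ℝ} {G : EuclideanSpace ℝ (Fin n) → EuclideanSpace ℝ (Fin n)}

/-- Truncation: a Poincaré inequality in `L^p` bounds the `L^{p,1}` norm of a nonnegative function
that vanishes on half of the domain. -/
theorem lorentzNorm_le_of_poincareLp (hΩ : IsOpen Ω) (hΩ1 : volume Ω = 1) (hp : 1 ≤ p) {C : ℝ≥0}
    (hC : ∀ f G, MemW11 Ω f G →
      eLpNorm (fun x => f x - ⨍ y in Ω, f y) (ENNReal.ofReal p) (volume.restrict Ω)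
        ≤ C * ∫⁻ x in Ω, ‖G x‖ₑ)
    (h : MemW11 Ω f G) (hf0 : ∀ x, 0 ≤ f x) (hhalf : volume.restrict Ω {x | 0 < f x} ≤ 1 / 2) :
    lorentzNorm p (volume.restrict Ω) (fun x => ‖f x‖ₑ)
      ≤ ENNReal.ofReal p * (6 * C * ∫⁻ x in Ω, ‖G x‖ₑ) := by
  have := isProbabilityMeasure_restrict hΩ1
  set μ := volume.restrict Ω with hμ
  have hfm : AEMeasurable f μ := h.2.1.1.aemeasurable
  let a : ℤ → ℝ := fun k => 2 ^ k
  have ha0 : ∀ k, 0 < a k := fun k => by positivity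
  have ha2 : ∀ k, a (k + 1) = 2 * a k := fun k => by
    simp only [a]
    rw [zpow_add_one₀ two_ne_zero, mul_comm]
  let S : ℤ → Set (EuclideanSpace ℝ (Fin n)) := fun k => f ⁻¹' Ioc (a k) (a (k + 1))
  have hSm : ∀ k, NullMeasurableSet (S k) μ := fun k =>
    hfm.nullMeasurable measurableSet_Ioc
  have hSd : Pairwise (Function.onFun Disjoint S) := by
    have hmono : Monotone a := fun i j hij => zpow_le_zpow_right₀ one_le_two hij
    intro i j hij
    exact (hmono.pairwise_disjoint_on_Ioc_succ hij).preimage f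
  -- The slice `w` of `f` between `a k` and `a (k + 1)` equals `a k` on `{f > a (k + 1)}`, vanishes
  -- on half of `Ω`, and has gradient `∇f` on `S k` only. In `6 = 2 * 3`, the 3 replaces the mean by
  -- zero and the 2 is `a (k + 1) / a k`.
  have key : ∀ k, ENNReal.ofReal (a (k + 1)) *
      μ {x | ENNReal.ofReal (a (k + 1)) < ‖f x‖ₑ} ^ (1 / p) ≤ 6 * C * ∫⁻ x in S k, ‖G x‖ₑ ∂μ := by
    intro k
    have hw := (h.posPart_sub_const hΩ hΩ1 (a k)).sub (h.posPart_sub_const hΩ hΩ1 (a (k + 1)))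
    set w : EuclideanSpace ℝ (Fin n) → ℝ :=
      fun x => max (f x - a k) 0 - max (f x - a (k + 1)) 0 with hwdef
    have hGw : ∫⁻ x in Ω, ‖{x | a k < f x}.indicator G x - {x | a (k + 1) < f x}.indicator G x‖ₑ
        = ∫⁻ x in S k, ‖G x‖ₑ ∂μ := by
      rw [← lintegral_indicator₀ (hSm k)]
      refine lintegral_congr fun x => ?_
      have : a k < a (k + 1) := by rw [ha2]; linarith [ha0 k]
      by_cases h1 : a k < f x <;> by_cases h2 : a (k + 1) < f x
      · simp [indicator, h1, h2, S, mem_Ioc]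
      · simp [indicator, h1, h2, S, mem_Ioc, not_lt.1 h2]
      · exact absurd (this.trans h2) h1
      · simp [indicator, h1, h2, S, mem_Ioc]
    have h1 := hC _ _ hw
    rw [hGw] at h1
    have hw0 : μ {x | w x ≠ 0} ≤ 1 / 2 := by
      refine (measure_mono fun x hx => ?_).trans hhalf
      by_contra hx0
      have hx1 : f x ≤ 0 := not_lt.1 hx0
      refine hx ?_
      simp only [w]
      rw [max_eq_right (by linarith [ha0 k]), max_eq_right (by linarith [ha0 (k + 1)]), sub_zero]
    have h2 := eLpNorm_le_three_mul_eLpNorm_sub_const hp hw.2.1.1 hw0 (⨍ y in Ω, w y)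
    have h3 : ‖a k‖ₑ * μ {x | ENNReal.ofReal (a (k + 1)) < ‖f x‖ₑ} ^ (1 / p) ≤
        eLpNorm w (ENNReal.ofReal p) μ := by
      refine enorm_mul_measure_rpow_le_eLpNorm hp
        (nullMeasurableSet_lt aemeasurable_const hfm.enorm) fun x hx => ?_
      have hx' : a (k + 1) < f x := by
        have hx : ENNReal.ofReal (a (k + 1)) < ‖f x‖ₑ := hx
        rw [Real.enorm_of_nonneg (hf0 x)] at hx
        exact (ENNReal.ofReal_lt_ofReal_iff_of_nonneg (ha0 _).le).1 hx
      have : w x = a k := by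
        simp only [w]
        rw [max_eq_left (by linarith [ha2 k, ha0 k]), max_eq_left (by linarith), ha2]
        ring
      rw [this]
    rw [Real.enorm_of_nonneg (ha0 k).le] at h3
    calc ENNReal.ofReal (a (k + 1)) * μ {x | ENNReal.ofReal (a (k + 1)) < ‖f x‖ₑ} ^ (1 / p)
        = 2 * (ENNReal.ofReal (a k) * μ {x | ENNReal.ofReal (a (k + 1)) < ‖f x‖ₑ} ^ (1 / p)) := by
          rw [ha2, ENNReal.ofReal_mul two_pos.le, ENNReal.ofReal_ofNat, mul_assoc]
      _ ≤ 2 * (3 * (C * ∫⁻ x in S k, ‖G x‖ₑ ∂μ)) := by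
          exact mul_le_mul_right (h3.trans (h2.trans (mul_le_mul_right h1 _))) _
      _ = _ := by ring
  rw [lorentzNorm_eq_distrib hp]
  gcongr
  have hU : Ioi (0 : ℝ) ⊆ ⋃ k : ℤ, Ioc (a k) (a (k + 1)) := fun x hx => by
    obtain ⟨k, hk⟩ := exists_mem_Ioc_zpow (y := (2 : ℝ)) (mem_Ioi.1 hx) one_lt_two
    exact mem_iUnion.2 ⟨k, hk⟩
  let m : ℝ → ℝ≥0∞ := fun l => μ {x | ENNReal.ofReal l < ‖f x‖ₑ} ^ (1 / p)
  have hm : Antitone m := fun l l' hl => by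
    simp only [m]
    gcongr
  calc ∫⁻ l in Ioi (0 : ℝ), m l ≤ ∫⁻ l in ⋃ k : ℤ, Ioc (a k) (a (k + 1)), m l :=
        lintegral_mono_set hU
    _ ≤ ∑' k : ℤ, ∫⁻ l in Ioc (a k) (a (k + 1)), m l := lintegral_iUnion_le _ _
    _ ≤ ∑' k : ℤ, ENNReal.ofReal (a k) * m (a k) := by
        refine ENNReal.tsum_le_tsum fun k => ?_
        calc ∫⁻ l in Ioc (a k) (a (k + 1)), m l ≤ ∫⁻ _ in Ioc (a k) (a (k + 1)), m (a k) :=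
              setLIntegral_mono' measurableSet_Ioc fun l hl => hm hl.1.le
          _ = _ := by
              rw [setLIntegral_const, Real.volume_Ioc, ha2, mul_comm]
              congr 2
              ring
    -- The dyadic sum has the value at the left endpoint, `key` that at the right one; a sum over
    -- all integers is shift invariant.
    _ = ∑' k : ℤ, ENNReal.ofReal (a (k + 1)) * m (a (k + 1)) :=
        ((Equiv.addRight (1 : ℤ)).tsum_eq fun k => ENNReal.ofReal (a k) * m (a k)).symm
    _ ≤ ∑' k : ℤ, 6 * C * ∫⁻ x in S k, ‖G x‖ₑ ∂μ := ENNReal.tsum_le_tsum key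
    _ = 6 * C * ∫⁻ x in ⋃ k, S k, ‖G x‖ₑ ∂μ := by
        rw [ENNReal.tsum_mul_left, lintegral_iUnion₀ hSm fun i j hij => (hSd hij).aedisjoint]
    _ ≤ _ := mul_le_mul_right (setLIntegral_le_lintegral _ _) _

/-- `(|f - m| - r)_+` is the maximum of `(f - m - r)_+` and `(m - f - r)_+`. Each vanishes on half
of `Ω` because `m` is a median, and `12 = 6 + 6`. -/
theorem lorentzNorm_tsub_le_of_poincareLp (hΩ : IsOpen Ω) (hΩ1 : volume Ω = 1) (hp : 1 ≤ p)
    {C : ℝ≥0} (hC : ∀ f G, MemW11 Ω f G →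
      eLpNorm (fun x => f x - ⨍ y in Ω, f y) (ENNReal.ofReal p) (volume.restrict Ω)
        ≤ C * ∫⁻ x in Ω, ‖G x‖ₑ)
    (h : MemW11 Ω f G) {m : ℝ} (h1 : volume.restrict Ω {x | m < f x} ≤ 1 / 2)
    (h2 : volume.restrict Ω {x | f x < m} ≤ 1 / 2) {r : ℝ} (hr : 0 ≤ r) :
    lorentzNorm p (volume.restrict Ω) (fun x => ‖f x - m‖ₑ - ENNReal.ofReal r)
      ≤ ENNReal.ofReal p * (12 * C) *
        ∫⁻ x in {x | ENNReal.ofReal r < ‖f x - m‖ₑ}, ‖G x‖ₑ ∂volume.restrict Ω := by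
  have := isProbabilityMeasure_restrict hΩ1
  set μ := volume.restrict Ω with hμ
  have hfm : AEMeasurable f μ := h.2.1.1.aemeasurable
  have hSm : NullMeasurableSet {x | ENNReal.ofReal r < ‖f x - m‖ₑ} μ :=
    nullMeasurableSet_lt aemeasurable_const (hfm.sub_const m).enorm
  have hmem : ∀ x, r < |f x - m| → ENNReal.ofReal r < ‖f x - m‖ₑ := fun x hx => by
    rw [Real.enorm_eq_ofReal_abs]
    exact (ENNReal.ofReal_lt_ofReal_iff_of_nonneg hr).2 hx
  have hA := lorentzNorm_le_of_poincareLp hΩ hΩ1 hp hC (h.posPart_sub_const hΩ hΩ1 (m + r))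
    (fun x => le_max_right _ _) (h1.trans' (measure_mono fun x hx => by
      have : 0 < f x - (m + r) := by simpa using hx
      show m < f x
      linarith))
  have hB := lorentzNorm_le_of_poincareLp hΩ hΩ1 hp hC
    (h.neg.posPart_sub_const hΩ hΩ1 (-m + r))
    (fun x => le_max_right _ _) (h2.trans' (measure_mono fun x hx => by
      have : 0 < -f x - (-m + r) := by simpa using hx
      show f x < m
      linarith))
  have hA' : ∫⁻ x in Ω, ‖{x | m + r < f x}.indicator G x‖ₑ ≤
      ∫⁻ x in {x | ENNReal.ofReal r < ‖f x - m‖ₑ}, ‖G x‖ₑ ∂μ := by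
    rw [← lintegral_indicator₀ hSm]
    refine lintegral_mono fun x => ?_
    by_cases hx : m + r < f x
    · rw [indicator_of_mem (show x ∈ {x | m + r < f x} from hx), indicator_of_mem]
      exact hmem x (lt_of_lt_of_le (by linarith) (le_abs_self _))
    · simp [hx]
  have hB' : ∫⁻ x in Ω, ‖{x | -m + r < -f x}.indicator (fun x => -G x) x‖ₑ ≤
      ∫⁻ x in {x | ENNReal.ofReal r < ‖f x - m‖ₑ}, ‖G x‖ₑ ∂μ := by
    rw [← lintegral_indicator₀ hSm]
    refine lintegral_mono fun x => ?_
    by_cases hx : -m + r < -f x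
    · rw [indicator_of_mem (show x ∈ {x | -m + r < -f x} from hx), indicator_of_mem, enorm_neg]
      exact hmem x (lt_of_lt_of_le (by linarith) (neg_le_abs _))
    · rw [indicator_of_notMem (show x ∉ {x | -m + r < -f x} from hx)]
      simp
  refine (lorentzNorm_le_add_of_distrib hp (f := fun x => ‖max (f x - (m + r)) 0‖ₑ)
    (g := fun x => ‖max (-f x - (-m + r)) 0‖ₑ) fun l x hx => ?_).trans
    ((add_le_add hA hB).trans ?_)
  · have hx : l < ‖f x - m‖ₑ - ENNReal.ofReal r := hx
    rw [Real.enorm_eq_ofReal_abs, ← ENNReal.ofReal_sub _ hr] at hx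
    rcases le_total m (f x) with hmf | hmf
    · refine Or.inl (hx.trans_le ?_)
      rw [abs_of_nonneg (by linarith), Real.enorm_of_nonneg (le_max_right _ _)]
      exact ENNReal.ofReal_le_ofReal (le_max_of_le_left (by linarith))
    · refine Or.inr (hx.trans_le ?_)
      rw [abs_of_nonpos (by linarith), Real.enorm_of_nonneg (le_max_right _ _)]
      exact ENNReal.ofReal_le_ofReal (le_max_of_le_left (by linarith))
  · refine (add_le_add (mul_le_mul_right (mul_le_mul_right hA' _) _)
      (mul_le_mul_right (mul_le_mul_right hB' _) _)).trans (le_of_eq ?_)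
    ring

/-- Any constant may be replaced by the mean: `|c - f_Ω|` is at most the `L^1` norm of `f - c`,
hence at most its `L^{p,1}` norm. -/
theorem poincareLorentz_of_exists_const (hΩ1 : volume Ω = 1) (hp : 1 ≤ p) {K : ℝ≥0}
    (h : ∀ f G, MemW11 Ω f G → ∃ c : ℝ,
      lorentzNorm p (volume.restrict Ω) (fun x => ‖f x - c‖ₑ) ≤ K * ∫⁻ x in Ω, ‖G x‖ₑ) :
    PoincareLorentz Ω p := by
  have := isProbabilityMeasure_restrict hΩ1
  refine ⟨2 * (1 + Real.toNNReal p) * K, fun f G hfG => ?_⟩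
  set μ := volume.restrict Ω with hμ
  obtain ⟨m, hm⟩ := h f G hfG
  have hmean : ‖m - ⨍ y in Ω, f y‖ₑ ≤ K * ∫⁻ x in Ω, ‖G x‖ₑ := by
    have hi : Integrable (fun x => f x - m) μ := hfG.2.1.sub (integrable_const m)
    have e : m - ⨍ y in Ω, f y = - ∫ x, (f x - m) ∂μ := by
      rw [integral_sub hfG.2.1 (integrable_const m), average_eq]
      simp
    rw [e, enorm_neg]
    exact (enorm_integral_le_lintegral_enorm _).trans
      ((lintegral_le_lorentzNorm hp hi.1.enorm).trans hm)
  calc lorentzNorm p μ (fun x => ‖f x - ⨍ y in Ω, f y‖ₑ)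
      ≤ lorentzNorm p μ (fun x => ‖f x - m‖ₑ + ‖m - ⨍ y in Ω, f y‖ₑ) :=
        lorentzNorm_mono fun x => by
          rw [← sub_add_sub_cancel (f x) m]
          exact enorm_add_le _ _
    _ ≤ 2 * (K * (∫⁻ x in Ω, ‖G x‖ₑ) + ENNReal.ofReal p * (K * ∫⁻ x in Ω, ‖G x‖ₑ)) := by
        refine (lorentzNorm_add_le hp _ _).trans ?_
        gcongr
        exact (lorentzNorm_const_le hp _).trans (by gcongr)
    _ = _ := by
        push_cast
        rw [ENNReal.ofReal]
        ring

theorem PoincareLp.poincareLorentz (hΩ : IsOpen Ω) (hΩ1 : volume Ω = 1) (hp : 1 ≤ p)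
    (h : PoincareLp Ω p) : PoincareLorentz Ω p := by
  have := isProbabilityMeasure_restrict hΩ1
  obtain ⟨C, hC⟩ := h
  refine poincareLorentz_of_exists_const hΩ1 hp (K := Real.toNNReal p * (12 * C))
    fun f G hfG => ?_
  obtain ⟨m, h1, h2⟩ := exists_median (μ := volume.restrict Ω) hfG.2.1.1.aemeasurable
  refine ⟨m, ?_⟩
  have := lorentzNorm_tsub_le_of_poincareLp hΩ hΩ1 hp hC hfG h1 h2 le_rfl
  simp only [ENNReal.ofReal_zero, tsub_zero] at this
  refine this.trans (mul_le_mul' (le_of_eq ?_) (setLIntegral_le_lintegral _ _))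
  push_cast
  rfl

theorem PoincareLorentz.poincareLp (hΩ1 : volume Ω = 1) (hp : 1 ≤ p)
    (h : PoincareLorentz Ω p) : PoincareLp Ω p := by
  have := isProbabilityMeasure_restrict hΩ1
  obtain ⟨C, hC⟩ := h
  refine ⟨C, fun f G hfG => le_trans ?_ (hC f G hfG)⟩
  have hp0 : 0 < p := by linarith
  have hm : AEMeasurable (fun x => ‖f x - ⨍ y in Ω, f y‖ₑ) (volume.restrict Ω) :=
    (hfG.2.1.1.aemeasurable.sub_const _).enorm
  rw [eLpNorm_eq_lintegral_rpow_enorm_toReal (by simpa using hp0) ENNReal.ofReal_ne_top,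
    ENNReal.toReal_ofReal hp0.le, one_div, ENNReal.rpow_inv_le_iff hp0]
  exact lintegral_rpow_le_lorentzNorm hp hm

/-- Hardy's inequality. -/
theorem lintegral_weight_mul_avg_le (hp : 1 < p) {k : ℝ → ℝ≥0∞} (hk : Measurable k) :
    ∫⁻ s in Ioo (0 : ℝ) 1, ENNReal.ofReal (s ^ (1 / p - 1)) *
      ((∫⁻ u in Ioo 0 s, k u) / ENNReal.ofReal s) ≤
      ENNReal.ofReal (1 / (1 - 1 / p)) *
        ∫⁻ u in Ioo (0 : ℝ) 1, ENNReal.ofReal (u ^ (1 / p - 1)) * k u := by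
  have hp' : 1 / p < 1 := by rw [div_lt_one (by linarith)]; exact hp
  have hS : MeasurableSet {q : ℝ × ℝ | q.2 < q.1} := measurableSet_lt measurable_snd measurable_fst
  have hw : Measurable fun s : ℝ => ENNReal.ofReal (s ^ (1 / p - 2)) :=
    (measurable_id.pow_const _).ennreal_ofReal
  calc ∫⁻ s in Ioo (0 : ℝ) 1, ENNReal.ofReal (s ^ (1 / p - 1)) *
        ((∫⁻ u in Ioo 0 s, k u) / ENNReal.ofReal s)
      = ∫⁻ s in Ioo (0 : ℝ) 1, ∫⁻ u in Ioo (0 : ℝ) 1, {q : ℝ × ℝ | q.2 < q.1}.indicator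
          (fun q => ENNReal.ofReal (q.1 ^ (1 / p - 2)) * k q.2) (s, u) := by
        refine setLIntegral_congr_fun measurableSet_Ioo fun s hs => ?_
        have e1 : ∀ u, {q : ℝ × ℝ | q.2 < q.1}.indicator
            (fun q => ENNReal.ofReal (q.1 ^ (1 / p - 2)) * k q.2) (s, u) =
            (Iio s).indicator (fun u => ENNReal.ofReal (s ^ (1 / p - 2)) * k u) u := fun u => by
          simp [indicator]
        simp_rw [e1]
        rw [lintegral_indicator measurableSet_Iio, Measure.restrict_restrict measurableSet_Iio,
          lintegral_const_mul _ hk]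
        have e2 : Iio s ∩ Ioo 0 1 = Ioo 0 s := by
          ext u
          simp only [mem_inter_iff, mem_Iio, mem_Ioo]
          exact ⟨fun h => ⟨h.2.1, h.1⟩, fun h => ⟨h.2, h.1, h.2.trans hs.2⟩⟩
        rw [e2, ENNReal.div_eq_inv_mul, ← mul_assoc, ← ENNReal.ofReal_inv_of_pos hs.1,
          ← ENNReal.ofReal_mul (Real.rpow_nonneg hs.1.le _), ← Real.rpow_neg_one s,
          ← Real.rpow_add hs.1]
        congr 3
        ring
    _ = ∫⁻ u in Ioo (0 : ℝ) 1, ∫⁻ s in Ioo (0 : ℝ) 1, {q : ℝ × ℝ | q.2 < q.1}.indicator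
          (fun q => ENNReal.ofReal (q.1 ^ (1 / p - 2)) * k q.2) (s, u) := by
        refine lintegral_lintegral_swap (Measurable.aemeasurable ?_)
        exact ((hw.comp measurable_fst).mul (hk.comp measurable_snd)).indicator hS
    _ ≤ ∫⁻ u in Ioo (0 : ℝ) 1, ENNReal.ofReal (1 / (1 - 1 / p)) *
          (ENNReal.ofReal (u ^ (1 / p - 1)) * k u) := by
        refine setLIntegral_mono' measurableSet_Ioo fun u hu => ?_
        have e1 : ∀ s, {q : ℝ × ℝ | q.2 < q.1}.indicator
            (fun q => ENNReal.ofReal (q.1 ^ (1 / p - 2)) * k q.2) (s, u) =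
            (Ioi u).indicator (fun s => ENNReal.ofReal (s ^ (1 / p - 2)) * k u) s := fun s => by
          simp [indicator]
        simp_rw [e1]
        rw [lintegral_indicator measurableSet_Ioi, lintegral_mul_const _ hw, ← mul_assoc]
        gcongr
        refine (lintegral_mono' (Measure.restrict_mono le_rfl Measure.restrict_le_self) le_rfl).trans
          (le_of_eq ?_)
        -- After Fubini the inner integral is `∫_u^∞ s^{1/p-2} ds = u^{1/p-1} / (1 - 1/p)`; its
        -- convergence is where `p > 1` is indispensable.
        have h2 : 1 / p - 2 < -1 := by linarith
        rw [← ofReal_integral_eq_lintegral_ofReal (integrableOn_Ioi_rpow_of_lt h2 hu.1),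
          integral_Ioi_rpow_of_lt h2 hu.1, ← ENNReal.ofReal_mul (by
            rw [one_div_nonneg]; linarith)]
        · congr 1
          have h3 : 1 / p - 2 + 1 = -(1 - 1 / p) := by ring
          have h4 : 1 / p - 1 = -(1 - 1 / p) := by ring
          rw [h3, h4, neg_div_neg_eq]
          ring
        · filter_upwards [ae_restrict_mem measurableSet_Ioi] with s hs
          exact Real.rpow_nonneg (hu.1.trans hs).le _
    _ = _ := lintegral_const_mul' _ _ ENNReal.ofReal_ne_top

/-- For `s ≤ t` the oscillation of `g` at `s` is controlled by the average of the rearrangement of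
`(g - g^*(t))_+`. The choice `t = s` and the decreasing weight give the pointwise inequality; a
fixed `t` and Hardy's inequality give the integrated one. -/
theorem PoincareLp.rearrIneq (hΩ : IsOpen Ω) (hΩ1 : volume Ω = 1) (hp : 1 < p)
    (h : PoincareLp Ω p) : RearrIneq Ω p := by
  have := isProbabilityMeasure_restrict hΩ1
  obtain ⟨C, hC⟩ := h
  set K : ℝ≥0 := Real.toNNReal p * (12 * C) with hK
  refine ⟨(1 + Real.toNNReal (1 / (1 - 1 / p))) * K, fun f G hfG => ?_⟩
  set μ := volume.restrict Ω with hμ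
  obtain ⟨m, h1, h2⟩ := exists_median (μ := μ) hfG.2.1.1.aemeasurable
  have hgm : AEMeasurable (fun x => ‖f x - m‖ₑ) μ := (hfG.2.1.1.aemeasurable.sub_const m).enorm
  have hgi : ∫⁻ x, ‖f x - m‖ₑ ∂μ < ⊤ := (hfG.2.1.sub (integrable_const m)).2
  have hGm : AEMeasurable (fun x => ‖G x‖ₑ) μ := hfG.2.2.1.enorm
  set g : EuclideanSpace ℝ (Fin n) → ℝ≥0∞ := fun x => ‖f x - m‖ₑ with hg
  -- the truncation of `g` at height `g^*(t)`
  have key : ∀ t ∈ Ioo (0 : ℝ) 1, lorentzNorm p μ (fun x => g x - decrRearr μ g t) ≤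
      K * ∫⁻ s in Ioo 0 t, decrRearr μ (fun x => ‖G x‖ₑ) s := by
    intro t ht
    have hfin : decrRearr μ g t ≠ ⊤ := decrRearr_ne_top hgm hgi.ne ht.1
    have := lorentzNorm_tsub_le_of_poincareLp hΩ hΩ1 hp.le hC hfG h1 h2
      (ENNReal.toReal_nonneg (a := decrRearr μ g t))
    rw [ENNReal.ofReal_toReal hfin] at this
    refine this.trans (mul_le_mul' (le_of_eq ?_) ?_)
    · rw [hK]
      push_cast
      rfl
    · exact setLIntegral_le_decrRearr hGm (nullMeasurableSet_lt aemeasurable_const hgm)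
        (decrRearr_le_iff.1 le_rfl)
  have hosc : ∀ s t, 0 < s → s ≤ t → avgRearr μ g s - decrRearr μ g s ≤
      avgRearr μ (fun x => g x - decrRearr μ g t) s := by
    intro s t hs hst
    rw [tsub_le_iff_right]
    have hne : ENNReal.ofReal s ≠ 0 := by simpa using hs
    rw [avgRearr, ENNReal.div_le_iff hne ENNReal.ofReal_ne_top, add_mul, mul_comm,
      ofReal_mul_avgRearr μ _ hs]
    calc ∫⁻ u in Ioo 0 s, decrRearr μ g u
        ≤ ∫⁻ u in Ioo 0 s, (decrRearr μ (fun x => g x - decrRearr μ g t) u + decrRearr μ g s) := by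
          refine lintegral_mono fun u => ?_
          rw [decrRearr_tsub_const]
          exact le_tsub_add.trans (add_le_add le_rfl (decrRearr_antitone μ g hst))
      _ = _ := by
          rw [lintegral_add_right _ measurable_const, setLIntegral_const, Real.volume_Ioo, sub_zero]
  have hK1 : (K : ℝ≥0∞) ≤ ((1 + Real.toNNReal (1 / (1 - 1 / p))) * K : ℝ≥0) := by
    norm_cast
    exact le_mul_of_one_le_left' (by simp)
  have hK2 : ENNReal.ofReal (1 / (1 - 1 / p)) * (K : ℝ≥0∞) ≤
      ((1 + Real.toNNReal (1 / (1 - 1 / p))) * K : ℝ≥0) := by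
    rw [ENNReal.ofReal]
    norm_cast
    exact mul_le_mul_left (by simp) _
  refine ⟨m, fun s hs => ?_, fun t ht => ?_⟩
  · refine le_trans ?_ (mul_le_mul_left hK1 _)
    calc oscRearr p μ g s
        ≤ ENNReal.ofReal (s ^ (1 / p - 1)) * avgRearr μ (fun x => g x - decrRearr μ g s) s :=
          mul_le_mul_right (hosc s s hs.1 le_rfl) _
      _ ≤ lorentzNorm p μ (fun x => g x - decrRearr μ g s) / ENNReal.ofReal s := by
          rw [avgRearr, ← mul_div_assoc]
          gcongr
          rw [← lintegral_const_mul' _ _ ENNReal.ofReal_ne_top]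
          refine (setLIntegral_mono' measurableSet_Ioo fun u hu => ?_).trans
            (lintegral_mono_set (Ioo_subset_Ioo_right hs.2.le))
          exact mul_le_mul_left (weight_anti hp.le hu.1 hu.2.le) _
      _ ≤ (K * ∫⁻ u in Ioo 0 s, decrRearr μ (fun x => ‖G x‖ₑ) u) / ENNReal.ofReal s := by
          gcongr
          exact key s hs
      _ = _ := by rw [avgRearr, mul_div_assoc]
  · refine le_trans ?_ (mul_le_mul_left hK2 _)
    calc ∫⁻ s in Ioo 0 t, oscRearr p μ g s
        ≤ ∫⁻ s in Ioo 0 t, ENNReal.ofReal (s ^ (1 / p - 1)) *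
            avgRearr μ (fun x => g x - decrRearr μ g t) s :=
          setLIntegral_mono' measurableSet_Ioo fun s hs =>
            mul_le_mul_right (hosc s t hs.1 hs.2.le) _
      _ ≤ ∫⁻ s in Ioo 0 1, ENNReal.ofReal (s ^ (1 / p - 1)) *
            avgRearr μ (fun x => g x - decrRearr μ g t) s :=
          lintegral_mono_set (Ioo_subset_Ioo_right ht.2.le)
      _ ≤ _ := lintegral_weight_mul_avg_le hp (measurable_decrRearr μ _)
      _ ≤ ENNReal.ofReal (1 / (1 - 1 / p)) *
            (K * ∫⁻ s in Ioo 0 t, decrRearr μ (fun x => ‖G x‖ₑ) s) := by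
          gcongr
          exact key t ht
      _ = _ := by rw [mul_assoc]

end Mazya

/-! ### A Poincaré inequality in `L^1` for smooth functions on convex sets. -/

section ConvexPoincare

open Filter Topology

variable {n : ℕ}

theorem lintegral_comp_smul_add_le {s : ℝ} (hs : 1 / 2 ≤ s) (w : EuclideanSpace ℝ (Fin n))
    {h : EuclideanSpace ℝ (Fin n) → ℝ≥0∞} (hh : Measurable h) :
    ∫⁻ x, h (s • x + w) ≤ 2 ^ n * ∫⁻ x, h x := by
  have hs0 : 0 < s := by linarith
  have hm : Measurable fun y => h (y + w) := hh.comp (measurable_add_const w)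
  have e : ∫⁻ x, h (s • x + w) = ∫⁻ y, h (y + w) ∂(Measure.map (s • ·) volume) :=
    (lintegral_map hm (measurable_const_smul s)).symm
  rw [e, Measure.map_addHaar_smul _ hs0.ne', lintegral_smul_measure, smul_eq_mul,
    lintegral_add_right_eq_self (fun y => h y) w]
  gcongr
  rw [finrank_euclideanSpace, Fintype.card_fin, abs_of_pos (by positivity), ← inv_pow]
  calc ENNReal.ofReal (s⁻¹ ^ n) ≤ ENNReal.ofReal (2 ^ n) := by
        refine ENNReal.ofReal_le_ofReal (pow_le_pow_left₀ (by positivity) ?_ n)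
        rw [inv_le_comm₀ hs0 two_pos]
        linarith
    _ = 2 ^ n := by
        rw [ENNReal.ofReal_pow two_pos.le, ENNReal.ofReal_ofNat]

/-- A Poincaré inequality for smooth functions on convex sets. -/
theorem lintegral_lintegral_enorm_sub_le {B : Set (EuclideanSpace ℝ (Fin n))} (hB : Convex ℝ B)
    (hBm : MeasurableSet B) {d : ℝ} (hd : ∀ x ∈ B, ∀ y ∈ B, ‖y - x‖ ≤ d)
    {u : EuclideanSpace ℝ (Fin n) → ℝ} (hu : ContDiff ℝ 1 u)
    {W : EuclideanSpace ℝ (Fin n) → ℝ≥0∞} (hW : Measurable W)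
    (huW : ∀ x ∈ B, ‖fderiv ℝ u x‖ₑ ≤ W x) :
    ∫⁻ x in B, ∫⁻ y in B, ‖u y - u x‖ₑ ≤
      ENNReal.ofReal d * (2 ^ n * (volume B * ∫⁻ x in B, W x)) := by
  set h := B.indicator W with hh
  have hhm : Measurable h := hW.indicator hBm
  have hhI : ∫⁻ x, h x = ∫⁻ x in B, W x := lintegral_indicator hBm _
  have hpt : ∀ x ∈ B, ∀ y ∈ B, ‖u y - u x‖ₑ ≤
      ∫⁻ t in Ioo (0 : ℝ) 1, ENNReal.ofReal d * h ((1 - t) • x + t • y) := by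
    intro x hx y hy
    let c : ℝ → EuclideanSpace ℝ (Fin n) := fun t => (1 - t) • x + t • y
    have hc : ∀ t, HasDerivAt c (y - x) t := fun t => by
      have h1 : HasDerivAt (fun t : ℝ => (1 - t) • x) ((-1 : ℝ) • x) t :=
        ((hasDerivAt_id t).const_sub 1).smul_const x
      have h2 : HasDerivAt (fun t : ℝ => t • y) ((1 : ℝ) • y) t := (hasDerivAt_id t).smul_const y
      have e : y - x = (-1 : ℝ) • x + (1 : ℝ) • y := by
        rw [neg_one_smul, one_smul]
        abel
      rw [e]
      exact h1.add h2
    have hcc : Continuous c := continuous_iff_continuousAt.2 fun t => (hc t).continuousAt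
    have hdc : Continuous fun t => fderiv ℝ u (c t) (y - x) :=
      ((hu.continuous_fderiv one_ne_zero).comp hcc).clm_apply continuous_const
    have hftc : ∫ t in (0 : ℝ)..1, fderiv ℝ u (c t) (y - x) = u y - u x := by
      have := intervalIntegral.integral_eq_sub_of_hasDerivAt (a := 0) (b := 1)
        (f := fun t => u (c t)) (f' := fun t => fderiv ℝ u (c t) (y - x))
        (fun t _ => ((hu.differentiable one_ne_zero) (c t)).hasFDerivAt.comp_hasDerivAt t (hc t))
        (hdc.intervalIntegrable 0 1)
      simpa [c] using this
    rw [← hftc, intervalIntegral.integral_of_le zero_le_one, integral_Ioc_eq_integral_Ioo]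
    refine (enorm_integral_le_lintegral_enorm _).trans
      (setLIntegral_mono' measurableSet_Ioo fun t ht => ?_)
    have hct : c t ∈ B := hB hx hy (by linarith [ht.2]) ht.1.le (by ring)
    have e : h ((1 - t) • x + t • y) = W (c t) := indicator_of_mem hct W
    rw [e]
    calc ‖fderiv ℝ u (c t) (y - x)‖ₑ ≤ ‖fderiv ℝ u (c t)‖ₑ * ‖y - x‖ₑ :=
          ContinuousLinearMap.le_opENorm _ _
      _ ≤ W (c t) * ENNReal.ofReal d := by
          refine mul_le_mul' (huW _ hct) ?_
          rw [← ofReal_norm]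
          exact ENNReal.ofReal_le_ofReal (hd x hx y hy)
      _ = _ := mul_comm _ _
  -- Integrate first in the variable with the larger coefficient. That coefficient is at least
  -- `1/2`, so the Jacobian of the dilation costs at most `2^n`.
  have hJ : ∀ t ∈ Ioo (0 : ℝ) 1, ∫⁻ x in B, ∫⁻ y in B, h ((1 - t) • x + t • y) ≤
      2 ^ n * (volume B * ∫⁻ x in B, W x) := by
    intro t ht
    rcases le_total (1 / 2) t with h2 | h2
    · calc ∫⁻ x in B, ∫⁻ y in B, h ((1 - t) • x + t • y)
          ≤ ∫⁻ _ in B, 2 ^ n * ∫⁻ x in B, W x := by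
            refine lintegral_mono fun x => (setLIntegral_le_lintegral _ _).trans ?_
            simp_rw [add_comm ((1 - t) • x)]
            exact (lintegral_comp_smul_add_le h2 _ hhm).trans_eq (by rw [hhI])
        _ = _ := by rw [setLIntegral_const]; ring
    · rw [lintegral_lintegral_swap]
      · calc ∫⁻ y in B, ∫⁻ x in B, h ((1 - t) • x + t • y)
            ≤ ∫⁻ _ in B, 2 ^ n * ∫⁻ x in B, W x := by
              refine lintegral_mono fun x => (setLIntegral_le_lintegral _ _).trans ?_
              exact (lintegral_comp_smul_add_le (by linarith) _ hhm).trans_eq (by rw [hhI])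
          _ = _ := by rw [setLIntegral_const]; ring
      · exact (hhm.comp (by fun_prop)).aemeasurable
  have hm1 : ∀ x, Measurable fun q : EuclideanSpace ℝ (Fin n) × ℝ =>
      ENNReal.ofReal d * h ((1 - q.2) • x + q.2 • q.1) := fun x =>
    (hhm.comp (by fun_prop)).const_mul _
  have hm2 : Measurable fun q : EuclideanSpace ℝ (Fin n) × ℝ =>
      ∫⁻ y in B, ENNReal.ofReal d * h ((1 - q.2) • q.1 + q.2 • y) := by
    refine Measurable.lintegral_prod_right'
      (f := fun r : (EuclideanSpace ℝ (Fin n) × ℝ) × EuclideanSpace ℝ (Fin n) =>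
        ENNReal.ofReal d * h ((1 - r.1.2) • r.1.1 + r.1.2 • r.2)) ?_
    exact (hhm.comp (by fun_prop)).const_mul _
  calc ∫⁻ x in B, ∫⁻ y in B, ‖u y - u x‖ₑ
      ≤ ∫⁻ x in B, ∫⁻ y in B, ∫⁻ t in Ioo (0 : ℝ) 1,
          ENNReal.ofReal d * h ((1 - t) • x + t • y) :=
        setLIntegral_mono' hBm fun x hx => setLIntegral_mono' hBm fun y hy => hpt x hx y hy
    _ = ∫⁻ x in B, ∫⁻ t in Ioo (0 : ℝ) 1, ∫⁻ y in B,
          ENNReal.ofReal d * h ((1 - t) • x + t • y) :=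
        lintegral_congr fun x => lintegral_lintegral_swap (hm1 x).aemeasurable
    _ = ∫⁻ t in Ioo (0 : ℝ) 1, ∫⁻ x in B, ∫⁻ y in B,
          ENNReal.ofReal d * h ((1 - t) • x + t • y) :=
        lintegral_lintegral_swap hm2.aemeasurable
    _ ≤ ∫⁻ _ in Ioo (0 : ℝ) 1, ENNReal.ofReal d * (2 ^ n * (volume B * ∫⁻ x in B, W x)) := by
        refine setLIntegral_mono' measurableSet_Ioo fun t ht => ?_
        simp_rw [lintegral_const_mul' _ _ (ENNReal.ofReal_ne_top (r := d))]
        exact mul_le_mul_right (hJ t ht) _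
    _ = _ := by simp

end ConvexPoincare

/-! ### Local Poincaré inequalities, chained through the connected set `Ω`. -/

section Local

open Filter Topology

variable {n : ℕ} {Ω : Set (EuclideanSpace ℝ (Fin n))}

/-- The `L^1` Poincaré inequality on a part `D` of the domain `Ω`. -/
def LocalPoincare (Ω D : Set (EuclideanSpace ℝ (Fin n))) : Prop :=
  ∃ C : ℝ≥0, ∀ f G, MemW11 Ω f G → ∃ c : ℝ,
    ∫⁻ x in D, ‖f x - c‖ₑ ≤ C * ∫⁻ x in Ω, ‖G x‖ₑ

/-- The smooth inequality holds for mollifications, which see the true gradient because the closed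
ball is compact in `Ω`; Fatou's lemma passes to the limit. The constant is `f x` for a point `x`
where the inner integral does not exceed its average. -/
theorem localPoincare_ball (hΩ : IsOpen Ω) {z : EuclideanSpace ℝ (Fin n)} {R : ℝ} (hR : 0 < R)
    (hball : Metric.closedBall z R ⊆ Ω) : LocalPoincare Ω (Metric.ball z R) := by
  set B := Metric.ball z R with hBdef
  have hBΩ : B ⊆ Ω := Metric.ball_subset_closedBall.trans hball
  have hBm : MeasurableSet B := measurableSet_ball
  have hB0 : volume B ≠ 0 := (Metric.measure_ball_pos volume z hR).ne'
  have hBtop : volume B ≠ ⊤ := measure_ball_lt_top.ne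
  refine ⟨Real.toNNReal (2 * R) * 2 ^ n, fun f G h => ?_⟩
  obtain ⟨hfi, hGi⟩ := h.integrable_indicator hΩ
  set K : ℝ≥0∞ := ENNReal.ofReal (2 * R) * (2 ^ n * (volume B * ∫⁻ x in Ω, ‖G x‖ₑ)) with hK
  have hmoll : ∀ᶠ k in atTop, ∫⁻ x in B, ∫⁻ y in B,
      ‖mollify k (Ω.indicator f) y - mollify k (Ω.indicator f) x‖ₑ ≤ K := by
    obtain ⟨δ, hδ, hsub⟩ := (isCompact_closedBall z R).exists_cthickening_subset_open hΩ hball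
    filter_upwards [mollifier_rOut_tendsto (n := n) |>.eventually (gt_mem_nhds hδ)] with k hk
    have hcont : Continuous (mollify k (Ω.indicator G)) := (contDiff_mollify k hGi).continuous
    refine (lintegral_lintegral_enorm_sub_le (convex_ball z R) hBm (d := 2 * R) ?_
      ((contDiff_mollify k hfi).of_le (by norm_cast))
      (W := fun x => ‖mollify k (Ω.indicator G) x‖ₑ) hcont.measurable.enorm ?_).trans ?_
    · intro x hx y hy
      have h1 : dist x z < R := hx
      have h2 : dist y z < R := hy
      rw [← dist_eq_norm]
      linarith [dist_triangle_right y x z]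
    · intro x hx
      have hxb : Metric.closedBall x (mollifier n k).rOut ⊆ Ω := fun y hy =>
        hsub (Metric.mem_cthickening_of_dist_le y x δ _ (Metric.ball_subset_closedBall hx)
          (le_trans hy hk.le))
      rw [enorm_le_iff_norm_le]
      refine ContinuousLinearMap.opNorm_le_bound _ (norm_nonneg _) fun v => ?_
      rw [h.fderiv_mollify hΩ hxb v]
      exact norm_inner_le_norm _ _
    · refine mul_le_mul_right (mul_le_mul_right (mul_le_mul_right ?_ _) _) _
      refine (setLIntegral_le_lintegral _ _).trans ((lintegral_enorm_mollify_le k hGi.1).trans ?_)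
      rw [← lintegral_indicator hΩ.measurableSet]
      refine lintegral_mono fun x => ?_
      by_cases hx : x ∈ Ω <;> simp [hx]
  have hlim : ∀ᵐ x ∂volume.restrict B,
      Tendsto (fun k => mollify k (Ω.indicator f) x) atTop (𝓝 (f x)) := by
    filter_upwards [ae_restrict_of_ae (ae_tendsto_mollify hfi), ae_restrict_mem hBm] with x hx hxB
    rwa [indicator_of_mem (hBΩ hxB)] at hx
  have hcm : ∀ k, Continuous (mollify k (Ω.indicator f)) := fun k =>
    (contDiff_mollify k hfi).continuous
  have hmain : ∫⁻ x in B, ∫⁻ y in B, ‖f y - f x‖ₑ ≤ K := by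
    calc ∫⁻ x in B, ∫⁻ y in B, ‖f y - f x‖ₑ
        ≤ ∫⁻ x in B, liminf (fun k => ∫⁻ y in B,
            ‖mollify k (Ω.indicator f) y - mollify k (Ω.indicator f) x‖ₑ) atTop := by
          refine lintegral_mono_ae (hlim.mono fun x hx => ?_)
          refine le_trans (lintegral_mono_ae (hlim.mono fun y hy => ?_))
            (lintegral_liminf_le fun k => ((hcm k).measurable.sub_const _).enorm)
          exact ((hy.sub hx).enorm.liminf_eq).ge
      _ ≤ liminf (fun k => ∫⁻ x in B, ∫⁻ y in B,
            ‖mollify k (Ω.indicator f) y - mollify k (Ω.indicator f) x‖ₑ) atTop := by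
          refine lintegral_liminf_le fun k => Measurable.lintegral_prod_right'
            (f := fun q : EuclideanSpace ℝ (Fin n) × EuclideanSpace ℝ (Fin n) =>
              ‖mollify k (Ω.indicator f) q.2 - mollify k (Ω.indicator f) q.1‖ₑ) ?_
          exact (((hcm k).comp continuous_snd).sub ((hcm k).comp continuous_fst)).measurable.enorm
      _ ≤ K := liminf_le_of_frequently_le' hmoll.frequently
  have hfm : AEMeasurable f (volume.restrict B) :=
    h.2.1.1.aemeasurable.mono_measure (Measure.restrict_mono hBΩ le_rfl)
  have hm : AEMeasurable (fun x => ∫⁻ y in B, ‖f y - f x‖ₑ) (volume.restrict B) := by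
    refine AEMeasurable.lintegral_prod_right'
      (f := fun q : EuclideanSpace ℝ (Fin n) × EuclideanSpace ℝ (Fin n) => ‖f q.2 - f q.1‖ₑ) ?_
    exact (hfm.comp_snd.sub hfm.comp_fst).enorm
  obtain ⟨x, -, hx⟩ := exists_le_setLAverage hB0 hBtop hm
  refine ⟨f x, hx.trans ?_⟩
  rw [setLAverage_eq, ENNReal.div_le_iff hB0 hBtop]
  refine hmain.trans (le_of_eq ?_)
  rw [hK, ENNReal.ofReal]
  push_cast
  ring

/-- On the overlap, which has positive measure `v`, both constants are close to `f`, so they differ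
by at most `(C + C') / v` times the integral of the gradient. -/
theorem LocalPoincare.union {D D' : Set (EuclideanSpace ℝ (Fin n))} (hΩ1 : volume Ω = 1)
    (hD : D ⊆ Ω) (hD' : D' ⊆ Ω) (h : LocalPoincare Ω D) (h' : LocalPoincare Ω D')
    (hne : volume (D ∩ D') ≠ 0) : LocalPoincare Ω (D ∪ D') := by
  obtain ⟨C, hC⟩ := h
  obtain ⟨C', hC'⟩ := h'
  set v := volume (D ∩ D') with hv
  have hvtop : v ≠ ⊤ := ne_top_of_le_ne_top (by rw [hΩ1]; exact ENNReal.one_ne_top)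
    (measure_mono (inter_subset_left.trans hD))
  refine ⟨(C + C') + (C + C') / v.toNNReal, fun f G hf => ?_⟩
  obtain ⟨c, hc⟩ := hC f G hf
  obtain ⟨c', hc'⟩ := hC' f G hf
  set I := ∫⁻ x in Ω, ‖G x‖ₑ with hI
  have hm : AEMeasurable (fun x => ‖f x - c‖ₑ) (volume.restrict (D ∩ D')) :=
    ((hf.2.1.1.aemeasurable.mono_measure
      (Measure.restrict_mono (inter_subset_left.trans hD) le_rfl)).sub_const c).enorm
  have hcc : ‖c' - c‖ₑ ≤ (C + C') / v * I := by
    have h1 : ‖c' - c‖ₑ * v ≤ (C + C') * I := by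
      calc ‖c' - c‖ₑ * v = ∫⁻ _ in D ∩ D', ‖c' - c‖ₑ := (setLIntegral_const _ _).symm
        _ ≤ ∫⁻ x in D ∩ D', (‖f x - c‖ₑ + ‖f x - c'‖ₑ) := by
            refine lintegral_mono fun x => ?_
            have : c' - c = (f x - c) - (f x - c') := by ring
            rw [this]
            exact enorm_sub_le
        _ = (∫⁻ x in D ∩ D', ‖f x - c‖ₑ) + ∫⁻ x in D ∩ D', ‖f x - c'‖ₑ := lintegral_add_left' hm _
        _ ≤ C * I + C' * I := add_le_add ((lintegral_mono_set inter_subset_left).trans hc)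
            ((lintegral_mono_set inter_subset_right).trans hc')
        _ = _ := (add_mul _ _ _).symm
    rw [← ENNReal.mul_div_right_comm]
    rwa [ENNReal.le_div_iff_mul_le (Or.inl hne) (Or.inl hvtop)]
  refine ⟨c, ?_⟩
  calc ∫⁻ x in D ∪ D', ‖f x - c‖ₑ
      ≤ (∫⁻ x in D, ‖f x - c‖ₑ) + ∫⁻ x in D', ‖f x - c‖ₑ := lintegral_union_le _ _ _
    _ ≤ C * I + ∫⁻ x in D', (‖f x - c'‖ₑ + ‖c' - c‖ₑ) := by
        refine add_le_add hc (lintegral_mono fun x => ?_)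
        rw [← sub_add_sub_cancel (f x) c' c]
        exact enorm_add_le _ _
    _ = C * I + ((∫⁻ x in D', ‖f x - c'‖ₑ) + ‖c' - c‖ₑ * volume D') := by
        rw [lintegral_add_right _ measurable_const, setLIntegral_const]
    _ ≤ C * I + (C' * I + (C + C') / v * I * 1) := by
        gcongr
        rw [← hΩ1]
        exact measure_mono hD'
    _ = _ := by
        rw [ENNReal.coe_add, ENNReal.coe_div (by simp [ENNReal.toNNReal_eq_zero_iff, hne, hvtop]),
          ENNReal.coe_toNNReal hvtop, ENNReal.coe_add]
        ring

/-- In a domain the `L^1` Poincaré inequality holds on subsets of almost full measure. -/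
theorem exists_localPoincare (hΩ : IsOpen Ω) (hc : IsConnected Ω) (hΩ1 : volume Ω = 1)
    {η : ℝ≥0∞} (hη : η ≠ 0) :
    ∃ D, IsOpen D ∧ D ⊆ Ω ∧ LocalPoincare Ω D ∧ volume (Ω \ D) < η := by
  obtain ⟨z, hz⟩ := hc.nonempty
  have hb : ∀ x ∈ Ω, ∃ R > 0, Metric.closedBall x R ⊆ Ω := fun x hx =>
    Metric.nhds_basis_closedBall.mem_iff.1 (hΩ.mem_nhds hx)
  -- The points joined to `z` by a good set. Adding a ball to such a set shows that both `U` and `Ω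
  -- \ U` are open, so `U` contains `Ω`.
  let U : Set (EuclideanSpace ℝ (Fin n)) :=
    {x | ∃ D, IsOpen D ∧ D ⊆ Ω ∧ LocalPoincare Ω D ∧ z ∈ D ∧ x ∈ D}
  have hUo : IsOpen U := by
    rw [isOpen_iff_forall_mem_open]
    rintro x ⟨D, h1, h2, h3, h4, h5⟩
    exact ⟨D, fun y hy => ⟨D, h1, h2, h3, h4, hy⟩, h1, h5⟩
  have hzU : z ∈ U := by
    obtain ⟨R, hR, hRs⟩ := hb z hz
    exact ⟨Metric.ball z R, Metric.isOpen_ball, Metric.ball_subset_closedBall.trans hRs,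
      localPoincare_ball hΩ hR hRs, Metric.mem_ball_self hR, Metric.mem_ball_self hR⟩
  have hVo : IsOpen (Ω \ U) := by
    rw [isOpen_iff_forall_mem_open]
    rintro x ⟨hx, hxU⟩
    obtain ⟨R, hR, hRs⟩ := hb x hx
    have hRs' := Metric.ball_subset_closedBall.trans hRs
    refine ⟨Metric.ball x R, fun y hy => ⟨hRs' hy, ?_⟩, Metric.isOpen_ball,
      Metric.mem_ball_self hR⟩
    rintro ⟨D, h1, h2, h3, h4, h5⟩
    refine hxU ⟨D ∪ Metric.ball x R, h1.union Metric.isOpen_ball, union_subset h2 hRs', ?_,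
      Or.inl h4, Or.inr (Metric.mem_ball_self hR)⟩
    exact h3.union hΩ1 h2 hRs' (localPoincare_ball hΩ hR hRs)
      ((h1.inter Metric.isOpen_ball).measure_pos volume ⟨y, h5, hy⟩).ne'
  have hΩU : Ω ⊆ U := hc.isPreconnected.subset_left_of_subset_union hUo hVo disjoint_sdiff_right
    (fun x hx => by by_cases h : x ∈ U; exacts [Or.inl h, Or.inr ⟨hx, h⟩]) ⟨z, hz, hzU⟩
  choose D h1 h2 h3 h4 h5 using fun x : Ω => hΩU x.2
  -- Countably many good sets suffice. All contain `z`, so finite unions are again good, and their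
  -- measures tend to that of `Ω`.
  obtain ⟨T, hT, hTU⟩ := TopologicalSpace.isOpen_iUnion_countable D h1
  have hcover : ⋃ i ∈ T, D i = Ω := by
    rw [hTU]
    exact (iUnion_subset h2).antisymm fun x hx => mem_iUnion.2 ⟨⟨x, hx⟩, h5 _⟩
  have hTne : T.Nonempty := by
    rw [nonempty_iff_ne_empty]
    rintro rfl
    simp only [mem_empty_iff_false, iUnion_of_empty, iUnion_empty] at hcover
    rw [← hcover] at hz
    exact hz
  obtain ⟨e, he⟩ := hT.exists_eq_range hTne
  have hcover' : ⋃ k, D (e k) = Ω := by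
    rw [← hcover, he, biUnion_range]
  have hacc : ∀ N, IsOpen (accumulate (fun k => D (e k)) N) ∧ accumulate (fun k => D (e k)) N ⊆ Ω ∧
      LocalPoincare Ω (accumulate (fun k => D (e k)) N) ∧ z ∈ accumulate (fun k => D (e k)) N := by
    intro N
    induction N with
    | zero =>
      have : accumulate (fun k => D (e k)) 0 = D (e 0) := by
        ext x
        simp
      rw [this]
      exact ⟨h1 _, h2 _, h3 _, h4 _⟩
    | succ N ih =>
      have : accumulate (fun k => D (e k)) (N + 1) =
          accumulate (fun k => D (e k)) N ∪ D (e (N + 1)) := by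
        ext x
        simp only [mem_accumulate, mem_union]
        constructor
        · rintro ⟨k, hk, hx⟩
          rcases Nat.le_succ_iff.1 hk with hk | rfl
          · exact Or.inl ⟨k, hk, hx⟩
          · exact Or.inr hx
        · rintro (⟨k, hk, hx⟩ | hx)
          · exact ⟨k, hk.trans (Nat.le_succ N), hx⟩
          · exact ⟨N + 1, le_rfl, hx⟩
      rw [this]
      obtain ⟨i1, i2, i3, i4⟩ := ih
      exact ⟨i1.union (h1 _), union_subset i2 (h2 _), i3.union hΩ1 i2 (h2 _) (h3 _)
        ((i1.inter (h1 _)).measure_pos volume ⟨z, i4, h4 _⟩).ne', Or.inl i4⟩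
  have hlim := tendsto_measure_iUnion_accumulate (μ := (volume : Measure (EuclideanSpace ℝ (Fin n))))
    (f := fun k => D (e k))
  rw [hcover', hΩ1] at hlim
  have hlim' := ENNReal.Tendsto.sub (tendsto_const_nhds (x := (1 : ℝ≥0∞))) hlim
    (Or.inl ENNReal.one_ne_top)
  rw [tsub_self] at hlim'
  obtain ⟨N, hN⟩ := (hlim'.eventually (gt_mem_nhds (pos_iff_ne_zero.2 hη))).exists
  obtain ⟨i1, i2, i3, -⟩ := hacc N
  refine ⟨_, i1, i2, i3, ?_⟩
  rw [measure_sdiff i2 i1.measurableSet.nullMeasurableSet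
    (ne_top_of_le_ne_top (by rw [hΩ1]; exact ENNReal.one_ne_top) (measure_mono i2)), hΩ1]
  exact hN

end Local

/-! ### The oscillation controls the distance of `g` from the constant `g^*(1/2)`, also for `p = 1`.
-/

section OscillationBelow

variable {α : Type*} [MeasurableSpace α] {μ : Measure α} {p : ℝ}
  {g : α → ℝ≥0∞}

theorem avgRearr_sub_le_oscRearr (hp : 1 ≤ p) {s : ℝ} (hs : s ∈ Ioo (0 : ℝ) 1) :
    avgRearr μ g s - decrRearr μ g s ≤ oscRearr p μ g s :=
  le_mul_of_one_le_left' (one_le_weight hp hs)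

variable [IsProbabilityMeasure μ]

/-- `g^*` is at least `a` on `(0,u)` and at least `b` on `(u,s)`, so `s (g^{**}(s) - b)` is at least
`u (a - b)`, and `u ≥ s/2`. -/
theorem decrRearr_tsub_le_two_mul (hg : AEMeasurable g μ) (hi : ∫⁻ x, g x ∂μ ≠ ⊤) {u s : ℝ}
    (hu : 0 < u) (hus : u ≤ s) (hsu : s ≤ 2 * u) :
    decrRearr μ g u - decrRearr μ g s ≤ 2 * (avgRearr μ g s - decrRearr μ g s) := by
  have hs : 0 < s := hu.trans_le hus
  set a := decrRearr μ g u with ha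
  set b := decrRearr μ g s with hb
  have hba : b ≤ a := decrRearr_antitone μ g hus
  have hbt : b ≠ ⊤ := decrRearr_ne_top hg hi hs
  have h1 : ENNReal.ofReal u * a + ENNReal.ofReal (s - u) * b ≤
      ENNReal.ofReal s * avgRearr μ g s := by
    rw [ofReal_mul_avgRearr μ g hs]
    calc ENNReal.ofReal u * a + ENNReal.ofReal (s - u) * b
        = (∫⁻ _ in Ioo 0 u, a) + ∫⁻ _ in Ioo u s, b := by
          simp only [setLIntegral_const, Real.volume_Ioo, sub_zero, mul_comm]
      _ ≤ (∫⁻ r in Ioo 0 u, decrRearr μ g r) + ∫⁻ r in Ioo u s, decrRearr μ g r :=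
          add_le_add
            (setLIntegral_mono' measurableSet_Ioo fun r hr => decrRearr_antitone μ g hr.2.le)
            (setLIntegral_mono' measurableSet_Ioo fun r hr => decrRearr_antitone μ g hr.2.le)
      _ = ∫⁻ r in Ioo 0 u ∪ Ioo u s, decrRearr μ g r :=
          (lintegral_union measurableSet_Ioo (disjoint_left.2 fun r hr hr' =>
            absurd hr.2 (not_lt.2 hr'.1.le))).symm
      _ ≤ _ := lintegral_mono_set (union_subset (Ioo_subset_Ioo_right hus)
          (Ioo_subset_Ioo_left hu.le))
  have h2 : ENNReal.ofReal s * ((a - b) / 2 + b) ≤ ENNReal.ofReal s * avgRearr μ g s := by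
    refine le_trans ?_ h1
    have e : ENNReal.ofReal s * b = ENNReal.ofReal u * b + ENNReal.ofReal (s - u) * b := by
      rw [← add_mul, ← ENNReal.ofReal_add hu.le (by linarith)]
      congr 2
      ring
    have e' : ENNReal.ofReal u * a = ENNReal.ofReal u * (a - b) + ENNReal.ofReal u * b := by
      rw [← mul_add, tsub_add_cancel_of_le hba]
    rw [mul_add, e, e', add_assoc]
    refine add_le_add ?_ le_rfl
    rw [ENNReal.div_eq_inv_mul, ← mul_assoc]
    refine mul_le_mul_left ?_ _
    rw [← div_eq_mul_inv, ENNReal.div_le_iff two_ne_zero ENNReal.ofNat_ne_top, mul_comm]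
    calc ENNReal.ofReal s ≤ ENNReal.ofReal (2 * u) := ENNReal.ofReal_le_ofReal hsu
      _ = 2 * ENNReal.ofReal u := by rw [ENNReal.ofReal_mul two_pos.le, ENNReal.ofReal_ofNat]
  rw [ENNReal.mul_le_mul_iff_right (by simpa using hs) ENNReal.ofReal_ne_top] at h2
  have h3 := ENNReal.le_sub_of_add_le_right hbt h2
  rw [ENNReal.div_le_iff two_ne_zero ENNReal.ofNat_ne_top] at h3
  rwa [mul_comm] at h3

theorem lintegral_half_tsub_le (hp : 1 ≤ p) (hg : AEMeasurable g μ) (hi : ∫⁻ x, g x ∂μ ≠ ⊤) :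
    ∫⁻ x, (decrRearr μ g (1 / 2) - g x) ∂μ ≤ 2 * ∫⁻ s in Ioo (0 : ℝ) 1, oscRearr p μ g s := by
  set m := decrRearr μ g (1 / 2) with hm
  rw [← lintegral_comp_decrRearr hg (Φ := fun y => m - y) (by fun_prop),
    ← lintegral_const_mul' _ _ ENNReal.ofNat_ne_top]
  refine setLIntegral_mono' measurableSet_Ioo fun s hs => ?_
  rcases le_total s (1 / 2) with h | h
  · rw [tsub_eq_zero_of_le (decrRearr_antitone μ g h)]
    exact zero_le
  · exact (decrRearr_tsub_le_two_mul hg hi (by norm_num) h (by linarith [hs.2])).trans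
      (mul_le_mul_right (avgRearr_sub_le_oscRearr hp hs) _)

/-- Dilation by 2 gains the factor `2^{1/p} > 1`, which is what permits absorption in the next
estimate. -/
theorem lintegral_Ioi_weight_mul_comp_half {k : ℝ → ℝ≥0∞} (hk : Measurable k) {ε : ℝ}
    (hε : 0 ≤ ε) :
    ∫⁻ s in Ioi (2 * ε), ENNReal.ofReal (s ^ (1 / p - 1)) * k (s / 2) =
      ENNReal.ofReal (2 ^ (1 / p)) * ∫⁻ s in Ioi ε, ENNReal.ofReal (s ^ (1 / p - 1)) * k s := by
  have hm : Measurable ((Ioi (2 * ε)).indicator fun s : ℝ =>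
      ENNReal.ofReal (s ^ (1 / p - 1)) * k (s / 2)) :=
    ((measurable_weight p).mul (hk.comp (measurable_id.div_const 2))).indicator measurableSet_Ioi
  rw [← lintegral_indicator measurableSet_Ioi, ← Real.smul_map_volume_mul_left (two_ne_zero' ℝ),
    lintegral_smul_measure, lintegral_map hm (measurable_const_mul 2), Real.smul_map_volume_mul_left
    two_ne_zero, ← lintegral_indicator measurableSet_Ioi, smul_eq_mul,
    ← lintegral_const_mul' _ _ ENNReal.ofReal_ne_top,
    ← lintegral_const_mul' _ _ ENNReal.ofReal_ne_top]
  refine lintegral_congr fun s => ?_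
  by_cases hs : s ∈ Ioi ε
  · have hs' : 2 * s ∈ Ioi (2 * ε) := by
      simp only [mem_Ioi] at hs ⊢
      linarith
    have hs0 : 0 < s := hε.trans_lt hs
    rw [indicator_of_mem hs, indicator_of_mem hs', ← mul_assoc, ← mul_assoc,
      ← ENNReal.ofReal_mul (by positivity), ← ENNReal.ofReal_mul (by positivity),
      mul_div_cancel_left₀ s two_ne_zero, Real.mul_rpow two_pos.le hs0.le, ← mul_assoc]
    congr 3
    rw [abs_two, Real.rpow_sub_one two_ne_zero]
    ring
  · have hs' : 2 * s ∉ Ioi (2 * ε) := by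
      simp only [mem_Ioi] at hs ⊢
      linarith
    rw [indicator_of_notMem hs, indicator_of_notMem hs', mul_zero, mul_zero]

/-- Let `k = (g^* - g^*(1/2))_+`. On `(0,1)`, `k(s/2)` exceeds `k(s)` by at most twice `g^{**} -
g^*` at `s`. Integrated against the weight this reads `2^{1/p} N ≤ N + 2O`. Restricting to `s > ε`
makes `N` finite, hence absorbable; then `ε` tends to zero. -/
theorem lorentzNorm_tsub_half_le (hp : 1 ≤ p) (hg : AEMeasurable g μ) (hi : ∫⁻ x, g x ∂μ ≠ ⊤) :
    lorentzNorm p μ (fun x => g x - decrRearr μ g (1 / 2)) ≤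
      ENNReal.ofReal (2 / (2 ^ (1 / p) - 1)) * ∫⁻ s in Ioo (0 : ℝ) 1, oscRearr p μ g s := by
  have hp0 : 0 < p := by linarith
  have hκ : 0 < (2 : ℝ) ^ (1 / p) - 1 := by
    have := Real.one_lt_rpow one_lt_two (by positivity : 0 < 1 / p)
    linarith
  set m := decrRearr μ g (1 / 2) with hm
  set O := ∫⁻ s in Ioo (0 : ℝ) 1, oscRearr p μ g s with hO
  let k : ℝ → ℝ≥0∞ := fun s => decrRearr μ g s - m
  have hk : Measurable k := (measurable_decrRearr μ g).sub_const m
  have hk0 : ∀ s, 1 / 2 ≤ s → k s = 0 := fun s hs =>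
    tsub_eq_zero_of_le (decrRearr_antitone μ g hs)
  have key : ∀ ε : ℝ, 0 < ε → ∫⁻ s in Ioi ε, ENNReal.ofReal (s ^ (1 / p - 1)) * k s ≤
      ENNReal.ofReal (2 / (2 ^ (1 / p) - 1)) * O := by
    intro ε hε
    set N := ∫⁻ s in Ioi ε, ENNReal.ofReal (s ^ (1 / p - 1)) * k s with hN
    have hNt : N ≠ ⊤ := by
      have : N ≤ ∫⁻ s, (Ioo ε 1).indicator
          (fun _ => ENNReal.ofReal (ε ^ (1 / p - 1)) * decrRearr μ g ε) s := by
        rw [hN, ← lintegral_indicator measurableSet_Ioi]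
        refine lintegral_mono fun s => ?_
        by_cases hs : s ∈ Ioi ε
        · rw [indicator_of_mem hs]
          rcases lt_or_ge s 1 with h1 | h1
          · rw [indicator_of_mem (show s ∈ Ioo ε 1 from ⟨hs, h1⟩)]
            exact mul_le_mul' (weight_anti hp hε (le_of_lt hs))
              (tsub_le_self.trans (decrRearr_antitone μ g (le_of_lt hs)))
          · rw [hk0 s (by linarith), mul_zero]
            exact zero_le
        · rw [indicator_of_notMem hs]
          exact zero_le
      refine ne_top_of_le_ne_top ?_ this
      rw [lintegral_indicator measurableSet_Ioo, setLIntegral_const, Real.volume_Ioo]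
      exact ENNReal.mul_ne_top (ENNReal.mul_ne_top ENNReal.ofReal_ne_top
        (decrRearr_ne_top hg hi hε)) ENNReal.ofReal_ne_top
    have h1 : ENNReal.ofReal (2 ^ (1 / p)) * N ≤ N + 2 * O := by
      rw [hN, ← lintegral_Ioi_weight_mul_comp_half hk hε.le, ← hN]
      calc ∫⁻ s in Ioi (2 * ε), ENNReal.ofReal (s ^ (1 / p - 1)) * k (s / 2)
          ≤ ∫⁻ s in Ioi (2 * ε), (ENNReal.ofReal (s ^ (1 / p - 1)) * k s +
              (Ioo (0 : ℝ) 1).indicator (fun s => 2 * oscRearr p μ g s) s) := by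
            refine setLIntegral_mono' measurableSet_Ioi fun s hs => ?_
            have hs0 : 0 < s := by
              have : 2 * ε < s := hs
              linarith
            rcases lt_or_ge s 1 with h1 | h1
            · rw [indicator_of_mem (show s ∈ Ioo (0 : ℝ) 1 from ⟨hs0, h1⟩), oscRearr,
                mul_left_comm, ← mul_add]
              gcongr
              have := decrRearr_tsub_le_two_mul hg hi (half_pos hs0) (by linarith)
                (by linarith : s ≤ 2 * (s / 2))
              simp only [k]
              rw [tsub_le_iff_right] at this ⊢
              refine this.trans ?_
              rw [add_right_comm, add_comm]
              gcongr
              exact le_tsub_add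
            · rw [hk0 (s / 2) (by linarith), mul_zero]
              exact zero_le
        _ = (∫⁻ s in Ioi (2 * ε), ENNReal.ofReal (s ^ (1 / p - 1)) * k s) +
              ∫⁻ s in Ioi (2 * ε), (Ioo (0 : ℝ) 1).indicator (fun s => 2 * oscRearr p μ g s) s :=
            lintegral_add_left ((measurable_weight p).mul hk) _
        _ ≤ N + 2 * O := by
            refine add_le_add (lintegral_mono_set (Ioi_subset_Ioi (by linarith)))
              ((setLIntegral_le_lintegral _ _).trans_eq ?_)
            rw [lintegral_indicator measurableSet_Ioo, hO,
              lintegral_const_mul' _ _ ENNReal.ofNat_ne_top]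
    have h2 : ENNReal.ofReal (2 ^ (1 / p) - 1) * N ≤ 2 * O := by
      have e : ENNReal.ofReal (2 ^ (1 / p)) = 1 + ENNReal.ofReal (2 ^ (1 / p) - 1) := by
        rw [← ENNReal.ofReal_one, ← ENNReal.ofReal_add zero_le_one hκ.le]
        congr 1
        ring
      rw [e, add_mul, one_mul] at h1
      exact (ENNReal.add_le_add_iff_left hNt).1 h1
    rw [ENNReal.ofReal_div_of_pos hκ, ENNReal.ofReal_ofNat, ← ENNReal.mul_div_right_comm,
      ENNReal.le_div_iff_mul_le (Or.inl (by simpa using hκ)) (Or.inl ENNReal.ofReal_ne_top),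
      mul_comm]
    exact h2
  have hU : Ioi (0 : ℝ) = ⋃ j : ℕ, Ioi (1 / ((j : ℝ) + 1)) := by
    ext s
    simp only [mem_Ioi, mem_iUnion]
    constructor
    · exact fun hs => exists_nat_one_div_lt hs
    · rintro ⟨j, hj⟩
      exact lt_trans (by positivity) hj
  calc lorentzNorm p μ (fun x => g x - m)
      ≤ ∫⁻ s in Ioi (0 : ℝ), ENNReal.ofReal (s ^ (1 / p - 1)) * k s := by
        rw [lorentzNorm]
        simp_rw [decrRearr_tsub_const]
        exact lintegral_mono_set fun s hs => hs.1
    _ ≤ _ := by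
        rw [hU, setLIntegral_iUnion_of_directed]
        · exact iSup_le fun j => key _ (by positivity)
        · refine (monotone_nat_of_le_succ fun j => Ioi_subset_Ioi ?_).directed_le
          exact Nat.one_div_le_one_div (Nat.le_succ j)

end OscillationBelow

/-! ### Functions close to two values. -/

section TwoValues

variable {α : Type*} [MeasurableSpace α] {μ : Measure α} {f f₁ f₂ : α → ℝ}

/-- One of `b`, `c` is zero or has sign opposite to `x`; the distance of `x` from it is at least
`|x|`. -/
theorem abs_le_min_add_min {b c : ℝ} (h : b * c ≤ 0) (x : ℝ) :
    |x| ≤ min |x| |x - b| + min |x| |x - c| := by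
  have h0 : ∀ y : ℝ, 0 ≤ min |x| |x - y| := fun y => le_min (abs_nonneg _) (abs_nonneg _)
  have h1 : ∀ y : ℝ, x * y ≤ 0 → min |x| |x - y| = |x| := fun y hy => by
    refine min_eq_left (sq_le_sq.1 ?_)
    nlinarith [sq_nonneg y]
  by_cases hb : x * b ≤ 0
  · linarith [h1 b hb, h0 c]
  · have hc : x * c ≤ 0 := by
      by_contra hc
      push Not at hb hc
      nlinarith [mul_pos hb hc, mul_nonneg (sq_nonneg x) (neg_nonneg.2 h)]
    linarith [h1 c hc, h0 b]

theorem abs_sub_min_abs_le (x y a b : ℝ) :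
    min |x - a| |x - b| ≤ min |y - a| |y - b| + |x - y| := by
  rw [← min_add_add_right]
  refine min_le_min ?_ ?_ <;>
  · rw [add_comm]
    exact abs_sub_le _ _ _

theorem integrable_min_abs_sub [IsFiniteMeasure μ] (hf : Integrable f μ) (a b : ℝ) :
    Integrable (fun x => min |f x - a| |f x - b|) μ :=
  (hf.sub (integrable_const a)).abs.inf (hf.sub (integrable_const b)).abs

/-- A function that is small on half of the space and close to two values is close to zero and
one more value. -/
theorem exists_integral_min_abs_le [IsProbabilityMeasure μ] (hf : Integrable f μ) {E : Set α}
    (hE2 : 1 / 2 ≤ μ.real E) {δ a b : ℝ} (h : ∫ x in E, |f x| ∂μ ≤ 2 * δ)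
    (hab : ∫ x, min |f x - a| |f x - b| ∂μ ≤ δ) :
    ∃ b' : ℝ, ∫ x, min |f x| |f x - b'| ∂μ ≤ 7 * δ := by
  wlog hle : |a| ≤ |b| generalizing a b
  · exact this (by simpa only [min_comm] using hab) (not_le.1 hle).le
  have hm := integrable_min_abs_sub hf a b
  -- On `E` the smaller value satisfies `|a| ≤ min |f - a| |f - b| + |f|`. Integration over mass at
  -- least `1/2` gives `|a| / 2 ≤ δ + 2δ`, and moving `a` to `0` costs `|a|` more.
  have ha : |a| ≤ 6 * δ := by
    have h1 : ∫ x in E, |a| ∂μ ≤ ∫ x in E, (min |f x - a| |f x - b| + |f x|) ∂μ := by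
      refine integral_mono (integrable_const _) (hm.add hf.abs).integrableOn fun x => ?_
      have h2 : |a| ≤ |f x - a| + |f x| := by
        have := abs_sub_abs_le_abs_sub a (f x)
        rw [abs_sub_comm] at this
        linarith
      have h3 : |b| ≤ |f x - b| + |f x| := by
        have := abs_sub_abs_le_abs_sub b (f x)
        rw [abs_sub_comm] at this
        linarith
      rw [← min_add_add_right]
      exact le_min h2 (hle.trans h3)
    rw [integral_add hm.integrableOn hf.abs.integrableOn, setIntegral_const, smul_eq_mul] at h1
    have h2 : ∫ x in E, min |f x - a| |f x - b| ∂μ ≤ δ :=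
      (setIntegral_le_integral hm (.of_forall fun x =>
        le_min (abs_nonneg _) (abs_nonneg _))).trans hab
    nlinarith [abs_nonneg a]
  refine ⟨b, ?_⟩
  calc ∫ x, min |f x| |f x - b| ∂μ ≤ ∫ x, (min |f x - a| |f x - b| + |a|) ∂μ := by
        refine integral_mono (by simpa using integrable_min_abs_sub hf 0 b)
          (hm.add (integrable_const _)) fun x => ?_
        dsimp only
        rw [← min_add_add_right]
        refine min_le_min ?_ (le_add_of_nonneg_right (abs_nonneg a))
        have := abs_add_le (f x - a) a
        rwa [sub_add_cancel] at this
    _ ≤ 7 * δ := by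
        rw [integral_add hm (integrable_const _)]
        simp only [integral_const, probReal_univ, one_smul]
        linarith

/-- The sum is small on `D₁ ∩ D₂`, so one of its two values may be taken to be `0`. On `D₂` the sum
is nearly `f₁` while `f₂` is nearly `0`; off `D₂` the roles are exchanged. Hence both summands are
close to `0` and the same `c`, with `9 = 7 + 1 + 1`. -/
theorem exists_integral_min_abs_le_of_add [IsProbabilityMeasure μ] (hf₁ : Integrable f₁ μ)
    (hf₂ : Integrable f₂ μ) {D₁ D₂ : Set α} (hD₂ : MeasurableSet D₂)
    (hD : 1 / 2 ≤ μ.real (D₁ ∩ D₂)) {δ a b : ℝ} (h₁ : ∫ x in D₁, |f₁ x| ∂μ ≤ δ)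
    (h₂ : ∫ x in D₂, |f₂ x| ∂μ ≤ δ) (h₃ : ∫ x in D₂ᶜ, |f₁ x| ∂μ ≤ δ)
    (hab : ∫ x, min |f₁ x + f₂ x - a| |f₁ x + f₂ x - b| ∂μ ≤ δ) :
    ∃ c : ℝ, ∫ x, min |f₁ x| |f₁ x - c| ∂μ ≤ 9 * δ ∧ ∫ x, min |f₂ x| |f₂ x - c| ∂μ ≤ 9 * δ := by
  obtain ⟨c, hc⟩ := exists_integral_min_abs_le (hf₁.add hf₂) hD (δ := δ) (a := a)
    (b := b) (by
      calc ∫ x in D₁ ∩ D₂, |f₁ x + f₂ x| ∂μ ≤ ∫ x in D₁ ∩ D₂, (|f₁ x| + |f₂ x|) ∂μ :=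
            integral_mono (hf₁.add hf₂).abs.integrableOn (hf₁.abs.add hf₂.abs).integrableOn
              fun x => abs_add_le _ _
        _ = (∫ x in D₁ ∩ D₂, |f₁ x| ∂μ) + ∫ x in D₁ ∩ D₂, |f₂ x| ∂μ :=
            integral_add hf₁.abs.integrableOn hf₂.abs.integrableOn
        _ ≤ (∫ x in D₁, |f₁ x| ∂μ) + ∫ x in D₂, |f₂ x| ∂μ :=
            add_le_add
              (setIntegral_mono_set hf₁.abs.integrableOn (.of_forall fun x => abs_nonneg _)
                inter_subset_left.eventuallyLE)
              (setIntegral_mono_set hf₂.abs.integrableOn (.of_forall fun x => abs_nonneg _)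
                inter_subset_right.eventuallyLE)
        _ ≤ 2 * δ := by linarith) hab
  have hi : ∀ {g : α → ℝ}, Integrable g μ → Integrable (fun x => min |g x| |g x - c|) μ :=
    fun hg => by simpa using integrable_min_abs_sub hg 0 c
  have key : ∀ {g : α → ℝ}, Integrable g μ → (∀ x, min |g x| |g x - c| ≤
      min |f₁ x + f₂ x| |f₁ x + f₂ x - c| + D₂.indicator (fun x => |f₂ x|) x +
        D₂ᶜ.indicator (fun x => |f₁ x|) x) → ∫ x, min |g x| |g x - c| ∂μ ≤ 9 * δ := by
    intro g hg hle
    have hF : Integrable (fun x => min |f₁ x + f₂ x| |f₁ x + f₂ x - c|) μ := hi (hf₁.add hf₂)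
    have hF' : Integrable (fun x => min |f₁ x + f₂ x| |f₁ x + f₂ x - c| +
        D₂.indicator (fun x => |f₂ x|) x) μ := hF.add (hf₂.abs.indicator hD₂)
    refine (integral_mono (hi hg) (hF'.add (hf₁.abs.indicator hD₂.compl)) hle).trans ?_
    have e : ∫ x, (min |f₁ x + f₂ x| |f₁ x + f₂ x - c| + D₂.indicator (fun x => |f₂ x|) x +
        D₂ᶜ.indicator (fun x => |f₁ x|) x) ∂μ = (∫ x, min |f₁ x + f₂ x| |f₁ x + f₂ x - c| ∂μ) +
          (∫ x in D₂, |f₂ x| ∂μ) + ∫ x in D₂ᶜ, |f₁ x| ∂μ := by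
      rw [integral_add hF' (hf₁.abs.indicator hD₂.compl),
        integral_add hF (hf₂.abs.indicator hD₂), integral_indicator hD₂, integral_indicator hD₂.compl]
    have hc' : ∫ x, min |f₁ x + f₂ x| |f₁ x + f₂ x - c| ∂μ ≤ 7 * δ := hc
    refine e.le.trans ?_
    linarith
  refine ⟨c, key hf₁ fun x => ?_, key hf₂ fun x => ?_⟩
  · by_cases hx : x ∈ D₂
    · have := abs_sub_min_abs_le (f₁ x) (f₁ x + f₂ x) 0 c
      simpa [hx] using this
    · have h0 : 0 ≤ min |f₁ x + f₂ x| |f₁ x + f₂ x - c| := le_min (abs_nonneg _) (abs_nonneg _)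
      simp only [hx, not_false_eq_true, indicator_of_notMem, mem_compl_iff, indicator_of_mem]
      linarith [min_le_left |f₁ x| |f₁ x - c|]
  · by_cases hx : x ∈ D₂
    · have h0 : 0 ≤ min |f₁ x + f₂ x| |f₁ x + f₂ x - c| := le_min (abs_nonneg _) (abs_nonneg _)
      simp only [hx, not_true_eq_false, not_false_eq_true, indicator_of_notMem, mem_compl_iff,
        indicator_of_mem]
      linarith [min_le_left |f₂ x| |f₂ x - c|]
    · have := abs_sub_min_abs_le (f₂ x) (f₁ x + f₂ x) 0 c
      simpa [hx] using this

/-- If both `f₁ + f₂` and `f₁ - f₂` are close to two values, then one of two functions with almost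
disjoint supports of small measure is small. -/
theorem integral_abs_le_or_of_two_values [IsProbabilityMeasure μ] (hf₁ : Integrable f₁ μ)
    (hf₂ : Integrable f₂ μ) {D₁ D₂ : Set α} (hD₂ : MeasurableSet D₂)
    (hD : 1 / 2 ≤ μ.real (D₁ ∩ D₂)) {δ a b a' b' : ℝ} (h₁ : ∫ x in D₁, |f₁ x| ∂μ ≤ δ)
    (h₂ : ∫ x in D₂, |f₂ x| ∂μ ≤ δ) (h₃ : ∫ x in D₂ᶜ, |f₁ x| ∂μ ≤ δ)
    (hab : ∫ x, min |f₁ x + f₂ x - a| |f₁ x + f₂ x - b| ∂μ ≤ δ)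
    (hab' : ∫ x, min |f₁ x - f₂ x - a'| |f₁ x - f₂ x - b'| ∂μ ≤ δ) :
    ∫ x, |f₁ x| ∂μ ≤ 18 * δ ∨ ∫ x, |f₂ x| ∂μ ≤ 18 * δ := by
  obtain ⟨c, hc₁, hc₂⟩ := exists_integral_min_abs_le_of_add hf₁ hf₂ hD₂ hD h₁ h₂ h₃ hab
  obtain ⟨d, hd₁, hd₂⟩ := exists_integral_min_abs_le_of_add hf₁ hf₂.neg hD₂ hD h₁
    (by simpa using h₂) h₃ (by simpa only [Pi.neg_apply, ← sub_eq_add_neg] using hab')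
  have hd₂' : ∫ x, min |f₂ x| |f₂ x - (-d)| ∂μ ≤ 9 * δ := by
    refine le_of_eq_of_le (integral_congr_ae (.of_forall fun x => ?_)) hd₂
    simp only [Pi.neg_apply, abs_neg]
    rw [← abs_neg (f₂ x - -d)]
    congr 2
    ring
  have key : ∀ {g : α → ℝ} {u v : ℝ}, Integrable g μ → u * v ≤ 0 →
      ∫ x, min |g x| |g x - u| ∂μ ≤ 9 * δ → ∫ x, min |g x| |g x - v| ∂μ ≤ 9 * δ →
      ∫ x, |g x| ∂μ ≤ 18 * δ := by
    intro g u v hg huv hu hv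
    have hi : ∀ w, Integrable (fun x => min |g x| |g x - w|) μ := fun w => by
      simpa using integrable_min_abs_sub hg 0 w
    have := integral_mono hg.abs ((hi u).add (hi v)) fun x => abs_le_min_add_min huv (g x)
    refine this.trans ?_
    rw [integral_add' (hi u) (hi v)]
    linarith
  -- `f₁` is close to `{0, c}` and to `{0, d}`, while `f₂` is close to `{0, c}` and to `{0, -d}`. In
  -- one of these pairs the nonzero candidates have opposite signs, which leaves only `0`.
  rcases le_total (c * d) 0 with h | h
  · exact Or.inl (key hf₁ h hc₁ hd₁)
  · exact Or.inr (key hf₂ (by linarith) hc₂ hd₂')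

end TwoValues

/-! ### What (iii) says for `X = L^1`. -/

section

variable {n : ℕ} {Ω : Set (EuclideanSpace ℝ (Fin n))} {p : ℝ}

theorem enorm_sub_eq_tsub_add_tsub {a m : ℝ} (ha : 0 ≤ a) (hm : 0 ≤ m) :
    ‖a - m‖ₑ = (ENNReal.ofReal a - ENNReal.ofReal m) + (ENNReal.ofReal m - ENNReal.ofReal a) := by
  rw [Real.enorm_eq_ofReal_abs, ← ENNReal.ofReal_sub _ hm, ← ENNReal.ofReal_sub _ ha]
  rcases le_total a m with h | h
  · rw [abs_of_nonpos (by linarith), ENNReal.ofReal_of_nonpos (p := a - m) (by linarith), zero_add,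
      neg_sub]
  · rw [abs_of_nonneg (by linarith), ENNReal.ofReal_of_nonpos (p := m - a) (by linarith), add_zero]

/-- The rearrangement inequality in `L¹` says that a Sobolev function is, up to its gradient, at
a constant distance from some constant. -/
theorem RISobolevAll.exists_two_values (hΩ1 : volume Ω = 1) (hp : 1 ≤ p) (h : RISobolevAll Ω p) :
    ∃ K : ℝ, 0 ≤ K ∧ ∀ f G, MemW11 Ω f G → ∀ ε > 0, ∃ c m : ℝ, 0 ≤ m ∧
      lorentzNorm p (volume.restrict Ω) (fun x => ‖f x - c‖ₑ - ENNReal.ofReal m) ≤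
        ENNReal.ofReal (K * (∫ x in Ω, ‖G x‖) + ε) ∧
      ∫ x in Ω, |‖f x - c‖ - m| ≤ K * (∫ x in Ω, ‖G x‖) + ε := by
  have := isProbabilityMeasure_restrict hΩ1
  obtain ⟨C, hC⟩ := h _ isRINorm_lintegral
  have hκ : 0 < (2 : ℝ) ^ (1 / p) - 1 := by
    have := Real.one_lt_rpow one_lt_two (by positivity : 0 < 1 / p)
    linarith
  set κ : ℝ := 2 / (2 ^ (1 / p) - 1) with hκd
  have hκ0 : 0 < κ := by positivity
  -- `κ` accounts for the part of `|f - c|` above `m`, and 2 for the part below. The infimum over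
  -- `c` need not be attained, which is what `ε` is for.
  refine ⟨(κ + 2) * C, by positivity, fun f G hfG ε hε => ?_⟩
  set μ := volume.restrict Ω with hμ
  have hI : ENNReal.ofReal (∫ x in Ω, ‖G x‖) = ∫⁻ x in Ω, ‖G x‖ₑ :=
    ofReal_integral_norm_eq_lintegral_enorm hfG.2.2
  have hI0 : 0 ≤ ∫ x in Ω, ‖G x‖ := integral_nonneg fun x => norm_nonneg _
  have h1 := hC f G ⟨hfG.1, hfG.2.1.2, hfG.2.2.2⟩
  have h2 : (C : ℝ≥0∞) * ∫⁻ x in Ω, ‖G x‖ₑ < ENNReal.ofReal (C * (∫ x in Ω, ‖G x‖) + ε / (κ + 2)) := by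
    rw [← hI, ← ENNReal.ofReal_coe_nnreal, ← ENNReal.ofReal_mul C.coe_nonneg,
      ENNReal.ofReal_lt_ofReal_iff_of_nonneg (mul_nonneg C.coe_nonneg hI0)]
    exact lt_add_of_pos_right _ (by positivity)
  obtain ⟨c, hc⟩ := iInf_lt_iff.1 (h1.trans_lt h2)
  have hO := (lintegral_le_hatNorm_lintegral (measurable_oscRearr p μ _)).trans hc.le
  set g : EuclideanSpace ℝ (Fin n) → ℝ≥0∞ := fun x => ‖f x - c‖ₑ with hg
  have hfc : Integrable (fun x => f x - c) μ := hfG.2.1.sub (integrable_const c)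
  have hgm : AEMeasurable g μ := hfc.1.aemeasurable.enorm
  have hgi : ∫⁻ x, g x ∂μ ≠ ⊤ := hfc.2.ne
  set O := ∫⁻ s in Ioo (0 : ℝ) 1, oscRearr p μ g s with hOd
  have hmt : decrRearr μ g (1 / 2) ≠ ⊤ := decrRearr_ne_top hgm hgi (by norm_num)
  have hN := lorentzNorm_tsub_half_le hp hgm hgi
  have hL := lintegral_half_tsub_le hp hgm hgi
  set m := (decrRearr μ g (1 / 2)).toReal with hm
  have hmo : ENNReal.ofReal m = decrRearr μ g (1 / 2) := ENNReal.ofReal_toReal hmt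
  rw [← hmo] at hN hL
  have hfin : ENNReal.ofReal (κ + 2) * O ≤
      ENNReal.ofReal ((κ + 2) * C * (∫ x in Ω, ‖G x‖) + ε) := by
    refine (mul_le_mul_right hO _).trans_eq ?_
    rw [← ENNReal.ofReal_mul (by positivity)]
    congr 1
    field_simp
  have hm0 : 0 ≤ m := ENNReal.toReal_nonneg
  refine ⟨c, m, hm0, hN.trans (le_trans ?_ hfin), ?_⟩
  · exact mul_le_mul_left (ENNReal.ofReal_le_ofReal (by linarith)) _
  · rw [← ENNReal.ofReal_le_ofReal_iff (by positivity)]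
    refine le_trans ?_ hfin
    have hint : Integrable (fun x => ‖f x - c‖ - m) μ := hfc.norm.sub (integrable_const m)
    have e := ofReal_integral_norm_eq_lintegral_enorm hint
    simp only [Real.norm_eq_abs] at e ⊢
    rw [e]
    have e2 : ∀ x, ‖|f x - c| - m‖ₑ = (g x - ENNReal.ofReal m) + (ENNReal.ofReal m - g x) := by
      intro x
      rw [enorm_sub_eq_tsub_add_tsub (abs_nonneg _) hm0]
      simp only [hg, Real.enorm_eq_ofReal_abs]
    simp_rw [e2]
    rw [lintegral_add_left' (hgm.sub_const _), ENNReal.ofReal_add hκ0.le two_pos.le, add_mul,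
      ENNReal.ofReal_ofNat]
    exact add_le_add ((lintegral_le_lorentzNorm hp (hgm.sub_const _)).trans hN) hL

end

/-! ### The Poincaré inequality in `L^1` from connectedness. -/

section

variable {n : ℕ} {Ω : Set (EuclideanSpace ℝ (Fin n))} {p : ℝ}

theorem min_abs_sub_le_abs_norm_sub (y c m : ℝ) :
    min |y - (c + m)| |y - (c - m)| ≤ |‖y - c‖ - m| := by
  rw [Real.norm_eq_abs]
  rcases le_total c y with h | h
  · rw [abs_of_nonneg (sub_nonneg.2 h)]
    exact (min_le_left _ _).trans_eq (by congr 1; ring)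
  · rw [abs_of_nonpos (sub_nonpos.2 h), ← abs_neg (-(y - c) - m)]
    exact (min_le_right _ _).trans_eq (by congr 1; ring)

/-- Take a counterexample to the Poincaré inequality with constant `(C + 1) / δ`, subtract the
constant that is good on `D`, and divide by the resulting `L^1` norm. -/
theorem LocalPoincare.exists_normalized (hΩ1 : volume Ω = 1) {D : Set (EuclideanSpace ℝ (Fin n))}
    (hDΩ : D ⊆ Ω) (hDm : MeasurableSet D) (hD : LocalPoincare Ω D)
    (hneg : ∀ C : ℝ, 0 ≤ C → ∃ f G, MemW11 Ω f G ∧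
      ∀ c : ℝ, C * (∫ x in Ω, ‖G x‖) < ∫ x in Ω, |f x - c|)
    {δ : ℝ} (hδ : 0 < δ) :
    ∃ f G, MemW11 Ω f G ∧ ∫ x in Ω, |f x| = 1 ∧ ∫ x in D, |f x| ∂(volume.restrict Ω) ≤ δ ∧
      ∫ x in Ω, ‖G x‖ ≤ δ := by
  obtain ⟨C, hC⟩ := hD
  obtain ⟨f, G, hfG, hJ⟩ := hneg ((C + 1) / δ) (by positivity)
  obtain ⟨c, hc⟩ := hC f G hfG
  specialize hJ c
  set J := ∫ x in Ω, |f x - c| with hJd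
  set I := ∫ x in Ω, ‖G x‖ with hId
  have hI0 : 0 ≤ I := integral_nonneg fun x => norm_nonneg _
  have hfc := hfG.sub_const hΩ1 c
  have hJ0 : 0 < J := lt_of_le_of_lt (by positivity) hJ
  have hJ' : (C + 1) * I < δ * J := by
    rw [div_mul_eq_mul_div, div_lt_iff₀ hδ] at hJ
    linarith
  have hDi : ∫ x in D, |f x - c| ≤ C * I := by
    rw [← ENNReal.ofReal_le_ofReal_iff (by positivity), ENNReal.ofReal_mul C.coe_nonneg,
      ENNReal.ofReal_coe_nnreal, hId, ofReal_integral_norm_eq_lintegral_enorm hfG.2.2]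
    refine le_trans (le_of_eq ?_) hc
    exact ofReal_integral_norm_eq_lintegral_enorm (hfc.2.1.mono_set hDΩ)
  refine ⟨_, _, hfc.const_mul J⁻¹, ?_, ?_, ?_⟩
  · simp only [abs_mul, abs_of_pos (inv_pos.2 hJ0)]
    rw [integral_const_mul, ← hJd, inv_mul_cancel₀ hJ0.ne']
  · rw [Measure.restrict_restrict hDm, inter_eq_left.2 hDΩ]
    simp only [abs_mul, abs_of_pos (inv_pos.2 hJ0)]
    rw [integral_const_mul, inv_mul_le_iff₀ hJ0]
    nlinarith
  · simp only [norm_smul, norm_inv, Real.norm_eq_abs, abs_of_pos hJ0]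
    rw [integral_const_mul, inv_mul_le_iff₀ hJ0, ← hId]
    nlinarith [C.coe_nonneg]

theorem integral_norm_add_le_add {α E : Type*} [MeasurableSpace α] {μ : Measure α}
    [NormedAddCommGroup E] {G H : α → E} (hG : Integrable G μ) (hH : Integrable H μ) :
    ∫ x, ‖G x + H x‖ ∂μ ≤ (∫ x, ‖G x‖ ∂μ) + ∫ x, ‖H x‖ ∂μ := by
  rw [← integral_add hG.norm hH.norm]
  exact integral_mono (hG.add hH).norm (hG.norm.add hH.norm) fun x => norm_add_le _ _

theorem integral_norm_sub_le_add {α E : Type*} [MeasurableSpace α] {μ : Measure α}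
    [NormedAddCommGroup E] {G H : α → E} (hG : Integrable G μ) (hH : Integrable H μ) :
    ∫ x, ‖G x - H x‖ ∂μ ≤ (∫ x, ‖G x‖ ∂μ) + ∫ x, ‖H x‖ ∂μ := by
  rw [← integral_add hG.norm hH.norm]
  exact integral_mono (hG.sub hH).norm (hG.norm.add hH.norm) fun x => norm_sub_le _ _

/-- On a connected open set the two-value property upgrades to the Poincaré inequality in `L¹`. -/
theorem RISobolevAll.exists_integral_abs_sub_le (hΩ : IsOpen Ω) (hc : IsConnected Ω)
    (hΩ1 : volume Ω = 1) (hp : 1 ≤ p) (h : RISobolevAll Ω p) :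
    ∃ C : ℝ, 0 ≤ C ∧ ∀ f G, MemW11 Ω f G →
      ∃ c : ℝ, ∫ x in Ω, |f x - c| ≤ C * ∫ x in Ω, ‖G x‖ := by
  by_contra! hneg
  have := isProbabilityMeasure_restrict hΩ1
  obtain ⟨K, hK0, hK⟩ := h.exists_two_values hΩ1 hp
  -- Makes every error at most `1/36`, so that the final bound `18 / 36` contradicts norm one.
  set δ : ℝ := 1 / 36 / (2 * (2 * K + 1)) with hδd
  have hδ : 0 < δ := by positivity
  have hδK : K * (2 * δ) + 1 / 72 ≤ 1 / 36 := by
    have : K * (2 * δ) = 1 / 72 * (2 * K / (2 * K + 1)) := by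
      rw [hδd]
      field_simp
      ring
    have h1 : 2 * K / (2 * K + 1) ≤ 1 := by
      rw [div_le_one (by positivity)]
      linarith
    linarith
  have hδ1 : δ ≤ 1 / 36 := div_le_self (by norm_num) (by linarith)
  have hcompl : ∀ D : Set (EuclideanSpace ℝ (Fin n)), MeasurableSet D →
      volume.restrict Ω Dᶜ = volume (Ω \ D) := fun D hD => by
    rw [Measure.restrict_apply hD.compl, inter_comm, sdiff_eq]
  obtain ⟨D₁, hD₁o, hD₁Ω, hD₁, hD₁v⟩ := exists_localPoincare hΩ hc hΩ1
    (η := ENNReal.ofReal (1 / 4)) (by norm_num)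
  obtain ⟨f₁, G₁, hf₁, hn₁, hs₁, hg₁⟩ := hD₁.exists_normalized hΩ1 hD₁Ω hD₁o.measurableSet hneg hδ
  -- The set `D₂` is chosen after `f₁`, with complement so small that `f₁` has little mass there;
  -- hence `f₁` and `f₂` are concentrated on essentially disjoint sets.
  obtain ⟨η, hη, hη'⟩ := exists_pos_setLIntegral_lt_of_measure_lt (μ := volume.restrict Ω)
    hf₁.2.1.2.ne (ε := ENNReal.ofReal δ) (by simpa using hδ)
  obtain ⟨D₂, hD₂o, hD₂Ω, hD₂, hD₂v⟩ := exists_localPoincare hΩ hc hΩ1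
    (η := min (ENNReal.ofReal (1 / 4)) η) (by
      rw [ne_eq, min_eq_iff]
      simp [hη.ne'])
  obtain ⟨f₂, G₂, hf₂, hn₂, hs₂, hg₂⟩ := hD₂.exists_normalized hΩ1 hD₂Ω hD₂o.measurableSet hneg hδ
  rw [← hcompl _ hD₁o.measurableSet] at hD₁v
  rw [← hcompl _ hD₂o.measurableSet] at hD₂v
  have hthird : ∫ x in D₂ᶜ, |f₁ x| ∂(volume.restrict Ω) ≤ δ := by
    rw [← ENNReal.ofReal_le_ofReal_iff hδ.le]
    refine le_trans (le_of_eq ?_) (hη' _ (hD₂v.trans_le (min_le_right _ _))).le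
    exact ofReal_integral_norm_eq_lintegral_enorm (Integrable.integrableOn hf₁.2.1)
  have hreal : ∀ {D : Set (EuclideanSpace ℝ (Fin n))},
      volume.restrict Ω Dᶜ < ENNReal.ofReal (1 / 4) → (volume.restrict Ω).real Dᶜ ≤ 1 / 4 :=
    fun hD => ENNReal.toReal_le_of_le_ofReal (by norm_num) hD.le
  have hhalf : 1 / 2 ≤ (volume.restrict Ω).real (D₁ ∩ D₂) := by
    have h1 := probReal_compl_eq_one_sub (μ := volume.restrict Ω)
      (hD₁o.inter hD₂o).measurableSet
    have h2 := measureReal_union_le (μ := volume.restrict Ω) D₁ᶜ D₂ᶜ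
    rw [← compl_inter] at h2
    linarith [hreal hD₁v, hreal (hD₂v.trans_le (min_le_left _ _))]
  have htwo : ∀ {F : EuclideanSpace ℝ (Fin n) → ℝ} {H}, MemW11 Ω F H →
      ∫ x in Ω, ‖H x‖ ≤ 2 * δ → ∃ a b, ∫ x in Ω, min |F x - a| |F x - b| ≤ 1 / 36 := by
    intro F H hF hH
    obtain ⟨c, m, -, -, hcm⟩ := hK F H hF (1 / 72) (by norm_num)
    refine ⟨c + m, c - m, le_trans (integral_mono (integrable_min_abs_sub hF.2.1 _ _)
      (((hF.sub_const hΩ1 c).2.1.norm.sub (integrable_const m)).abs) fun x =>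
      min_abs_sub_le_abs_norm_sub _ _ _) (hcm.trans (le_trans ?_ hδK))⟩
    gcongr
  obtain ⟨a, b, hab⟩ := htwo (hf₁.add hf₂)
    ((integral_norm_add_le_add hf₁.2.2 hf₂.2.2).trans (by linarith))
  obtain ⟨a', b', hab'⟩ := htwo (hf₁.sub hf₂)
    ((integral_norm_sub_le_add hf₁.2.2 hf₂.2.2).trans (by linarith))
  rcases integral_abs_le_or_of_two_values hf₁.2.1 hf₂.2.1 hD₂o.measurableSet hhalf
    (hs₁.trans hδ1) (hs₂.trans hδ1) (hthird.trans hδ1) hab hab' with h | h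
  · rw [hn₁] at h
    norm_num at h
  · rw [hn₂] at h
    norm_num at h

end

/-! ### Absolute continuity of the Lorentz norm. -/

section LorentzMin

variable {α : Type*} [MeasurableSpace α] {μ : Measure α} {p : ℝ}

/-- The rearrangement of the restriction to `A` is at most `f^*` and lives on an interval of length
`μ A`; absolute continuity of the integral does the rest. -/
theorem exists_lorentzNorm_indicator_le {f : α → ℝ≥0∞} (hf : lorentzNorm p μ f ≠ ⊤)
    {ε : ℝ≥0∞} (hε : ε ≠ 0) :
    ∃ r : ℝ≥0∞, r ≠ 0 ∧ r ≠ ⊤ ∧ ∀ A : Set α, μ A ≤ r → lorentzNorm p μ (A.indicator f) ≤ ε := by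
  obtain ⟨γ, hγ, hγ'⟩ := exists_pos_setLIntegral_lt_of_measure_lt hf hε
  obtain ⟨r, hr0, hrγ⟩ := exists_between hγ
  have hrt : r ≠ ⊤ := (hrγ.trans_le le_top).ne
  refine ⟨r, hr0.ne', hrt, fun A hA => ?_⟩
  set t := r.toReal with ht
  have hr : ENNReal.ofReal t = r := ENNReal.ofReal_toReal hrt
  have hv : volume.restrict (Ioo (0 : ℝ) 1) (Iio t) < γ := by
    rw [Measure.restrict_apply measurableSet_Iio]
    refine (measure_mono (t := Ioo 0 t) fun s hs => ⟨hs.2.1, hs.1⟩).trans_lt ?_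
    rwa [Real.volume_Ioo, sub_zero, hr]
  refine le_trans ?_ (hγ' _ hv).le
  rw [← lintegral_indicator measurableSet_Iio]
  refine lintegral_mono fun s => ?_
  rcases lt_or_ge s t with h | h
  · rw [indicator_of_mem (show s ∈ Iio t from h)]
    exact mul_le_mul_right (decrRearr_mono_ae (.of_forall (indicator_le_self A f)) s) _
  · dsimp only
    rw [decrRearr_indicator_le A (hA.trans (hr.symm.le.trans (ENNReal.ofReal_le_ofReal h))),
      mul_zero]
    exact zero_le

/-- Off `{g ≥ η}` the minimum is below `η`; on it the minimum is at most `f`, and by Chebyshev's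
inequality the set is small. Convergence in `L^1` thus yields smallness in `L^{p,1}` under the
majorant `f`. -/
theorem exists_lorentzNorm_min_le [IsProbabilityMeasure μ] (hp : 1 ≤ p) {f : α → ℝ≥0∞}
    (hf : lorentzNorm p μ f ≠ ⊤)
    {ε : ℝ≥0∞} (hε : ε ≠ 0) (hεt : ε ≠ ⊤) :
    ∃ δ : ℝ≥0∞, δ ≠ 0 ∧ ∀ g : α → ℝ≥0∞, AEMeasurable g μ → ∫⁻ x, g x ∂μ ≤ δ →
      lorentzNorm p μ (fun x => min (f x) (g x)) ≤ ε := by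
  have hε4 : ε / 4 ≠ 0 := (ENNReal.div_pos hε (by simp)).ne'
  have hp0 : ENNReal.ofReal p ≠ 0 := by simpa using (by linarith : 0 < p)
  obtain ⟨r, hr0, hrt, hr⟩ := exists_lorentzNorm_indicator_le hf hε4
  set η := ε / 4 / ENNReal.ofReal p with hη
  have hη0 : η ≠ 0 := (ENNReal.div_pos hε4 ENNReal.ofReal_ne_top).ne'
  have hηt : η ≠ ⊤ := ENNReal.div_ne_top (ENNReal.div_ne_top hεt (by simp)) hp0
  refine ⟨r * η, mul_ne_zero hr0 hη0, fun g hg hgδ => ?_⟩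
  have hA : μ {x | η ≤ g x} ≤ r := by
    refine (meas_ge_le_lintegral_div hg hη0 hηt).trans ?_
    rw [ENNReal.div_le_iff hη0 hηt]
    exact hgδ
  calc lorentzNorm p μ (fun x => min (f x) (g x))
      ≤ lorentzNorm p μ (fun x => η + {x | η ≤ g x}.indicator f x) := by
        refine lorentzNorm_mono fun x => ?_
        by_cases hx : x ∈ {x | η ≤ g x}
        · rw [indicator_of_mem hx]
          exact (min_le_left _ _).trans le_add_self
        · rw [indicator_of_notMem hx, add_zero]
          exact (min_le_right _ _).trans (not_le.1 hx).le
    _ ≤ 2 * (lorentzNorm p μ (fun _ => η) + lorentzNorm p μ ({x | η ≤ g x}.indicator f)) :=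
        lorentzNorm_add_le hp _ _
    _ ≤ 2 * (ε / 4 + ε / 4) := by
        refine mul_le_mul_right (add_le_add ((lorentzNorm_const_le hp η).trans ?_) (hr _ hA)) _
        rw [hη, ENNReal.mul_div_cancel hp0 ENNReal.ofReal_ne_top]
    _ = ε := by
        rw [← two_mul, ← mul_assoc, show (2 : ℝ≥0∞) * 2 = 4 by norm_num,
          ENNReal.mul_div_cancel (by simp) (by simp)]

end LorentzMin

/-! ### From `L^1` to `L^{p,1}`: (iii) implies (iv). -/

section

variable {n : ℕ} {Ω : Set (EuclideanSpace ℝ (Fin n))} {p : ℝ}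

/-- This qualitative finiteness allows normalization in `L^{p,1}` later on. -/
theorem RISobolevAll.lorentzNorm_ne_top (hΩ1 : volume Ω = 1) (hp : 1 ≤ p) (h : RISobolevAll Ω p)
    {f : EuclideanSpace ℝ (Fin n) → ℝ} {G} (hfG : MemW11 Ω f G) :
    lorentzNorm p (volume.restrict Ω) (fun x => ‖f x‖ₑ) ≠ ⊤ := by
  have := isProbabilityMeasure_restrict hΩ1
  obtain ⟨K, -, hK⟩ := h.exists_two_values hΩ1 hp
  obtain ⟨c, m, hm, hN, -⟩ := hK f G hfG 1 one_pos
  have h1 : lorentzNorm p (volume.restrict Ω) (fun x => ‖f x‖ₑ) ≤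
      lorentzNorm p (volume.restrict Ω) (fun x => (‖f x - c‖ₑ - ENNReal.ofReal m) +
        (ENNReal.ofReal m + ‖c‖ₑ)) := by
    refine lorentzNorm_mono fun x => ?_
    rw [← add_assoc]
    calc ‖f x‖ₑ = ‖(f x - c) + c‖ₑ := by rw [sub_add_cancel]
      _ ≤ ‖f x - c‖ₑ + ‖c‖ₑ := enorm_add_le _ _
      _ ≤ _ := add_le_add le_tsub_add le_rfl
  refine ne_top_of_le_ne_top ?_ ((h1.trans (lorentzNorm_add_le hp _ _)).trans
    (mul_le_mul_right (add_le_add hN (lorentzNorm_const_le hp _)) _))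
  exact ENNReal.mul_ne_top ENNReal.ofNat_ne_top (ENNReal.add_ne_top.2 ⟨ENNReal.ofReal_ne_top,
    ENNReal.mul_ne_top ENNReal.ofReal_ne_top (ENNReal.add_ne_top.2
      ⟨ENNReal.ofReal_ne_top, enorm_ne_top⟩)⟩)

/-- A small Sobolev function with small gradient has a small negative or a small positive part. -/
theorem RISobolevAll.lorentzNorm_posPart_or_negPart_le (hΩ1 : volume Ω = 1) (hp : 1 ≤ p)
    (h : RISobolevAll Ω p) :
    ∃ K : ℝ, 0 ≤ K ∧ ∀ f G, MemW11 Ω f G → ∀ t > 0, ∫ x in Ω, |f x| ≤ t → ∫ x in Ω, ‖G x‖ ≤ t →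
      lorentzNorm p (volume.restrict Ω) (fun x => ENNReal.ofReal (-f x)) ≤ ENNReal.ofReal (K * t) ∨
      lorentzNorm p (volume.restrict Ω) (fun x => ENNReal.ofReal (f x)) ≤ ENNReal.ofReal (K * t) := by
  have := isProbabilityMeasure_restrict hΩ1
  obtain ⟨K, hK0, hK⟩ := h.exists_two_values hΩ1 hp
  refine ⟨2 * ((K + 1) + p * (K + 2)), by positivity, fun f G hfG t ht hft hGt => ?_⟩
  obtain ⟨c, m, hm, hN, hI⟩ := hK f G hfG t ht
  have hKt : K * (∫ x in Ω, ‖G x‖) + t ≤ (K + 1) * t := by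
    nlinarith
  -- As `f` is small in `L^1`, its distance from `c` is mostly about `|c|`, which must therefore be
  -- close to `m`.
  have hcm : |‖c‖ - m| ≤ (K + 2) * t := by
    have hi : Integrable (fun x => |‖f x - c‖ - m|) (volume.restrict Ω) :=
      ((hfG.sub_const hΩ1 c).2.1.norm.sub (integrable_const m)).abs
    have h1 : ∫ _ in Ω, |‖c‖ - m| ≤ ∫ x in Ω, (|‖f x - c‖ - m| + |f x|) := by
      refine integral_mono (integrable_const _) (hi.add hfG.2.1.abs) fun x => ?_
      have h2 : |‖c‖ - ‖f x - c‖| ≤ |f x| := by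
        rw [norm_sub_rev]
        refine (abs_norm_sub_norm_le _ _).trans_eq ?_
        rw [sub_sub_cancel, Real.norm_eq_abs]
      have h3 := abs_add_le (‖f x - c‖ - m) (‖c‖ - ‖f x - c‖)
      rw [show ‖f x - c‖ - m + (‖c‖ - ‖f x - c‖) = ‖c‖ - m by ring] at h3
      linarith
    rw [integral_add hi hfG.2.1.abs] at h1
    simp only [integral_const, probReal_univ, one_smul] at h1
    linarith
  have key : ∀ g : EuclideanSpace ℝ (Fin n) → ℝ, (∀ x, g x ≤ ‖f x - c‖ - ‖c‖) →
      lorentzNorm p (volume.restrict Ω) (fun x => ENNReal.ofReal (g x)) ≤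
        ENNReal.ofReal (2 * ((K + 1) + p * (K + 2)) * t) := by
    intro g hg
    calc lorentzNorm p (volume.restrict Ω) (fun x => ENNReal.ofReal (g x))
        ≤ lorentzNorm p (volume.restrict Ω) (fun x => (‖f x - c‖ₑ - ENNReal.ofReal m) +
            ENNReal.ofReal ((K + 2) * t)) := by
          refine lorentzNorm_mono fun x => ?_
          rw [← ofReal_norm, ← ENNReal.ofReal_sub _ hm]
          refine le_trans (ENNReal.ofReal_le_ofReal ?_) ENNReal.ofReal_add_le
          linarith [hg x, neg_abs_le (‖c‖ - m)]
      _ ≤ 2 * (ENNReal.ofReal ((K + 1) * t) + ENNReal.ofReal p * ENNReal.ofReal ((K + 2) * t)) :=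
          (lorentzNorm_add_le hp _ _).trans (mul_le_mul_right (add_le_add
            (hN.trans (ENNReal.ofReal_le_ofReal hKt)) (lorentzNorm_const_le hp _)) _)
      _ = _ := by
          rw [← ENNReal.ofReal_mul (by positivity), ← ENNReal.ofReal_add (by positivity)
            (by positivity), ← ENNReal.ofReal_ofNat 2, ← ENNReal.ofReal_mul two_pos.le]
          congr 1
          ring
  -- The excess `|f - c| - |c|` dominates `-f` when `c ≥ 0` and `f` when `c ≤ 0`, so the sign of `c`
  -- decides which part is small.
  rcases le_total 0 c with hc | hc
  · refine Or.inl (key _ fun x => ?_)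
    rw [Real.norm_eq_abs, Real.norm_eq_abs, abs_of_nonneg hc]
    linarith [neg_abs_le (f x - c)]
  · refine Or.inr (key _ fun x => ?_)
    rw [Real.norm_eq_abs, Real.norm_eq_abs, abs_of_nonpos hc]
    linarith [le_abs_self (f x - c)]

/-- If the Poincaré inequality in `L^{p,1}` fails, then there are small functions with small
gradient whose positive part has a norm bounded below. -/
theorem RISobolevAll.exists_one_le_lorentzNorm (hΩ : IsOpen Ω) (hc : IsConnected Ω)
    (hΩ1 : volume Ω = 1) (hp : 1 ≤ p) (h : RISobolevAll Ω p)
    (hneg : ∀ K : ℝ≥0, ∃ f G, MemW11 Ω f G ∧ ∀ c : ℝ,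
      K * ∫⁻ x in Ω, ‖G x‖ₑ < lorentzNorm p (volume.restrict Ω) (fun x => ‖f x - c‖ₑ))
    {δ : ℝ} (hδ : 0 < δ) :
    ∃ f G, MemW11 Ω f G ∧ ∫ x in Ω, |f x| ≤ δ ∧ ∫ x in Ω, ‖G x‖ ≤ δ ∧
      1 ≤ lorentzNorm p (volume.restrict Ω) (fun x => ENNReal.ofReal (f x)) := by
  have := isProbabilityMeasure_restrict hΩ1
  obtain ⟨K, hK0, hK⟩ := h.lorentzNorm_posPart_or_negPart_le hΩ1 hp
  -- The counterexample will be scaled to norm 2. If one of its parts has norm at most `K * δ ≤ 1`,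
  -- the other has norm at least 1, and a change of sign makes it the positive part.
  wlog hδK : K * δ ≤ 1 generalizing δ
  · have hK1 : 0 < K := by
      by_contra hK1
      rw [le_antisymm (not_lt.1 hK1) hK0, zero_mul] at hδK
      exact hδK zero_le_one
    obtain ⟨f, G, h1, h2, h3, h4⟩ := this (δ := 1 / K) (by positivity)
      (mul_one_div_cancel hK1.ne').le
    have : 1 / K ≤ δ := by
      rw [div_le_iff₀ hK1]
      linarith
    exact ⟨f, G, h1, h2.trans this, h3.trans this, h4⟩
  obtain ⟨C, hC0, hC⟩ := h.exists_integral_abs_sub_le hΩ hc hΩ1 hp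
  obtain ⟨f, G, hfG, hM⟩ := hneg (Real.toNNReal (2 * (C + 1) / δ))
  obtain ⟨c, hcI⟩ := hC f G hfG
  specialize hM c
  have hfc := hfG.sub_const hΩ1 c
  have hMt := h.lorentzNorm_ne_top hΩ1 hp hfc
  set M := (lorentzNorm p (volume.restrict Ω) fun x => ‖f x - c‖ₑ).toReal with hMd
  set I := ∫ x in Ω, ‖G x‖ with hI
  have hI0 : 0 ≤ I := integral_nonneg fun x => norm_nonneg _
  have hMr : 2 * (C + 1) / δ * I < M := by
    rw [← ofReal_integral_norm_eq_lintegral_enorm hfG.2.2, ← ENNReal.ofReal_toReal hMt] at hM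
    change ENNReal.ofReal _ * _ < _ at hM
    rw [← ENNReal.ofReal_mul (by positivity)] at hM
    exact (ENNReal.ofReal_lt_ofReal_iff_of_nonneg (by positivity)).1 hM
  have hM0 : 0 < M := lt_of_le_of_lt (by positivity) hMr
  have hMr' : 2 * (C + 1) * I < δ * M := by
    rw [div_mul_eq_mul_div, div_lt_iff₀ hδ] at hMr
    linarith
  have ha : 0 < 2 / M := by positivity
  have hg := hfc.const_mul (2 / M)
  have hgi : ∫ x in Ω, |2 / M * (f x - c)| ≤ δ := by
    simp only [abs_mul, abs_of_pos ha]
    rw [integral_const_mul, div_mul_eq_mul_div, div_le_iff₀ hM0]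
    nlinarith
  have hGi : ∫ x in Ω, ‖(2 / M) • G x‖ ≤ δ := by
    simp only [norm_smul, Real.norm_eq_abs, abs_of_pos ha]
    rw [integral_const_mul, div_mul_eq_mul_div, div_le_iff₀ hM0]
    nlinarith
  have htwo : 2 ≤ lorentzNorm p (volume.restrict Ω)
        (fun x => ENNReal.ofReal (2 / M * (f x - c))) +
      lorentzNorm p (volume.restrict Ω) (fun x => ENNReal.ofReal (-(2 / M * (f x - c)))) := by
    have e : (2 : ℝ≥0∞) = lorentzNorm p (volume.restrict Ω)
        (fun x => (Real.toNNReal (2 / M) : ℝ≥0∞) * ‖f x - c‖ₑ) := by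
      rw [lorentzNorm_const_mul (by simpa using ha), ← ENNReal.ofReal_toReal hMt, ← hMd]
      change _ = ENNReal.ofReal _ * _
      rw [← ENNReal.ofReal_mul ha.le, div_mul_cancel₀ _ hM0.ne', ENNReal.ofReal_ofNat]
    refine e.le.trans (lorentzNorm_le_add_of_distrib hp fun l x hx => ?_)
    have e2 : (Real.toNNReal (2 / M) : ℝ≥0∞) * ‖f x - c‖ₑ =
        max (ENNReal.ofReal (2 / M * (f x - c))) (ENNReal.ofReal (-(2 / M * (f x - c)))) := by
      change ENNReal.ofReal _ * _ = _
      rw [← ENNReal.ofReal_max, ← abs_eq_max_neg, abs_mul, abs_of_pos ha,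
        ENNReal.ofReal_mul ha.le, Real.enorm_eq_ofReal_abs]
    simp only [mem_ofPred_eq, e2, lt_max_iff] at hx
    exact hx
  have hle : ∀ {a b : ℝ≥0∞}, 2 ≤ a + b → b ≤ ENNReal.ofReal (K * δ) → 1 ≤ a := by
    intro a b hab hb
    have hb1 : b ≤ 1 := hb.trans (by simpa using hδK)
    have h2 : (1 : ℝ≥0∞) + 1 ≤ a + 1 := by
      rw [one_add_one_eq_two]
      exact hab.trans (add_le_add le_rfl hb1)
    exact (ENNReal.add_le_add_iff_right ENNReal.one_ne_top).1 h2
  rcases hK _ _ hg δ hδ hgi hGi with h1 | h1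
  · exact ⟨_, _, hg, hgi, hGi, hle htwo h1⟩
  · refine ⟨_, _, hg.neg, by simpa only [abs_neg] using hgi, by simpa only [norm_neg] using hGi, ?_⟩
    rw [add_comm] at htwo
    exact hle htwo h1

/-- If the inequality fails, choose `f₁`, and then `f₂` so small in `L^1` that the minimum of the
positive parts is negligible in `L^{p,1}`. One of the parts of `f₁ - f₂` is small, and adding the
minimum back makes the positive part of `f₁` or of `f₂` small, though both have norm at least 1. -/
theorem RISobolevAll.poincareLorentz (hΩ : IsOpen Ω) (hc : IsConnected Ω)
    (hΩ1 : volume Ω = 1) (hp : 1 ≤ p) (h : RISobolevAll Ω p) : PoincareLorentz Ω p := by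
  have := isProbabilityMeasure_restrict hΩ1
  suffices ∃ K : ℝ≥0, ∀ f G, MemW11 Ω f G → ∃ c : ℝ,
      lorentzNorm p (volume.restrict Ω) (fun x => ‖f x - c‖ₑ) ≤ K * ∫⁻ x in Ω, ‖G x‖ₑ by
    obtain ⟨K, hK⟩ := this
    exact poincareLorentz_of_exists_const hΩ1 hp hK
  by_contra! hneg
  obtain ⟨K, hK0, hK⟩ := h.lorentzNorm_posPart_or_negPart_le hΩ1 hp
  set δ : ℝ := 1 / (16 * (K + 1)) with hδd
  have hδ : 0 < δ := by positivity
  have hKδ : K * (2 * δ) ≤ 1 / 8 := by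
    have : K * (2 * δ) = 1 / 8 * (K / (K + 1)) := by
      rw [hδd]
      field_simp
      ring
    have h1 : K / (K + 1) ≤ 1 := by
      rw [div_le_one (by positivity)]
      linarith
    linarith
  obtain ⟨f₁, G₁, hf₁, hi₁, hg₁, hN₁⟩ := h.exists_one_le_lorentzNorm hΩ hc hΩ1 hp hneg hδ
  have hfin : lorentzNorm p (volume.restrict Ω) (fun x => ENNReal.ofReal (f₁ x)) ≠ ⊤ :=
    ne_top_of_le_ne_top (h.lorentzNorm_ne_top hΩ1 hp hf₁) (lorentzNorm_mono fun x =>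
      Real.ofReal_le_enorm _)
  obtain ⟨η, hη, hmin⟩ := exists_lorentzNorm_min_le hp hfin (ε := ENNReal.ofReal (1 / 8))
    (by simp) ENNReal.ofReal_ne_top
  obtain ⟨δ', hδ', hδη⟩ : ∃ δ' : ℝ, 0 < δ' ∧ ENNReal.ofReal δ' ≤ η := by
    obtain ⟨r, hr0, hr⟩ := ENNReal.lt_iff_exists_nnreal_btwn.1 (pos_iff_ne_zero.2 hη)
    exact ⟨r, by simpa using hr0, by simpa using hr.le⟩
  obtain ⟨f₂, G₂, hf₂, hi₂, hg₂, hN₂⟩ := h.exists_one_le_lorentzNorm hΩ hc hΩ1 hp hneg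
    (lt_min hδ hδ')
  have hmin₂ := hmin (fun x => ENNReal.ofReal (f₂ x)) hf₂.2.1.1.aemeasurable.ennreal_ofReal (by
    refine le_trans ?_ hδη
    calc ∫⁻ x in Ω, ENNReal.ofReal (f₂ x) ≤ ∫⁻ x in Ω, ‖f₂ x‖ₑ :=
          lintegral_mono fun x => Real.ofReal_le_enorm _
      _ = ENNReal.ofReal (∫ x in Ω, ‖f₂ x‖) :=
          (ofReal_integral_norm_eq_lintegral_enorm hf₂.2.1).symm
      _ ≤ ENNReal.ofReal δ' := ENNReal.ofReal_le_ofReal (hi₂.trans (min_le_right _ _)))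
  -- Numerically `1 ≤ 2 (1/8 + 1/8)` is absurd; the outer 2 is the constant of the quasi-triangle
  -- inequality.
  have hcontra : ∀ {u v : EuclideanSpace ℝ (Fin n) → ℝ≥0∞},
      1 ≤ lorentzNorm p (volume.restrict Ω) u →
      lorentzNorm p (volume.restrict Ω) v ≤ ENNReal.ofReal (K * (2 * δ)) →
      (∀ x, u x ≤ v x + min (ENNReal.ofReal (f₁ x)) (ENNReal.ofReal (f₂ x))) → False := by
    intro u v hu hv huv
    have h1 := (hu.trans (lorentzNorm_mono huv)).trans ((lorentzNorm_add_le hp _ _).trans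
      (mul_le_mul_right (add_le_add (hv.trans (ENNReal.ofReal_le_ofReal hKδ)) hmin₂) _))
    rw [← ENNReal.ofReal_add (by norm_num) (by norm_num), ← ENNReal.ofReal_ofNat 2,
      ← ENNReal.ofReal_mul two_pos.le, ENNReal.one_le_ofReal] at h1
    norm_num at h1
  have hpt : ∀ y z : ℝ, ENNReal.ofReal y ≤
      ENNReal.ofReal (y - z) + min (ENNReal.ofReal y) (ENNReal.ofReal z) := by
    intro y z
    rcases le_total y z with hyz | hyz
    · rw [min_eq_left (ENNReal.ofReal_le_ofReal hyz)]
      exact le_add_self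
    · rw [min_eq_right (ENNReal.ofReal_le_ofReal hyz)]
      refine le_trans (ENNReal.ofReal_le_ofReal ?_) ENNReal.ofReal_add_le
      linarith
  have hi₂' := hi₂.trans (min_le_left _ _)
  have hg₂' := hg₂.trans (min_le_left _ _)
  rcases hK _ _ (hf₁.sub hf₂) (2 * δ) (by positivity)
    ((integral_norm_sub_le_add hf₁.2.1 hf₂.2.1).trans
      ((add_le_add hi₁ hi₂').trans_eq (two_mul δ).symm))
    ((integral_norm_sub_le_add hf₁.2.2 hf₂.2.2).trans (by linarith)) with h1 | h1
  · refine hcontra hN₂ h1 fun x => ?_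
    rw [neg_sub, min_comm]
    exact hpt _ _
  · exact hcontra hN₁ h1 fun x => hpt _ _

end

end SobolevPoincare

end

open SobolevPoincare in
theorem theorem1 {n : ℕ} (hn : 2 ≤ n) (Ω : Set (EuclideanSpace ℝ (Fin n)))
    (hΩo : IsOpen Ω) (hΩc : IsConnected Ω) (hΩ1 : volume Ω = 1)
    (p : ℝ) (hp1 : 1 ≤ p) (hpn : p ≤ (n : ℝ) / ((n : ℝ) - 1)) :
    (1 < p → List.TFAE [PoincareLp Ω p, RearrIneq Ω p, RISobolevAll Ω p, RISobolevUniform Ω p,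
      PoincareLorentz Ω p]) ∧
    (PoincareLp Ω p ↔ PoincareLorentz Ω p) ∧
    (RearrIneq Ω p → RISobolevUniform Ω p) ∧
    (RISobolevAll Ω p → PoincareLorentz Ω p) := by
  have h_iv_i : PoincareLorentz Ω p → PoincareLp Ω p := fun h => h.poincareLp hΩ1 hp1
  have h_ii_uniform : RearrIneq Ω p → RISobolevUniform Ω p :=
    fun h => h.riSobolevUniform (by omega) hΩ1
  have h_iii_iv : RISobolevAll Ω p → PoincareLorentz Ω p :=
    fun h => h.poincareLorentz hΩo hΩc hΩ1 hp1
  refine ⟨fun hp => ?_, ⟨fun h => h.poincareLorentz hΩo hΩ1 hp1, h_iv_i⟩, h_ii_uniform, h_iii_iv⟩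
  -- The only implication that needs `1 < p`, through Hardy's inequality.
  tfae_have 1 → 2 := fun h => h.rearrIneq hΩo hΩ1 hp
  tfae_have 2 → 4 := h_ii_uniform
  tfae_have 4 → 3 := fun ⟨C, hC⟩ ρ hρ => ⟨C, hC ρ hρ⟩
  tfae_have 3 → 5 := h_iii_iv
  tfae_have 5 → 1 := h_iv_i
  tfae_finish
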